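/- **Setting.** All vector spaces, algebras and Lie algebras are over $\mathbb C$; algebras are associative and unital; algebraic groups are complex affine (linear) algebraic groups. For an algebraic group $K$, $R(K)$ is its algebra of regular functions, $\mathfrak k$ its Lie algebra, and $R(K,V)=R(K)\otimes V$ is the space of regular functions from $K$ to a vector space $V$. Algebraic actions are locally finite with regular matrix coefficients. A *Harish-Chandra pair* $(\mathcal A,K)$ consists of an algebra $\mathcal A$, an algebraic group $K$, an algebraic action $\phi$ of $K$ on $\mathcal A$ by algebra automorphisms, and a $K$-equivariant Lie algebra morphism $\psi:\mathfrak k\to\mathcal A$ such that the differential of $\phi$ is $\xi\mapsto[\psi(\xi),-]$. Let $\gamma:T\to K$ be a morphism of algebraic groups with injective differential $\mathfrak t\to\mathfrak k$; then $(\mathcal A,T)$ is a Harish-Chandra pair via $\gamma$. The *standard complex* $N(\mathfrak k)=\mathcal U(\mathfrak k)\otimes\Lambda(\mathfrak k)$ is regarded as a DG algebra, namely the enveloping DG algebra of the DG Lie algebra $\mathfrak k\xrightarrow{\ \mathrm{id}\ }\mathfrak k$ in degrees $-1,0$ (with zero bracket on the degree $-1$ part, and the adjoint action between degrees $0$ and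 $-1$). $K$ acts on it by $\operatorname{Ad}$, $\rho:\mathfrak k\to N(\mathfrak k)$ is the inclusion in degree $0$, and $n\mapsto{}^\iota n$ is its principal antiautomorphism (the graded antiautomorphism equal to $-1$ on both copies of $\mathfrak k$, with ${}^\iota(mn)=(-1)^{\deg m\deg n}\,{}^\iota n\,{}^\iota m$). An *$(\mathcal A,K,N(\mathfrak k))$-module* is a complex $V$ of vector spaces with an action $\pi$ of $\mathcal A$ by chain maps, an algebraic action $\nu$ of $K$ by chain maps, and a DG action $\omega$ of $N(\mathfrak k)$ (that is, $\omega$ is compatible with degrees and $d(\omega(n)v)=\omega(dn)v+(-1)^{\deg n}\omega(n)dv$), such that $\pi(\phi(k)a)=\nu(k)\pi(a)\nu(k)^{-1}$, $\omega(\operatorname{Ad}(k)n)=\nu(k)\omega(n)\nu(k)^{-1}$, $\pi(a)\omega(n)=\omega(n)\pi(a)$, and $d\nu(\xi)=\pi(\psi(\xi))+\omega(\rho(\xi))$ for $\xi\in\mathfrak k$. Morphisms are chain maps commuting with all the actions; they form the category $\mathcal M(\mathcal A,K,N(\mathfrak k))$. The shift $V[1]$ has components $V[1]^p=V^{p+1}$,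 differential $-d_V$, the same $\pi,\nu$, and $\omega_{V[1]}(n)=(-1)^{\deg n}\omega_V(n)$. The homotopy category $K(\mathcal A,K,N(\mathfrak k))$ has the same objects, and its morphisms are the classes of morphisms modulo homotopy, where $f,g:V\to W$ are homotopic if $f-g=hd+dh$ for a linear map $h:V\to W$ of degree $-1$ which commutes with $\pi$ and $\nu$ and satisfies $h\,\omega(n)=(-1)^{\deg n}\omega(n)\,h$. Its distinguished triangles are those isomorphic to a standard triangle $V\xrightarrow{f}W\to C_f\to V[1]$, where $C_f=V[1]\oplus W$ is the cone. A functor between two such homotopy categories is *exact* if it commutes with translation and takes distinguished triangles to distinguished triangles. The same notions apply to $(\mathcal A,T,N(\mathfrak t))$, and restricting the actions along $\gamma$ gives forgetful functors $\mathcal M(\mathcal A,K,N(\mathfrak k))\to\mathcal M(\mathcal A,T,N(\mathfrak t))$ and $K(\mathcal A,K,N(\mathfrak k))\to K(\mathcal A,T,N(\mathfrak t))$. **The functor.** Let $V$ be an $(\mathcal A,T,N(\mathfrak t))$-module. On the complex $R(K,V)$, with the differential induced by $d_V$, let $\mathfrak k$ and $T$ act by the tensor products $\lambda_{\mathfrak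 k},\lambda_T$ of the left regular action on $R(K)$ with the given actions on $V$ (so $(\lambda_T(t)F)(k)=\nu_V(t)F(\gamma(t)^{-1}k)$), and let $N(\mathfrak t)$ act by $(\lambda_N(m)F)(k)=\omega_V(m)(F(k))$. On $N(\mathfrak k)$ let $\mathfrak k$ act by left multiplication, $T$ by $\operatorname{Ad}\circ\gamma$, and $N(\mathfrak t)$ by $\omega_N(m)n=(-1)^{\deg m\deg n}\,n\,{}^\iota m$. Put $$\Gamma^{eq}_{K,T}(V)=\operatorname{Hom}^{\cdot}_{(\mathfrak k,T,N(\mathfrak t))}(N(\mathfrak k),R(K,V)),$$ whose degree $p$ component is the space of linear maps $f$ of degree $p$ commuting with the actions of $\mathfrak k$ and $T$ and satisfying $f(\omega_N(m)n)=(-1)^{p\deg m}\lambda_N(m)f(n)$ for $m\in N(\mathfrak t)$; the differential is $df=d\circ f-(-1)^pf\circ d$. With the actions $$(\pi_\Gamma(a)f)(n)(k)=\pi_V(\phi(k)a)\bigl(f(n)(k)\bigr),\qquad(\nu_\Gamma(l)f)(n)(k)=f(n)(kl),$$ $$(\omega_\Gamma(m)f)(n)(k)=(-1)^{\deg m\deg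 f}f\bigl((\operatorname{Ad}(k)\,{}^\iota m)\,n\bigr)(k),$$ $\Gamma^{eq}_{K,T}(V)$ is an $(\mathcal A,K,N(\mathfrak k))$-module, and $f\mapsto\varphi\circ f$ for morphisms $\varphi$ makes $\Gamma^{eq}_{K,T}$ a functor $\mathcal M(\mathcal A,T,N(\mathfrak t))\to\mathcal M(\mathcal A,K,N(\mathfrak k))$. **Proposition.** The functor $\Gamma^{eq}_{K,T}$ induces a functor $K(\mathcal A,T,N(\mathfrak t))\to K(\mathcal A,K,N(\mathfrak k))$ between the homotopy categories (the functor on homotopy classes which agrees with $\Gamma^{eq}_{K,T}$ on modules and on morphisms of modules). This induced functor is exact, and it is right adjoint to the forgetful functor $K(\mathcal A,K,N(\mathfrak k))\to K(\mathcal A,T,N(\mathfrak t))$. -/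

import Mathlib

open CategoryTheory TensorProduct

universe u v w

namespace HC

noncomputable section

/-! ## Affine algebraic groups over `ℂ` -/

/-- A complex (affine) algebraic group structure on a group `K`: the algebra of regular functions
is a finitely generated algebra of functions on `K`, the points of `K` are exactly its
characters, and multiplication and inversion are morphisms of varieties. -/
class AffineAlgebraicGroup (K : Type u) [Group K] where
  /-- the regular functions -/
  coord : Subalgebra ℂ (K → ℂ)
  fg : coord.FG
  points : ∀ χ : coord →ₐ[ℂ] ℂ, ∃! k : K, ∀ f : coord, χ f = f.1 k
  mul_regular : ∀ f ∈ coord, ∃ (n : ℕ) (g h : Fin n → coord),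
    ∀ x y : K, f (x * y) = ∑ i, (g i).1 x * (h i).1 y
  inv_regular : ∀ f ∈ coord, (fun x => f x⁻¹) ∈ coord

/-- The algebra `R(K)` of regular functions on `K`. -/
def Reg (K : Type u) [Group K] [AffineAlgebraicGroup K] : Type u :=
  ↥(AffineAlgebraicGroup.coord (K := K))

instance (K : Type u) [Group K] [AffineAlgebraicGroup K] : CommRing (Reg K) :=
  inferInstanceAs (CommRing ↥(AffineAlgebraicGroup.coord (K := K)))

instance (K : Type u) [Group K] [AffineAlgebraicGroup K] : Algebra ℂ (Reg K) :=
  inferInstanceAs (Algebra ℂ ↥(AffineAlgebraicGroup.coord (K := K)))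

section Group

variable {K : Type u} [Group K] [AffineAlgebraicGroup K]
variable {V : Type v} [AddCommGroup V] [Module ℂ V]
variable {W : Type w} [AddCommGroup W] [Module ℂ W]

/-- A regular function as a function. -/
def Reg.val (f : Reg K) : K → ℂ := Subtype.val f

theorem Reg.ext' {f g : Reg K} (h : ∀ k, f.val k = g.val k) : f = g := Subtype.ext (funext h)

/-- A regular function as an element of `R(K)`. -/
def Reg.mk (f : K → ℂ) (hf : f ∈ AffineAlgebraicGroup.coord (K := K)) : Reg K := ⟨f, hf⟩

@[simp] theorem Reg.mk_apply (f : K → ℂ) (hf) (k : K) : (Reg.mk f hf).val k = f k := rfl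
theorem Reg.exists_mul (f : Reg K) : ∃ (n : ℕ) (g h : Fin n → Reg K),
    ∀ x y : K, f.val (x * y) = ∑ i, (g i).val x * (h i).val y :=
  AffineAlgebraicGroup.mul_regular f.val f.2

@[simp] theorem Reg.one_apply (k : K) : (1 : Reg K).val k = 1 := rfl
@[simp] theorem Reg.zero_apply (k : K) : (0 : Reg K).val k = 0 := rfl
@[simp] theorem Reg.add_apply (f g : Reg K) (k : K) : (f + g).val k = f.val k + g.val k := rfl
@[simp] theorem Reg.mul_apply (f g : Reg K) (k : K) : (f * g).val k = f.val k * g.val k := rfl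
@[simp] theorem Reg.smul_apply (c : ℂ) (f : Reg K) (k : K) : (c • f).val k = c * f.val k := rfl

/-- The translate `x ↦ f (k x)` of a regular function. -/
def leftTrans (k : K) : Reg K →ₐ[ℂ] Reg K where
  toFun f := ⟨fun x => f.val (k * x), by
    obtain ⟨n, g, h, H⟩ := AffineAlgebraicGroup.mul_regular f.val f.2
    have : (fun x => f.val (k * x)) = ∑ i, (g i).val k • (h i).1 := by
      funext x; simp [H, Finset.sum_apply]
    rw [this]
    exact Subalgebra.sum_mem _ fun i _ => Subalgebra.smul_mem _ (h i).2 _⟩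
  map_one' := rfl
  map_mul' _ _ := rfl
  map_zero' := rfl
  map_add' _ _ := rfl
  commutes' _ := rfl

/-- The translate `x ↦ f (x k)` of a regular function. -/
def rightTrans (k : K) : Reg K →ₐ[ℂ] Reg K where
  toFun f := ⟨fun x => f.val (x * k), by
    obtain ⟨n, g, h, H⟩ := AffineAlgebraicGroup.mul_regular f.val f.2
    have : (fun x => f.val (x * k)) = ∑ i, (h i).val k • (g i).1 := by
      funext x; simp [H, Finset.sum_apply, mul_comm]
    rw [this]
    exact Subalgebra.sum_mem _ fun i _ => Subalgebra.smul_mem _ (g i).2 _⟩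
  map_one' := rfl
  map_mul' _ _ := rfl
  map_zero' := rfl
  map_add' _ _ := rfl
  commutes' _ := rfl

@[simp] theorem leftTrans_apply (k x : K) (f : Reg K) : (leftTrans k f).val x = f.val (k * x) := rfl
@[simp] theorem rightTrans_apply (k x : K) (f : Reg K) : (rightTrans k f).val x = f.val (x * k) := rfl

/-- Evaluation at a point, as a linear functional on `R(K)`. -/
def evalAt (k : K) : Reg K →ₗ[ℂ] ℂ where
  toFun f := f.val k
  map_add' _ _ := rfl
  map_smul' _ _ := rfl

@[simp] theorem evalAt_apply (k : K) (f : Reg K) : evalAt k f = f.val k := rfl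

variable (K) in
/-- The Lie algebra of `K`: the left-invariant derivations of `R(K)`. -/
def lieSubalgebra : LieSubalgebra ℂ (Derivation ℂ (Reg K) (Reg K)) where
  carrier := {D | ∀ (k : K) (f : Reg K), D (leftTrans k f) = leftTrans k (D f)}
  add_mem' {a b} ha hb k f := by
    change a _ + b _ = leftTrans k (a f + b f)
    rw [ha, hb, map_add]
  zero_mem' k f := by simp
  smul_mem' c a ha k f := by
    change c • a _ = leftTrans k (c • a f)
    rw [ha, map_smul]
  lie_mem' {a b} ha hb k f := by
    rw [Derivation.commutator_apply, Derivation.commutator_apply, hb, ha, ha, hb, map_sub]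

variable (K) in
/-- The Lie algebra `𝔨` of `K`. -/
def LieAlg : Type u := ↥(lieSubalgebra K)

instance : LieRing (LieAlg K) := inferInstanceAs (LieRing ↥(lieSubalgebra K))

instance : LieAlgebra ℂ (LieAlg K) := inferInstanceAs (LieAlgebra ℂ ↥(lieSubalgebra K))

/-- A Lie algebra element as a derivation of `R(K)`. -/
def LieAlg.der (ξ : LieAlg K) : Derivation ℂ (Reg K) (Reg K) := Subtype.val ξ

theorem LieAlg.der_leftTrans (ξ : LieAlg K) (k : K) (f : Reg K) :
    ξ.der (leftTrans k f) = leftTrans k (ξ.der f) := Subtype.property ξ k f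

theorem LieAlg.ext_der {ξ η : LieAlg K} (h : ∀ f, ξ.der f = η.der f) : ξ = η :=
  Subtype.ext (Derivation.ext h)

/-- The tangent vector at the identity defined by `ξ ∈ 𝔨`. -/
def tangent (ξ : LieAlg K) : Reg K →ₗ[ℂ] ℂ := (evalAt 1).comp (ξ.der : Reg K →ₗ[ℂ] Reg K)

@[simp] theorem tangent_apply (ξ : LieAlg K) (f : Reg K) : tangent ξ f = (ξ.der f).val 1 := rfl

theorem LieAlg.apply_eq (ξ : LieAlg K) (f : Reg K) (x : K) :
    (ξ.der f).val x = tangent ξ (leftTrans x f) := by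
  rw [tangent_apply, LieAlg.der_leftTrans, leftTrans_apply, mul_one]

theorem LieAlg.ext' {ξ η : LieAlg K} (h : ∀ f, tangent ξ f = tangent η f) : ξ = η := by
  apply LieAlg.ext_der
  intro f
  apply Reg.ext'
  intro k
  rw [LieAlg.apply_eq, LieAlg.apply_eq, h]

/-- A functional on `R(K)` applied to `V`-valued regular functions, elements of `R(K) ⊗ V`. -/
def extend (p : Reg K →ₗ[ℂ] ℂ) : Reg K ⊗[ℂ] V →ₗ[ℂ] V :=
  (TensorProduct.lid ℂ V).toLinearMap ∘ₗ LinearMap.rTensor V p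

@[simp] theorem extend_tmul (p : Reg K →ₗ[ℂ] ℂ) (f : Reg K) (v : V) :
    extend p (f ⊗ₜ v) = p f • v := by simp [extend]

/-- `F : K → V` is a `V`-valued regular function, i.e. an element of `R(K, V) = R(K) ⊗ V`. -/
def IsRegular (F : K → V) : Prop :=
  ∃ t : Reg K ⊗[ℂ] V, ∀ k, extend (evalAt k) t = F k

/-- `F : K → V` is regular and `w` is its derivative at `1` in the direction `ξ ∈ 𝔨`. -/
def HasDerivOne (ξ : LieAlg K) (F : K → V) (w : V) : Prop :=
  ∃ t : Reg K ⊗[ℂ] V, (∀ k, extend (evalAt k) t = F k) ∧ extend (tangent ξ) t = w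

theorem HasDerivOne.isRegular {ξ : LieAlg K} {F : K → V} {w : V} (h : HasDerivOne ξ F w) :
    IsRegular F := ⟨h.choose, h.choose_spec.1⟩

theorem IsRegular.hasDerivOne {F : K → V} (h : IsRegular F) (ξ : LieAlg K) :
    ∃ w, HasDerivOne ξ F w := by
  obtain ⟨t, ht⟩ := h
  exact ⟨_, t, ht, rfl⟩

theorem extend_dual (p : Reg K →ₗ[ℂ] ℂ) (l : V →ₗ[ℂ] ℂ) (t : Reg K ⊗[ℂ] V) :
    l (extend p t) = p (TensorProduct.rid ℂ _ (LinearMap.lTensor _ l t)) := by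
  induction t with
  | zero => simp
  | tmul f v => simp [mul_comm]
  | add a b ha hb => simp only [map_add, ha, hb]

theorem extend_congr (p : Reg K →ₗ[ℂ] ℂ) {t s : Reg K ⊗[ℂ] V}
    (h : ∀ k, extend (evalAt k) t = extend (evalAt k) s) : extend p t = extend p s := by
  rw [← sub_eq_zero, ← Module.forall_dual_apply_eq_zero_iff ℂ]
  intro l
  rw [map_sub, extend_dual, extend_dual, sub_eq_zero]
  congr 1
  apply Reg.ext'
  intro k
  have := congrArg l (h k)
  rwa [extend_dual, extend_dual] at this

theorem HasDerivOne.unique {ξ : LieAlg K} {F : K → V} {w w' : V} (h : HasDerivOne ξ F w)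
    (h' : HasDerivOne ξ F w') : w = w' := by
  obtain ⟨t, ht, rfl⟩ := h
  obtain ⟨s, hs, rfl⟩ := h'
  exact extend_congr _ fun k => by rw [ht, hs]

theorem extend_map (p : Reg K →ₗ[ℂ] ℂ) (l : V →ₗ[ℂ] W) (t : Reg K ⊗[ℂ] V) :
    extend p (LinearMap.lTensor _ l t) = l (extend p t) := by
  induction t with
  | zero => simp
  | tmul f v => simp
  | add a b ha hb => simp only [map_add, ha, hb]

theorem HasDerivOne.map {ξ : LieAlg K} {F : K → V} {w : V} (h : HasDerivOne ξ F w)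
    (l : V →ₗ[ℂ] W) : HasDerivOne ξ (fun k => l (F k)) (l w) := by
  obtain ⟨t, ht, rfl⟩ := h
  exact ⟨LinearMap.lTensor _ l t, fun k => by rw [extend_map, ht], extend_map _ _ _⟩

theorem HasDerivOne.add {ξ : LieAlg K} {F G : K → V} {w z : V} (h : HasDerivOne ξ F w)
    (h' : HasDerivOne ξ G z) : HasDerivOne ξ (fun k => F k + G k) (w + z) := by
  obtain ⟨t, ht, rfl⟩ := h
  obtain ⟨s, hs, rfl⟩ := h'
  exact ⟨t + s, fun k => by rw [map_add, ht, hs], map_add _ _ _⟩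

theorem HasDerivOne.smul {ξ : LieAlg K} {F : K → V} {w : V} (h : HasDerivOne ξ F w) (c : ℂ) :
    HasDerivOne ξ (fun k => c • F k) (c • w) := h.map (c • LinearMap.id)

theorem HasDerivOne.const (ξ : LieAlg K) (v : V) : HasDerivOne ξ (fun _ : K => v) 0 :=
  ⟨1 ⊗ₜ v, fun k => by simp, by simp⟩

theorem IsRegular.map {F : K → V} (h : IsRegular F) (l : V →ₗ[ℂ] W) :
    IsRegular (fun k => l (F k)) := by
  obtain ⟨t, ht⟩ := h
  exact ⟨LinearMap.lTensor _ l t, fun k => by rw [extend_map, ht]⟩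

theorem IsRegular.add {F G : K → V} (h : IsRegular F) (h' : IsRegular G) :
    IsRegular (fun k => F k + G k) := by
  obtain ⟨t, ht⟩ := h
  obtain ⟨s, hs⟩ := h'
  exact ⟨t + s, fun k => by rw [map_add, ht, hs]⟩

theorem IsRegular.zero : IsRegular (fun _ : K => (0 : V)) := ⟨0, fun k => by simp⟩

theorem IsRegular.smul {F : K → V} (h : IsRegular F) (c : ℂ) :
    IsRegular (fun k => c • F k) := h.map (c • LinearMap.id)

theorem IsRegular.dual {F : K → V} (h : IsRegular F) (l : V →ₗ[ℂ] ℂ) :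
    (fun k => l (F k)) ∈ AffineAlgebraicGroup.coord (K := K) := by
  obtain ⟨t, ht⟩ := h
  have : (fun k => l (F k)) = (TensorProduct.rid ℂ _ (LinearMap.lTensor (Reg K) l t)).1 := by
    funext k
    rw [← ht, extend_dual]; rfl
  rw [this]
  exact (TensorProduct.rid ℂ _ (LinearMap.lTensor (Reg K) l t)).2

variable {U : Type*} [AddCommGroup U] [Module ℂ U]

theorem bilin_aux (B : V →ₗ[ℂ] W →ₗ[ℂ] U) (t : Reg K ⊗[ℂ] V) (s : Reg K ⊗[ℂ] W) :
    ∃ r : Reg K ⊗[ℂ] U,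
      (∀ k, extend (evalAt k) r = B (extend (evalAt k) t) (extend (evalAt k) s)) ∧
      ∀ ξ : LieAlg K, extend (tangent ξ) r = B (extend (tangent ξ) t) (extend (evalAt 1) s) +
        B (extend (evalAt 1) t) (extend (tangent ξ) s) := by
  induction t with
  | zero => exact ⟨0, by simp⟩
  | add a b ha hb =>
    obtain ⟨r, h1, h2⟩ := ha
    obtain ⟨r', h1', h2'⟩ := hb
    refine ⟨r + r', fun k => by simp [h1, h1'], fun ξ => ?_⟩
    simp only [map_add, h2, h2', LinearMap.add_apply]; abel
  | tmul f v =>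
    induction s with
    | zero => exact ⟨0, by simp⟩
    | add a b ha hb =>
      obtain ⟨r, h1, h2⟩ := ha
      obtain ⟨r', h1', h2'⟩ := hb
      refine ⟨r + r', fun k => by simp [h1, h1'], fun ξ => ?_⟩
      simp only [map_add, h2, h2']; abel
    | tmul g w =>
      refine ⟨(f * g) ⊗ₜ B v w, fun k => ?_, fun ξ => ?_⟩
      · simp [mul_smul, smul_comm (f.val k) (g.val k)]
      · simp only [extend_tmul, tangent_apply, Derivation.leibniz, map_smul, LinearMap.smul_apply,
          smul_smul, ← add_smul, evalAt_apply]
        congr 1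
        simp [mul_comm, add_comm]

theorem HasDerivOne.bilin {ξ : LieAlg K} {F : K → V} {G : K → W} {v : V} {w : W}
    (h : HasDerivOne ξ F v) (h' : HasDerivOne ξ G w) (B : V →ₗ[ℂ] W →ₗ[ℂ] U) :
    HasDerivOne ξ (fun k => B (F k) (G k)) (B v (G 1) + B (F 1) w) := by
  obtain ⟨t, ht, rfl⟩ := h
  obtain ⟨s, hs, rfl⟩ := h'
  obtain ⟨r, h1, h2⟩ := bilin_aux B t s
  exact ⟨r, fun k => by rw [h1, ht, hs], by rw [h2, ht, hs]⟩

theorem IsRegular.bilin {F : K → V} {G : K → W} (h : IsRegular F) (h' : IsRegular G)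
    (B : V →ₗ[ℂ] W →ₗ[ℂ] U) : IsRegular (fun k => B (F k) (G k)) := by
  obtain ⟨t, ht⟩ := h
  obtain ⟨s, hs⟩ := h'
  obtain ⟨r, h1, h2⟩ := bilin_aux B t s
  exact ⟨r, fun k => by rw [h1, ht, hs]⟩

/-- Pulling back along a map of groups (or of varieties) respecting regular functions. -/
theorem extend_pullback {T : Type*} [Group T] [AffineAlgebraicGroup T] (Θ : Reg K →ₗ[ℂ] Reg T)
    (p : Reg T →ₗ[ℂ] ℂ) (t : Reg K ⊗[ℂ] V) :
    extend p (LinearMap.rTensor V Θ t) = extend (p ∘ₗ Θ) t := by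
  induction t with
  | zero => simp
  | tmul f v => simp
  | add a b ha hb => simp only [map_add, ha, hb]

theorem IsRegular.pullback {T : Type*} [Group T] [AffineAlgebraicGroup T] {F : K → V}
    (h : IsRegular F) (Θ : Reg K →ₗ[ℂ] Reg T) (θ : T → K)
    (hΘ : ∀ f x, (Θ f).val x = f.val (θ x)) : IsRegular (fun x => F (θ x)) := by
  obtain ⟨t, ht⟩ := h
  refine ⟨LinearMap.rTensor V Θ t, fun x => ?_⟩
  have : evalAt x ∘ₗ Θ = evalAt (θ x) := LinearMap.ext fun f => hΘ f x
  rw [extend_pullback, this, ht]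

theorem IsRegular.mul_right {F : K → V} (h : IsRegular F) (k : K) :
    IsRegular (fun x => F (x * k)) :=
  h.pullback (rightTrans k).toLinearMap (fun x => x * k) fun _ _ => rfl

theorem IsRegular.mul_left {F : K → V} (h : IsRegular F) (k : K) :
    IsRegular (fun x => F (k * x)) :=
  h.pullback (leftTrans k).toLinearMap (fun x => k * x) fun _ _ => rfl

/-- An action of `K` by linear operators is algebraic if `V` is the union of finite-dimensional
invariant subspaces on which all matrix coefficients are regular functions. -/
def IsAlgebraic (ρ : K → V →ₗ[ℂ] V) : Prop :=
  ∀ v : V, ∃ U : Submodule ℂ V, v ∈ U ∧ FiniteDimensional ℂ U ∧ (∀ k, ∀ u ∈ U, ρ k u ∈ U) ∧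
    ∀ u ∈ U, ∀ l : V →ₗ[ℂ] ℂ, (fun k => l (ρ k u)) ∈ AffineAlgebraicGroup.coord (K := K)

theorem isRegular_of_finiteDimensional {F : K → V} (U : Submodule ℂ V) [FiniteDimensional ℂ U]
    (hF : ∀ k, F k ∈ U)
    (h : ∀ l : V →ₗ[ℂ] ℂ, (fun k => l (F k)) ∈ AffineAlgebraicGroup.coord (K := K)) :
    IsRegular F := by
  let b := Module.finBasis ℂ U
  choose c hc using fun i => LinearMap.exists_extend (b.coord i)
  refine ⟨∑ i, Reg.mk _ (h (c i)) ⊗ₜ[ℂ] (b i : V), fun k => ?_⟩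
  have h1 : ∀ i, c i (F k) = b.repr ⟨F k, hF k⟩ i := fun i =>
    LinearMap.congr_fun (hc i) ⟨F k, hF k⟩
  have h2 := congrArg U.subtype (b.sum_repr ⟨F k, hF k⟩)
  rw [map_sum] at h2
  simp only [map_sum, extend_tmul, evalAt_apply, Reg.mk_apply, h1]
  exact h2

theorem IsAlgebraic.isRegular {ρ : K → V →ₗ[ℂ] V} (h : IsAlgebraic ρ) (v : V) :
    IsRegular (fun k => ρ k v) := by
  obtain ⟨U, hv, hU, hinv, hl⟩ := h v
  exact isRegular_of_finiteDimensional U (fun k => hinv k v hv) (hl v hv)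

theorem extend_mem_span (t : Reg K ⊗[ℂ] V) :
    ∃ U : Submodule ℂ V, FiniteDimensional ℂ U ∧ ∀ p, extend p t ∈ U := by
  induction t with
  | zero => exact ⟨⊥, inferInstance, by simp⟩
  | tmul f v =>
    exact ⟨ℂ ∙ v, inferInstance, fun p => by
      rw [extend_tmul]; exact Submodule.smul_mem _ _ (Submodule.mem_span_singleton_self v)⟩
  | add a b ha hb =>
    obtain ⟨U, hU, h⟩ := ha
    obtain ⟨U', hU', h'⟩ := hb
    exact ⟨U ⊔ U', inferInstance, fun p => by
      rw [map_add]; exact Submodule.add_mem_sup (h p) (h' p)⟩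

/-- A criterion for algebraicity. -/
theorem isAlgebraic_of_injective {ρ : K → V →ₗ[ℂ] V} (one : ρ 1 = LinearMap.id)
    (mul : ∀ k l v, ρ (k * l) v = ρ k (ρ l v)) (E : V →ₗ[ℂ] W) (hE : Function.Injective E)
    (h : ∀ v, IsRegular (fun k => E (ρ k v))) : IsAlgebraic ρ := by
  intro v
  obtain ⟨e, he⟩ := LinearMap.exists_leftInverse_of_injective E (LinearMap.ker_eq_bot.2 hE)
  have he' : ∀ v, e (E v) = v := fun v => LinearMap.congr_fun he v
  have key : ∀ u, IsRegular (fun k => ρ k u) := fun u => by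
    simpa only [he'] using (h u).map e
  obtain ⟨t, ht⟩ := key v
  obtain ⟨Y, hY, hY'⟩ := extend_mem_span t
  refine ⟨Submodule.span ℂ (Set.range fun k => ρ k v), ?_, ?_, ?_, fun u _ l => (key u).dual l⟩
  · exact Submodule.subset_span ⟨1, by simp [one]⟩
  · refine Submodule.finiteDimensional_of_le (S₂ := Y) (Submodule.span_le.2 ?_)
    rintro _ ⟨k, rfl⟩
    simp only [← ht]
    exact hY' _
  · intro k u hu
    have : Submodule.span ℂ (Set.range fun k => ρ k v) ≤
        (Submodule.span ℂ (Set.range fun k => ρ k v)).comap (ρ k) := by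
      refine Submodule.span_le.2 ?_
      rintro _ ⟨l, rfl⟩
      exact Submodule.subset_span ⟨k * l, mul k l v⟩
    exact this hu

theorem isAlgebraic_of_isRegular {ρ : K → V →ₗ[ℂ] V} (one : ρ 1 = LinearMap.id)
    (mul : ∀ k l v, ρ (k * l) v = ρ k (ρ l v))
    (h : ∀ v, IsRegular (fun k => ρ k v)) : IsAlgebraic ρ :=
  isAlgebraic_of_injective one mul LinearMap.id Function.injective_id h

/-! ### The adjoint action -/

theorem rightTrans_rightTrans_inv (k : K) (f : Reg K) : rightTrans k (rightTrans k⁻¹ f) = f :=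
  Reg.ext' fun x => congrArg f.val (mul_inv_cancel_right x k)

theorem rightTrans_inv_rightTrans (k : K) (f : Reg K) : rightTrans k⁻¹ (rightTrans k f) = f :=
  Reg.ext' fun x => congrArg f.val (inv_mul_cancel_right x k)

theorem rightTrans_leftTrans (k l : K) (f : Reg K) :
    rightTrans k (leftTrans l f) = leftTrans l (rightTrans k f) :=
  Reg.ext' fun x => congrArg f.val (mul_assoc l x k).symm

/-- Conjugation of a left-invariant derivation by the right translation by `k`. -/
def conjDerivation (k : K) (ξ : LieAlg K) : LieAlg K :=
  ⟨Derivation.mk'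
      ((rightTrans k).toLinearMap ∘ₗ (ξ.der : Reg K →ₗ[ℂ] Reg K) ∘ₗ (rightTrans k⁻¹).toLinearMap)
      (fun f g => by
        change rightTrans k (ξ.der (rightTrans k⁻¹ (f * g))) =
          f * rightTrans k (ξ.der (rightTrans k⁻¹ g)) +
          g * rightTrans k (ξ.der (rightTrans k⁻¹ f))
        rw [map_mul, Derivation.leibniz, map_add, smul_eq_mul, smul_eq_mul,
          map_mul, map_mul, rightTrans_rightTrans_inv, rightTrans_rightTrans_inv]), fun l f => by
      change rightTrans k (ξ.der (rightTrans k⁻¹ (leftTrans l f))) =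
        leftTrans l (rightTrans k (ξ.der (rightTrans k⁻¹ f)))
      rw [rightTrans_leftTrans, LieAlg.der_leftTrans, rightTrans_leftTrans]⟩

theorem conjDerivation_apply (k : K) (ξ : LieAlg K) (f : Reg K) :
    (conjDerivation k ξ).der f = rightTrans k (ξ.der (rightTrans k⁻¹ f)) := rfl

/-- The adjoint action of `k ∈ K` on `𝔨`: conjugation by right translation. -/
def Ad (k : K) : LieAlg K →ₗ⁅ℂ⁆ LieAlg K where
  toFun := conjDerivation k
  map_add' ξ η := by
    apply LieAlg.ext_der; intro f
    change rightTrans k (ξ.der _ + η.der _) = _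
    rw [map_add]; rfl
  map_smul' c ξ := by
    apply LieAlg.ext_der; intro f
    change rightTrans k (c • ξ.der _) = _
    rw [map_smul]; rfl
  map_lie' {ξ η} := by
    apply LieAlg.ext_der; intro f
    change rightTrans k (⁅ξ.der, η.der⁆ _) = ⁅(conjDerivation k ξ).der, (conjDerivation k η).der⁆ f
    rw [Derivation.commutator_apply, Derivation.commutator_apply, conjDerivation_apply,
      conjDerivation_apply, conjDerivation_apply, conjDerivation_apply,
      rightTrans_inv_rightTrans, rightTrans_inv_rightTrans, map_sub]
    rfl

theorem Ad_apply (k : K) (ξ : LieAlg K) (f : Reg K) :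
    (Ad k ξ).der f = rightTrans k (ξ.der (rightTrans k⁻¹ f)) := rfl

theorem tangent_Ad (k : K) (ξ : LieAlg K) (f : Reg K) :
    tangent (Ad k ξ) f = tangent ξ (leftTrans k (rightTrans k⁻¹ f)) := by
  rw [tangent_apply, Ad_apply, rightTrans_apply, one_mul, LieAlg.apply_eq]

theorem Ad_one : Ad (1 : K) = LieHom.id := by
  ext1 ξ
  apply LieAlg.ext'
  intro f
  rw [tangent_Ad]
  congr 1
  exact Reg.ext' fun x => by simp

theorem Ad_mul (k l : K) : Ad (k * l) = (Ad k).comp (Ad l) := by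
  ext1 ξ
  apply LieAlg.ext'
  intro f
  rw [LieHom.comp_apply, tangent_Ad, tangent_Ad, tangent_Ad]
  congr 1
  exact Reg.ext' fun x => by simp [mul_assoc]

/-- Moving a translation from one side to the other changes the direction by `Ad`. -/
theorem HasDerivOne.conj {ξ : LieAlg K} {F : K → V} {k : K} {w : V}
    (h : HasDerivOne (Ad k ξ) (fun x => F (x * k)) w) : HasDerivOne ξ (fun x => F (k * x)) w := by
  obtain ⟨t, ht, rfl⟩ := h
  let Θ : Reg K →ₗ[ℂ] Reg K := (leftTrans k).toLinearMap ∘ₗ (rightTrans k⁻¹).toLinearMap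
  refine ⟨LinearMap.rTensor V Θ t, fun x => ?_, ?_⟩
  · have : evalAt x ∘ₗ Θ = evalAt (k * x * k⁻¹) := LinearMap.ext fun f => by simp [Θ]
    rw [extend_pullback, this, ht]
    simp
  · rw [extend_pullback]
    congr 1
    exact congrArg extend (LinearMap.ext fun f => (tangent_Ad k ξ f).symm)

end Group

section Group2
variable {K : Type u} [Group K] [AffineAlgebraicGroup K]
variable {V : Type v} [AddCommGroup V] [Module ℂ V]

instance : FiniteDimensional ℂ (LieAlg K) := by
  obtain ⟨s, hs⟩ := AffineAlgebraicGroup.fg (K := K)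
  have hsub : ∀ x : s, x.1 ∈ AffineAlgebraicGroup.coord (K := K) := fun x => by
    rw [← hs]; exact Algebra.subset_adjoin x.2
  let e : LieAlg K →ₗ[ℂ] (s → ℂ) :=
    { toFun := fun ξ x => tangent ξ ⟨x.1, hsub x⟩
      map_add' := fun _ _ => rfl
      map_smul' := fun _ _ => rfl }
  refine FiniteDimensional.of_injective e ((injective_iff_map_eq_zero e).2 fun ξ hξ => ?_)
  apply LieAlg.ext'
  have key : ∀ f (hf : f ∈ Algebra.adjoin ℂ (s : Set (K → ℂ))),
      tangent ξ ⟨f, hs ▸ hf⟩ = 0 := by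
    intro f hf
    induction hf using Algebra.adjoin_induction with
    | mem x hx => exact congrFun hξ ⟨x, hx⟩
    | algebraMap r =>
      exact congrArg (fun g : Reg K => g.val 1) (ξ.der.map_algebraMap r)
    | add x y hx hy ihx ihy =>
      have := (tangent ξ).map_add ⟨x, hs ▸ hx⟩ ⟨y, hs ▸ hy⟩
      rw [ihx, ihy, add_zero] at this
      exact this
    | mul x y hx hy ihx ihy =>
      have h := ξ.der.leibniz ⟨x, hs ▸ hx⟩ ⟨y, hs ▸ hy⟩
      have h2 := congrArg (fun g : Reg K => g.val 1) h
      change tangent ξ _ = x 1 * tangent ξ ⟨y, hs ▸ hy⟩ + y 1 * tangent ξ ⟨x, hs ▸ hx⟩ at h2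
      rw [ihx, ihy, mul_zero, mul_zero, add_zero] at h2
      exact h2
  intro f
  have := key f.val (hs.symm ▸ f.2)
  rw [show (⟨f.val, _⟩ : Reg K) = f from rfl] at this
  rw [this]
  rfl

theorem Reg.sum_apply {ι : Type*} (S : Finset ι) (F : ι → Reg K) (x : K) :
    (∑ i ∈ S, F i : Reg K).val x = ∑ i ∈ S, (F i).val x :=
  map_sum (evalAt x) F S

/-- Every functional on `𝔨` is evaluation on a regular function. -/
theorem exists_tangent_eq (l : LieAlg K →ₗ[ℂ] ℂ) : ∃ f : Reg K, ∀ ξ, l ξ = tangent ξ f := by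
  let p : Reg K →ₗ[ℂ] Module.Dual ℂ (LieAlg K) :=
    { toFun := fun f => { toFun := fun ξ => tangent ξ f
                          map_add' := fun _ _ => rfl
                          map_smul' := fun _ _ => rfl }
      map_add' := fun f g => LinearMap.ext fun ξ => map_add (tangent ξ) f g
      map_smul' := fun c f => LinearMap.ext fun ξ => map_smul (tangent ξ) c f }
  have hp : LinearMap.range p = ⊤ := by
    by_contra hne
    obtain ⟨φ, hφ0, hφ⟩ := Submodule.exists_le_ker_of_lt_top _ (lt_top_iff_ne_top.2 hne)
    obtain ⟨ξ, rfl⟩ := (Module.evalEquiv ℂ (LieAlg K)).surjective φ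
    apply hφ0
    have : ξ = 0 := by
      apply LieAlg.ext'
      intro f
      exact (hφ ⟨f, rfl⟩ : tangent ξ f = 0)
    rw [this]
    exact (Module.evalEquiv ℂ (LieAlg K)).toLinearMap.map_zero
  obtain ⟨f, hf⟩ := LinearMap.range_eq_top.1 hp l
  exact ⟨f, fun ξ => by rw [← hf]; rfl⟩

/-- Regular functions of two variables: `x, y ↦ f (x y)` in tensor form. -/
theorem exists_comul (f : Reg K) : ∃ t : Reg K ⊗[ℂ] Reg K, ∀ y,
    extend (evalAt y) t = rightTrans y f := by
  obtain ⟨n, g, h, H⟩ := f.exists_mul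
  refine ⟨∑ i, h i ⊗ₜ g i, fun y => Reg.ext' fun x => ?_⟩
  rw [rightTrans_apply, H]
  rw [map_sum, Reg.sum_apply]
  exact Finset.sum_congr rfl fun i _ => by
    rw [extend_tmul, Reg.smul_apply, evalAt_apply, mul_comm]

/-- Inversion on regular functions. -/
def invReg : Reg K →ₗ[ℂ] Reg K where
  toFun f := Reg.mk (fun x => f.val x⁻¹) (AffineAlgebraicGroup.inv_regular _ f.2)
  map_add' _ _ := rfl
  map_smul' _ _ := rfl

theorem hasDerivOne_reg (ξ : LieAlg K) (f : Reg K) :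
    HasDerivOne ξ (fun x => f.val x) (tangent ξ f) :=
  ⟨f ⊗ₜ 1, fun k => by simp, by simp⟩

theorem hasDerivOne_rightTrans (ξ : LieAlg K) (f : Reg K) :
    HasDerivOne ξ (fun y => rightTrans y f) (ξ.der f) := by
  obtain ⟨t, ht⟩ := exists_comul f
  refine ⟨t, ht, Reg.ext' fun x => ?_⟩
  have h1 : HasDerivOne ξ (fun y => evalAt x (rightTrans y f)) (evalAt x (extend (tangent ξ) t)) :=
    HasDerivOne.map ⟨t, ht, rfl⟩ (evalAt x)
  have h2 := hasDerivOne_reg ξ (leftTrans x f)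
  rw [LieAlg.apply_eq]
  exact h1.unique h2

theorem HasDerivOne.inv {ξ : LieAlg K} {F : K → V} {w : V} (h : HasDerivOne ξ F w) :
    HasDerivOne ξ (fun x => F x⁻¹) (-w) := by
  obtain ⟨t, ht, rfl⟩ := h
  refine ⟨LinearMap.rTensor V invReg t, fun x => ?_, ?_⟩
  · have : evalAt x ∘ₗ invReg = evalAt x⁻¹ := rfl
    rw [extend_pullback, this, ht]
  · rw [extend_pullback]
    have : tangent ξ ∘ₗ invReg = - tangent ξ := by
      apply LinearMap.ext
      intro f
      -- differentiate `x ↦ f (x * x⁻¹)`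
      obtain ⟨n, g, h, H⟩ := f.exists_mul
      have h0 : (∑ i, g i * invReg (h i) : Reg K) = algebraMap ℂ (Reg K) (f.val 1) := by
        apply Reg.ext'
        intro x
        have := H x x⁻¹
        rw [mul_inv_cancel] at this
        rw [Reg.sum_apply]
        exact this.symm
      have h1 := congrArg (tangent ξ) h0
      have e1 : tangent ξ (algebraMap ℂ (Reg K) (f.val 1)) = 0 := by
        rw [tangent_apply, Derivation.map_algebraMap]; rfl
      have e2 : ∀ a b : Reg K, tangent ξ (a * b) = a.val 1 * tangent ξ b + b.val 1 * tangent ξ a := by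
        intro a b
        rw [tangent_apply, Derivation.leibniz]; rfl
      have e3 : (∑ i, (h i).val 1 • g i : Reg K) = f := by
        apply Reg.ext'
        intro x
        have := H x 1
        rw [mul_one] at this
        rw [Reg.sum_apply]
        rw [this]
        exact Finset.sum_congr rfl fun i _ => mul_comm _ _
      have e4 : (∑ i, (g i).val 1 • h i : Reg K) = f := by
        apply Reg.ext'
        intro x
        have := H 1 x
        rw [one_mul] at this
        rw [Reg.sum_apply]
        rw [this]
        rfl
      rw [e1, map_sum] at h1
      simp only [e2, Finset.sum_add_distrib] at h1
      have e5 : ∑ i, (g i).val 1 * tangent ξ (invReg (h i)) = tangent ξ (invReg f) := by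
        conv_rhs => rw [← e4]
        simp only [map_sum, map_smul, smul_eq_mul]
      have e6 : ∑ i, (invReg (h i)).val 1 * tangent ξ (g i) = tangent ξ f := by
        conv_rhs => rw [← e3]
        simp only [map_sum, map_smul, smul_eq_mul]
        refine Finset.sum_congr rfl fun i _ => ?_
        congr 1
        exact congrArg (h i).1 inv_one
      rw [e5, e6] at h1
      exact eq_neg_of_add_eq_zero_left h1
    rw [this]
    have : ∀ t : Reg K ⊗[ℂ] V, extend (-tangent ξ) t = -extend (tangent ξ) t := by
      intro t
      induction t with
      | zero => simp
      | tmul f v => simp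
      | add a b ha hb => simp only [map_add, ha, hb, neg_add]
    exact this t

theorem HasDerivOne.mono {ξ : LieAlg K} {F G : K → V} {w z : V} (h : HasDerivOne ξ F w)
    (hF : ∀ x, F x = G x) (hw : w = z) : HasDerivOne ξ G z := by
  obtain rfl : F = G := funext hF
  exact hw ▸ h

theorem HasDerivOne.sum {ι : Type*} (S : Finset ι) {ξ : LieAlg K} {F : ι → K → V} {w : ι → V}
    (h : ∀ i, HasDerivOne ξ (F i) (w i)) :
    HasDerivOne ξ (fun k => ∑ i ∈ S, F i k) (∑ i ∈ S, w i) := by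
  classical
  induction S using Finset.induction_on with
  | empty => simpa using HasDerivOne.const ξ (0 : V)
  | insert a S ha ih =>
    simp only [Finset.sum_insert ha]
    exact (h a).add ih

theorem tangent_lie (η ξ : LieAlg K) (f : Reg K) :
    tangent ⁅η, ξ⁆ f = tangent η (ξ.der f) - tangent ξ (η.der f) := by
  change (⁅η.der, ξ.der⁆ f).val 1 = _
  rw [Derivation.commutator_apply]; rfl

theorem hasDerivOne_tangent_Ad (η ξ : LieAlg K) (f : Reg K) :
    HasDerivOne η (fun k => tangent (Ad k ξ) f) (tangent ⁅η, ξ⁆ f) := by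
  obtain ⟨n, g, h, H⟩ := f.exists_mul
  -- first write `f (y k⁻¹) = ∑ g i y * h i k⁻¹`
  have e : ∀ k, leftTrans k (rightTrans k⁻¹ f) = ∑ i, (h i).val k⁻¹ • leftTrans k (g i) := by
    intro k
    apply Reg.ext'
    intro y
    rw [Reg.sum_apply]
    exact (H (k * y) k⁻¹).trans (Finset.sum_congr rfl fun i _ => mul_comm _ _)
  have d1 : ∀ i, HasDerivOne η (fun k => (h i).val k⁻¹) (-(tangent η (h i))) := fun i =>
    (hasDerivOne_reg η (h i)).inv
  have d2 : ∀ i, HasDerivOne η (fun k => tangent ξ (leftTrans k (g i)))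
      (tangent η (ξ.der (g i))) := fun i =>
    (hasDerivOne_reg η (ξ.der (g i))).mono (fun x => LieAlg.apply_eq _ _ _) rfl
  have d3 : ∀ i, HasDerivOne η (fun k => (h i).val k⁻¹ * tangent ξ (leftTrans k (g i)))
      (-(tangent η (h i)) * tangent ξ (g i) + (h i).val 1 * tangent η (ξ.der (g i))) := fun i =>
    ((d1 i).bilin (d2 i) (LinearMap.mul ℂ ℂ)).mono (fun _ => rfl) (by
      have : leftTrans (1 : K) (g i) = g i := Reg.ext' fun x => congrArg (g i).val (one_mul x)
      rw [this, LinearMap.mul_apply', LinearMap.mul_apply', inv_one])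
  refine (HasDerivOne.sum Finset.univ d3).mono (fun k => ?_) ?_
  · rw [tangent_Ad, e, map_sum]
    exact Finset.sum_congr rfl fun i _ => (map_smul (tangent ξ) _ _).symm
  · have e1 : η.der f = ∑ i, tangent η (h i) • g i := by
      apply Reg.ext'
      intro x
      have : leftTrans x f = ∑ i, (g i).val x • h i := by
        apply Reg.ext'
        intro y
        rw [Reg.sum_apply]
        exact H x y
      rw [LieAlg.apply_eq, this, map_sum, Reg.sum_apply]
      exact Finset.sum_congr rfl fun i _ => (map_smul (tangent η) _ _).trans (mul_comm _ _)
    have e2 : ξ.der f = ∑ i, (h i).val 1 • ξ.der (g i) := by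
      have : f = ∑ i, (h i).val 1 • g i := by
        apply Reg.ext'
        intro x
        have := H x 1
        rw [mul_one] at this
        rw [this, Reg.sum_apply]
        exact Finset.sum_congr rfl fun i _ => mul_comm _ _
      conv_lhs => rw [this]
      rw [map_sum]
      exact Finset.sum_congr rfl fun i _ => ξ.der.map_smul _ _
    have e3 : tangent ξ (η.der f) = ∑ i, tangent η (h i) * tangent ξ (g i) := by
      rw [e1, map_sum]
      exact Finset.sum_congr rfl fun i _ => map_smul (tangent ξ) _ _
    have e4 : tangent η (ξ.der f) = ∑ i, (h i).val 1 * tangent η (ξ.der (g i)) := by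
      rw [e2, map_sum]
      exact Finset.sum_congr rfl fun i _ => map_smul (tangent η) _ _
    rw [tangent_lie, e3, e4, Finset.sum_add_distrib]
    simp only [neg_mul, Finset.sum_neg_distrib]
    ring

/-- The adjoint action is algebraic, and its differential is the bracket. -/
theorem hasDerivOne_Ad (η ξ : LieAlg K) : HasDerivOne η (fun k => Ad k ξ) ⁅η, ξ⁆ := by
  have hreg : IsRegular (fun k => Ad k ξ) := by
    refine isRegular_of_finiteDimensional ⊤ (fun k => Submodule.mem_top) fun l => ?_
    obtain ⟨f, hf⟩ := exists_tangent_eq l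
    simp only [hf]
    exact (hasDerivOne_tangent_Ad 0 ξ f).isRegular.dual LinearMap.id
  obtain ⟨w, hw⟩ := hreg.hasDerivOne η
  have : w = ⁅η, ξ⁆ := by
    rw [← sub_eq_zero, ← Module.forall_dual_apply_eq_zero_iff ℂ]
    intro l
    obtain ⟨f, hf⟩ := exists_tangent_eq l
    rw [map_sub, sub_eq_zero, hf ⁅η, ξ⁆]
    exact ((hw.map l).mono (fun k => hf _) rfl).unique (hasDerivOne_tangent_Ad η ξ f)
  exact this ▸ hw

/-! ### Morphisms of algebraic groups -/

/-- A morphism of algebraic groups. -/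
structure GroupMorphism (T : Type u) (K : Type v) [Group T] [AffineAlgebraicGroup T]
    [Group K] [AffineAlgebraicGroup K] where
  hom : T →* K
  regular : ∀ f ∈ AffineAlgebraicGroup.coord (K := K),
    (fun t => f (hom t)) ∈ AffineAlgebraicGroup.coord (K := T)

namespace GroupMorphism

variable {T : Type u} [Group T] [AffineAlgebraicGroup T] {K : Type v} [Group K]
  [AffineAlgebraicGroup K] (γ : GroupMorphism T K)

/-- Pullback of regular functions. -/
def pullback : Reg K →ₐ[ℂ] Reg T where
  toFun f := ⟨fun t => f.val (γ.hom t), γ.regular _ f.2⟩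
  map_one' := rfl
  map_mul' _ _ := rfl
  map_zero' := rfl
  map_add' _ _ := rfl
  commutes' _ := rfl

/-- The left-invariant derivation `f ↦ (x ↦ ξ(y ↦ f (x γ(y)))(1))`. -/
def pushDerivation (ξ : LieAlg T) : LieAlg K :=
  have mem : ∀ f : Reg K, (fun x => tangent ξ (γ.pullback (leftTrans x f))) ∈
      AffineAlgebraicGroup.coord (K := K) := fun f => by
    obtain ⟨n, g, h, H⟩ := f.exists_mul
    have : ∀ x, leftTrans x f = ∑ i, (g i).val x • h i := fun x => by
      apply Reg.ext'
      intro y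
      rw [Reg.sum_apply]
      exact H x y
    have h2 : (fun x => tangent ξ (γ.pullback (leftTrans x f))) =
        (∑ i, tangent ξ (γ.pullback (h i)) • g i : Reg K).val := by
      funext x
      rw [this]
      simp only [map_sum, map_smul, smul_eq_mul]
      rw [Reg.sum_apply]
      exact Finset.sum_congr rfl fun i _ => mul_comm _ _
    rw [h2]
    exact (∑ i, tangent ξ (γ.pullback (h i)) • g i : Reg K).2
  ⟨Derivation.mk'
    { toFun := fun f => ⟨fun x => tangent ξ (γ.pullback (leftTrans x f)), mem f⟩
      map_add' := fun f g => Reg.ext' fun x => by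
        change tangent ξ (γ.pullback (leftTrans x (f + g))) =
          tangent ξ (γ.pullback (leftTrans x f)) + tangent ξ (γ.pullback (leftTrans x g))
        simp only [map_add]
      map_smul' := fun c f => Reg.ext' fun x => by
        change tangent ξ (γ.pullback (leftTrans x (c • f))) =
          c * tangent ξ (γ.pullback (leftTrans x f))
        simp only [map_smul, smul_eq_mul] }
    (fun f g => Reg.ext' fun x => by
      change tangent ξ (γ.pullback (leftTrans x (f * g))) =
        f.val x * tangent ξ (γ.pullback (leftTrans x g)) +
        g.val x * tangent ξ (γ.pullback (leftTrans x f))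
      rw [map_mul, map_mul, tangent_apply, Derivation.leibniz]
      change f.val (x * γ.hom 1) * _ + g.val (x * γ.hom 1) * _ = _
      rw [map_one, mul_one]; rfl), fun k f => Reg.ext' fun x => by
      change tangent ξ (γ.pullback (leftTrans x (leftTrans k f))) =
        tangent ξ (γ.pullback (leftTrans (k * x) f))
      congr 2
      exact Reg.ext' fun y => congrArg f.val (mul_assoc k x y).symm⟩

theorem pushDerivation_apply (ξ : LieAlg T) (f : Reg K) (x : K) :
    ((γ.pushDerivation ξ).der f).val x = tangent ξ (γ.pullback (leftTrans x f)) := rfl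

theorem tangent_pushDerivation (ξ : LieAlg T) (f : Reg K) :
    tangent (γ.pushDerivation ξ) f = tangent ξ (γ.pullback f) := by
  rw [tangent_apply, pushDerivation_apply]
  congr 2
  exact Reg.ext' fun y => congrArg f.val (one_mul y)

theorem pullback_pushDerivation (ξ : LieAlg T) (f : Reg K) :
    γ.pullback ((γ.pushDerivation ξ).der f) = ξ.der (γ.pullback f) := by
  apply Reg.ext'
  intro t
  change ((γ.pushDerivation ξ).der f).val (γ.hom t) = _
  rw [pushDerivation_apply, LieAlg.apply_eq]
  congr 1
  exact Reg.ext' fun y => congrArg f.val (map_mul γ.hom t y).symm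

/-- The differential `𝔱 → 𝔨` of a morphism of algebraic groups. -/
def differential : LieAlg T →ₗ⁅ℂ⁆ LieAlg K where
  toFun := γ.pushDerivation
  map_add' ξ η := LieAlg.ext' fun f => by
    change _ = tangent (γ.pushDerivation ξ) f + tangent (γ.pushDerivation η) f
    rw [tangent_pushDerivation, tangent_pushDerivation, tangent_pushDerivation]; rfl
  map_smul' c ξ := LieAlg.ext' fun f => by
    change _ = c * tangent (γ.pushDerivation ξ) f
    rw [tangent_pushDerivation, tangent_pushDerivation]; rfl
  map_lie' {ξ η} := LieAlg.ext' fun f => by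
    rw [tangent_pushDerivation]
    change (⁅ξ.der, η.der⁆ (γ.pullback f)).val 1 =
      (⁅(γ.pushDerivation ξ).der, (γ.pushDerivation η).der⁆ f).val 1
    rw [Derivation.commutator_apply, Derivation.commutator_apply]
    change tangent ξ (η.der (γ.pullback f)) - tangent η (ξ.der (γ.pullback f)) =
      tangent (γ.pushDerivation ξ) ((γ.pushDerivation η).der f) -
      tangent (γ.pushDerivation η) ((γ.pushDerivation ξ).der f)
    rw [tangent_pushDerivation, tangent_pushDerivation, pullback_pushDerivation,
      pullback_pushDerivation]

theorem tangent_differential (ξ : LieAlg T) (f : Reg K) :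
    tangent (γ.differential ξ) f = tangent ξ (γ.pullback f) := γ.tangent_pushDerivation ξ f

theorem differential_Ad (t : T) (ξ : LieAlg T) :
    γ.differential (Ad t ξ) = Ad (γ.hom t) (γ.differential ξ) := by
  apply LieAlg.ext'
  intro f
  rw [tangent_differential, tangent_Ad, tangent_Ad, tangent_differential]
  congr 1
  apply Reg.ext'
  intro x
  change f.val (γ.hom (t * x * t⁻¹)) = f.val (γ.hom t * γ.hom x * (γ.hom t)⁻¹)
  simp only [map_mul, map_inv]

end GroupMorphism

variable {T : Type w} [Group T] [AffineAlgebraicGroup T] (γ : GroupMorphism T K)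

theorem HasDerivOne.comp {ξ : LieAlg T} {F : K → V} {w : V}
    (h : HasDerivOne (γ.differential ξ) F w) : HasDerivOne ξ (fun t => F (γ.hom t)) w := by
  obtain ⟨t, ht, rfl⟩ := h
  refine ⟨LinearMap.rTensor V γ.pullback.toLinearMap t, fun x => ?_, ?_⟩
  · have : evalAt x ∘ₗ γ.pullback.toLinearMap = evalAt (γ.hom x) := rfl
    rw [extend_pullback, this, ht]
  · rw [extend_pullback]
    congr 1
    exact congrArg extend (LinearMap.ext fun f => (γ.tangent_differential ξ f).symm)

theorem IsAlgebraic.comp {ρ : K → V →ₗ[ℂ] V} (h : IsAlgebraic ρ) :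
    IsAlgebraic (fun t => ρ (γ.hom t)) := by
  intro v
  obtain ⟨U, h1, h2, h3, h4⟩ := h v
  exact ⟨U, h1, h2, fun t => h3 _, fun u hu l => γ.regular _ (h4 u hu l)⟩

end Group2

/-! ## Gradings and signs -/

/-- The sign `(-1)^n`. -/
def sgn (n : ℤ) : ℂ := (-1) ^ n

theorem sgn_add (m n : ℤ) : sgn (m + n) = sgn m * sgn n := zpow_add₀ (by norm_num) m n
@[simp] theorem sgn_zero : sgn 0 = 1 := zpow_zero _
@[simp] theorem sgn_one : sgn 1 = -1 := zpow_one _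
@[simp] theorem sgn_neg (n : ℤ) : sgn (-n) = sgn n := by
  unfold sgn
  rw [← inv_zpow', inv_neg, inv_one]
@[simp] theorem sgn_mul_self (n : ℤ) : sgn n * sgn n = 1 := by
  unfold sgn
  rw [← mul_zpow]; norm_num
@[simp] theorem sgn_smul_smul {V : Type*} [AddCommGroup V] [Module ℂ V] (n : ℤ) (v : V) :
    sgn n • sgn n • v = v := by rw [smul_smul, sgn_mul_self, one_smul]
theorem sgn_sub (m n : ℤ) : sgn (m - n) = sgn m * sgn n := by
  rw [sub_eq_add_neg, sgn_add, sgn_neg]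
theorem sgn_add_one (n : ℤ) : sgn (n + 1) = -sgn n := by rw [sgn_add]; simp
theorem sgn_sub_one (n : ℤ) : sgn (n - 1) = -sgn n := by rw [sgn_sub]; simp

section Grading

variable {V : Type v} [AddCommGroup V] [Module ℂ V] {gr : ℤ → Submodule ℂ V}

/-- The operator multiplying homogeneous elements of degree `i` by `c i`. -/
def scale (hgr : DirectSum.IsInternal gr) (c : ℤ → ℂ) : V →ₗ[ℂ] V :=
  (DirectSum.toModule ℂ ℤ V fun i => c i • (gr i).subtype) ∘ₗ
    (LinearEquiv.ofBijective (DirectSum.coeLinearMap gr) hgr).symm.toLinearMap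

theorem scale_of_mem (hgr : DirectSum.IsInternal gr) (c : ℤ → ℂ) {i : ℤ} {v : V}
    (hv : v ∈ gr i) : scale hgr c v = c i • v := by
  have : (LinearEquiv.ofBijective (DirectSum.coeLinearMap gr) hgr).symm v =
      DirectSum.lof ℂ ℤ (fun i => gr i) i ⟨v, hv⟩ := by
    rw [LinearEquiv.symm_apply_eq]
    exact (DirectSum.coeLinearMap_lof gr i ⟨v, hv⟩).symm
  rw [scale, LinearMap.comp_apply, LinearEquiv.coe_coe, this, DirectSum.toModule_lof]
  rfl

@[elab_as_elim]
theorem grading_induction (hgr : DirectSum.IsInternal gr) {p : V → Prop} (v : V)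
    (mem : ∀ i, ∀ v ∈ gr i, p v) (zero : p 0) (add : ∀ v w, p v → p w → p (v + w)) : p v := by
  have : v ∈ ⨆ i, gr i := by rw [hgr.submodule_iSup_eq_top]; trivial
  exact Submodule.iSup_induction gr (motive := p) this mem zero add

theorem linearMap_ext_grading {W : Type*} [AddCommGroup W] [Module ℂ W]
    (hgr : DirectSum.IsInternal gr) {f g : V →ₗ[ℂ] W} (h : ∀ i, ∀ v ∈ gr i, f v = g v) :
    f = g := by
  ext v
  exact grading_induction hgr v h (by simp) fun v w hv hw => by rw [map_add, map_add, hv, hw]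

/-- A family of subspaces is independent if an operator has eigenvalue `2^i` on the `i`-th one. -/
theorem isInternal_of_scale (E : V →ₗ[ℂ] V) (hE : ∀ i, ∀ v ∈ gr i, E v = (2 : ℂ) ^ i • v)
    (htop : ⨆ i, gr i = ⊤) : DirectSum.IsInternal gr := by
  refine DirectSum.isInternal_submodule_of_iSupIndep_of_iSup_eq_top ?_ htop
  have hinj : Function.Injective fun i : ℤ => (2 : ℂ) ^ i := by
    intro i j hij
    have h2 : ((2 : ℝ) : ℂ) ^ i = ((2 : ℝ) : ℂ) ^ j := by simpa using hij
    rw [← Complex.ofReal_zpow, ← Complex.ofReal_zpow, Complex.ofReal_inj] at h2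
    exact zpow_right_injective₀ (by norm_num) (by norm_num) h2
  exact ((Module.End.eigenspaces_iSupIndep E).comp hinj).mono fun i v hv =>
    Module.End.mem_eigenspace_iff.2 (hE i v hv)

theorem isInternal_shift (hgr : DirectSum.IsInternal gr) (n : ℤ) :
    DirectSum.IsInternal fun i => gr (i + n) := by
  refine DirectSum.isInternal_submodule_of_iSupIndep_of_iSup_eq_top
    (hgr.submodule_iSupIndep.comp (add_left_injective n)) ?_
  rw [← hgr.submodule_iSup_eq_top]
  exact (Equiv.addRight n).iSup_comp (g := gr)

theorem isInternal_prod {W : Type w} [AddCommGroup W] [Module ℂ W] {gr' : ℤ → Submodule ℂ W}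
    (hgr : DirectSum.IsInternal gr) (hgr' : DirectSum.IsInternal gr') :
    DirectSum.IsInternal fun i => (gr i).prod (gr' i) := by
  refine isInternal_of_scale ((scale hgr fun i => 2 ^ i).prodMap (scale hgr' fun i => 2 ^ i))
    (fun i v hv => ?_) ?_
  · rw [LinearMap.prodMap_apply, scale_of_mem hgr _ hv.1, scale_of_mem hgr' _ hv.2]
    rfl
  · rw [eq_top_iff]
    rintro ⟨v, w⟩ -
    have h1 : (v, (0 : W)) ∈ ⨆ i, (gr i).prod (gr' i) :=
      grading_induction hgr (p := fun v => (v, (0 : W)) ∈ ⨆ i, (gr i).prod (gr' i)) v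
        (fun i v hv => Submodule.mem_iSup_of_mem i ⟨hv, zero_mem _⟩) (zero_mem _)
        fun a b ha hb => by simpa using add_mem ha hb
    have h2 : ((0 : V), w) ∈ ⨆ i, (gr i).prod (gr' i) :=
      grading_induction hgr' (p := fun w => ((0 : V), w) ∈ ⨆ i, (gr i).prod (gr' i)) w
        (fun i v hv => Submodule.mem_iSup_of_mem i ⟨zero_mem _, hv⟩) (zero_mem _)
        fun a b ha hb => by simpa using add_mem ha hb
    simpa using add_mem h1 h2

end Grading

/-! ## Harish-Chandra pairs and Harish-Chandra DG algebras -/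

/-- A Harish-Chandra pair `(A, K)`. -/
structure HCPair (A : Type v) (K : Type u) [Ring A] [Algebra ℂ A] [Group K]
    [AffineAlgebraicGroup K] where
  φ : K →* (A ≃ₐ[ℂ] A)
  φ_algebraic : IsAlgebraic fun k => (φ k).toLinearMap
  ψ : LieAlg K →ₗ[ℂ] A
  ψ_lie : ∀ ξ η, ψ ⁅ξ, η⁆ = ψ ξ * ψ η - ψ η * ψ ξ
  ψ_Ad : ∀ k ξ, ψ (Ad k ξ) = φ k (ψ ξ)
  deriv_φ : ∀ ξ a, HasDerivOne ξ (fun k => φ k a) (ψ ξ * a - a * ψ ξ)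

/-- A Harish-Chandra DG algebra: a DG algebra `D` with an algebraic action `χ` of `K` by DG
automorphisms and a `K`-equivariant morphism of DG Lie algebras `ρ : 𝔨 → D` such that the
differential of `χ` is the action by the inner derivations `[ρ ξ, -]`. -/
structure HCDGAlgebra (D : Type v) (K : Type u) [Ring D] [Algebra ℂ D] [Group K]
    [AffineAlgebraicGroup K] where
  gr : ℤ → Submodule ℂ D
  internal : DirectSum.IsInternal gr
  one_mem : (1 : D) ∈ gr 0
  mul_mem : ∀ {i j : ℤ} {x y : D}, x ∈ gr i → y ∈ gr j → x * y ∈ gr (i + j)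
  d : D →ₗ[ℂ] D
  d_mem : ∀ {i : ℤ} {x : D}, x ∈ gr i → d x ∈ gr (i + 1)
  d_d : ∀ x, d (d x) = 0
  d_mul : ∀ {i : ℤ} {x : D}, x ∈ gr i → ∀ y, d (x * y) = d x * y + sgn i • (x * d y)
  χ : K →* (D ≃ₐ[ℂ] D)
  χ_algebraic : IsAlgebraic fun k => (χ k).toLinearMap
  χ_mem : ∀ (k : K) {i : ℤ} {x : D}, x ∈ gr i → χ k x ∈ gr i
  χ_d : ∀ k x, d (χ k x) = χ k (d x)
  ρ : LieAlg K →ₗ[ℂ] D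
  ρ_mem : ∀ ξ, ρ ξ ∈ gr 0
  d_ρ : ∀ ξ, d (ρ ξ) = 0
  ρ_lie : ∀ ξ η, ρ ⁅ξ, η⁆ = ρ ξ * ρ η - ρ η * ρ ξ
  ρ_Ad : ∀ k ξ, ρ (Ad k ξ) = χ k (ρ ξ)
  deriv_χ : ∀ ξ x, HasDerivOne ξ (fun k => χ k x) (ρ ξ * x - x * ρ ξ)

/-! ## The category of `(A, K, D)`-modules -/

section AKD

variable {A : Type*} {K : Type u} {D : Type*} [Ring A] [Algebra ℂ A] [Group K]
  [AffineAlgebraicGroup K] [Ring D] [Algebra ℂ D]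

/-- The automorphism of the graded algebra `D` given by `(-1)^(n deg x)` on homogeneous `x`. -/
def HCDGAlgebra.twist (Q : HCDGAlgebra D K) (n : ℤ) : D →ₐ[ℂ] D :=
  AlgHom.ofLinearMap (scale Q.internal fun i => sgn (n * i))
    (by rw [scale_of_mem Q.internal _ Q.one_mem]; simp) (by
      intro x y
      refine grading_induction Q.internal x (fun i x hx => ?_) (by simp) fun a b ha hb => by
        rw [add_mul, map_add, ha, hb, map_add, add_mul]
      refine grading_induction Q.internal y (fun j y hy => ?_) (by simp) fun a b ha hb => by
        rw [mul_add, map_add, ha, hb, map_add, mul_add]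
      rw [scale_of_mem Q.internal _ hx, scale_of_mem Q.internal _ hy,
        scale_of_mem Q.internal _ (Q.mul_mem hx hy), mul_add, sgn_add, smul_mul_smul_comm])

theorem HCDGAlgebra.twist_of_mem (Q : HCDGAlgebra D K) (n : ℤ) {i : ℤ} {x : D}
    (hx : x ∈ Q.gr i) : Q.twist n x = sgn (n * i) • x := scale_of_mem Q.internal _ hx

theorem HCDGAlgebra.twist_zero (Q : HCDGAlgebra D K) (x : D) : Q.twist 0 x = x :=
  grading_induction Q.internal x (fun i x hx => by rw [Q.twist_of_mem 0 hx]; simp) (by simp)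
    fun a b ha hb => by rw [map_add, ha, hb]

theorem HCDGAlgebra.twist_add (Q : HCDGAlgebra D K) (m n : ℤ) (x : D) :
    Q.twist (m + n) x = Q.twist m (Q.twist n x) :=
  grading_induction Q.internal x (fun i x hx => by
    rw [Q.twist_of_mem _ hx, Q.twist_of_mem _ hx, map_smul, Q.twist_of_mem _ hx, add_mul, sgn_add,
      smul_smul, mul_comm]) (by simp)
    fun a b ha hb => by rw [map_add, ha, hb, map_add, map_add]

/-- An `(A, K, D)`-module: a complex of vector spaces, written as its total space with the grading
by the components, with actions `π` of `A`, `ν` of `K` and `ω` of `D`. -/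
structure AKDModule (P : HCPair A K) (Q : HCDGAlgebra D K) where
  carrier : Type v
  [addCommGroup : AddCommGroup carrier]
  [module : Module ℂ carrier]
  gr : ℤ → Submodule ℂ carrier
  internal : DirectSum.IsInternal gr
  d : carrier →ₗ[ℂ] carrier
  d_mem : ∀ {i : ℤ} {v : carrier}, v ∈ gr i → d v ∈ gr (i + 1)
  d_d : ∀ v, d (d v) = 0
  π : A →ₐ[ℂ] Module.End ℂ carrier
  π_mem : ∀ a {i : ℤ} {v : carrier}, v ∈ gr i → π a v ∈ gr i
  π_d : ∀ a v, d (π a v) = π a (d v)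
  ν : K →* Module.End ℂ carrier
  ν_algebraic : IsAlgebraic fun k => ν k
  ν_mem : ∀ k {i : ℤ} {v : carrier}, v ∈ gr i → ν k v ∈ gr i
  ν_d : ∀ k v, d (ν k v) = ν k (d v)
  ω : D →ₐ[ℂ] Module.End ℂ carrier
  ω_mem : ∀ {i j : ℤ} {x : D} {v : carrier}, x ∈ Q.gr i → v ∈ gr j → ω x v ∈ gr (i + j)
  d_ω : ∀ {i : ℤ} {x : D}, x ∈ Q.gr i → ∀ v, d (ω x v) = ω (Q.d x) v + sgn i • ω x (d v)
  π_equivariant : ∀ k a v, π (P.φ k a) v = ν k (π a (ν k⁻¹ v))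
  ω_equivariant : ∀ k x v, ω (Q.χ k x) v = ν k (ω x (ν k⁻¹ v))
  π_ω : ∀ a x v, π a (ω x v) = ω x (π a v)
  deriv_ν : ∀ ξ v, HasDerivOne ξ (fun k => ν k v) (π (P.ψ ξ) v + ω (Q.ρ ξ) v)

namespace AKDModule

variable {P : HCPair A K} {Q : HCDGAlgebra D K}

attribute [instance] addCommGroup module

/-- Morphisms of `(A, K, D)`-modules: chain maps preserving all the actions. -/
@[ext]
structure Hom (V W : AKDModule.{u, v} P Q) where
  toLin : V.carrier →ₗ[ℂ] W.carrier
  map_mem : ∀ {i : ℤ} {v : V.carrier}, v ∈ V.gr i → toLin v ∈ W.gr i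
  map_d : ∀ v, toLin (V.d v) = W.d (toLin v)
  map_π : ∀ a v, toLin (V.π a v) = W.π a (toLin v)
  map_ν : ∀ k v, toLin (V.ν k v) = W.ν k (toLin v)
  map_ω : ∀ x v, toLin (V.ω x v) = W.ω x (toLin v)

instance : Category (AKDModule.{u, v} P Q) where
  Hom := Hom
  id V := ⟨LinearMap.id, id, fun _ => rfl, fun _ _ => rfl, fun _ _ => rfl, fun _ _ => rfl⟩
  comp f g := ⟨g.toLin ∘ₗ f.toLin, fun h => g.map_mem (f.map_mem h),
    fun v => by simp [f.map_d, g.map_d], fun a v => by simp [f.map_π, g.map_π],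
    fun k v => by simp [f.map_ν, g.map_ν], fun x v => by simp [f.map_ω, g.map_ω]⟩

@[ext]
theorem hom_ext {V W : AKDModule.{u, v} P Q} {f g : V ⟶ W} (h : ∀ v, f.toLin v = g.toLin v) :
    f = g := Hom.ext (LinearMap.ext h)

@[simp] theorem id_toLin (V : AKDModule.{u, v} P Q) (v : V.carrier) : Hom.toLin (𝟙 V) v = v := rfl
@[simp] theorem comp_toLin {U V W : AKDModule.{u, v} P Q} (f : U ⟶ V) (g : V ⟶ W)
    (v : U.carrier) : (f ≫ g).toLin v = g.toLin (f.toLin v) := rfl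

/-! ### Translation -/

/-- The shift `V[n]`. -/
def shift (n : ℤ) (V : AKDModule.{u, v} P Q) : AKDModule.{u, v} P Q where
  carrier := V.carrier
  gr i := V.gr (i + n)
  internal := isInternal_shift V.internal n
  d := sgn n • V.d
  d_mem {i v} hv := by
    have := V.d_mem hv
    rw [show i + n + 1 = i + 1 + n by ring] at this
    exact Submodule.smul_mem _ _ this
  d_d v := by simp [V.d_d]
  π := V.π
  π_mem a _ _ h := V.π_mem a h
  π_d a v := by simp [V.π_d]
  ν := V.ν
  ν_algebraic := V.ν_algebraic
  ν_mem k _ _ h := V.ν_mem k h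
  ν_d k v := by simp [V.ν_d]
  ω := V.ω.comp (Q.twist n)
  ω_mem {i j x v} hx hv := by
    rw [AlgHom.comp_apply, Q.twist_of_mem n hx, map_smul, add_assoc]
    exact Submodule.smul_mem _ _ (V.ω_mem hx hv)
  d_ω {i x} hx v := by
    simp only [AlgHom.comp_apply, LinearMap.smul_apply]
    rw [Q.twist_of_mem n hx, Q.twist_of_mem n (Q.d_mem hx)]
    simp only [map_smul, LinearMap.smul_apply]
    rw [V.d_ω hx, smul_add, smul_add, mul_add, mul_one, sgn_add, smul_smul, smul_smul, smul_smul,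
      smul_smul, smul_smul]
    congr 2 <;> ring
  π_equivariant := V.π_equivariant
  ω_equivariant k x v := by
    have : Q.twist n (Q.χ k x) = Q.χ k (Q.twist n x) :=
      grading_induction Q.internal x (fun i x hx => by
        rw [Q.twist_of_mem n hx, Q.twist_of_mem n (Q.χ_mem k hx), map_smul]) (by simp)
        fun a b ha hb => by simp only [map_add, ha, hb]
    rw [AlgHom.comp_apply, this, V.ω_equivariant]; rfl
  π_ω a x v := V.π_ω a _ v
  deriv_ν ξ v := by
    have : Q.twist n (Q.ρ ξ) = Q.ρ ξ := by rw [Q.twist_of_mem n (Q.ρ_mem ξ)]; simp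
    rw [AlgHom.comp_apply, this]
    exact V.deriv_ν ξ v

/-- The shift functors. -/
def shiftFun (n : ℤ) : AKDModule.{u, v} P Q ⥤ AKDModule.{u, v} P Q where
  obj V := V.shift n
  map {V W} f := ⟨f.toLin, fun h => f.map_mem h,
    fun v => (map_smul f.toLin (sgn n) (V.d v)).trans (congrArg (sgn n • ·) (f.map_d v)),
    f.map_π, f.map_ν, fun x v => f.map_ω _ v⟩

/-- An isomorphism which is the identity on underlying vector spaces. -/
def isoOfLinearEquiv {V W : AKDModule.{u, v} P Q} (e : V.carrier ≃ₗ[ℂ] W.carrier)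
    (mem : ∀ i v, v ∈ V.gr i ↔ e v ∈ W.gr i)
    (map_d : ∀ v, e (V.d v) = W.d (e v)) (map_π : ∀ a v, e (V.π a v) = W.π a (e v))
    (map_ν : ∀ k v, e (V.ν k v) = W.ν k (e v))
    (map_ω : ∀ x v, e (V.ω x v) = W.ω x (e v)) : V ≅ W where
  hom := ⟨e.toLinearMap, fun {i v} h => (mem i v).1 h, map_d, map_π, map_ν, map_ω⟩
  inv := ⟨e.symm.toLinearMap, fun {i v} h => (mem i _).2 (by simpa using h),
    fun v => e.injective (by simp [map_d]), fun a v => e.injective (by simp [map_π]),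
    fun k v => e.injective (by simp [map_ν]), fun x v => e.injective (by simp [map_ω])⟩
  hom_inv_id := hom_ext fun v => e.symm_apply_apply v
  inv_hom_id := hom_ext fun v => e.apply_symm_apply v

/-- `V[0] = V`. -/
def shiftZero : shiftFun (P := P) (Q := Q) 0 ≅ 𝟭 (AKDModule.{u, v} P Q) :=
  NatIso.ofComponents (fun V => isoOfLinearEquiv (V := V.shift 0) (W := V)
    (LinearEquiv.refl ℂ V.carrier)
    (fun i v => by change v ∈ V.gr (i + 0) ↔ v ∈ V.gr i; rw [add_zero])
    (fun v => by change sgn 0 • V.d v = V.d v; rw [sgn_zero, one_smul])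
    (fun _ _ => rfl) (fun _ _ => rfl)
    (fun x v => by change V.ω (Q.twist 0 x) v = V.ω x v; rw [Q.twist_zero]))
    fun f => hom_ext fun v => rfl

/-- `V[m + n] = V[m][n]`. -/
def shiftAdd (m n : ℤ) :
    shiftFun (P := P) (Q := Q) (m + n) ≅ shiftFun.{u, v} m ⋙ shiftFun n :=
  NatIso.ofComponents (fun V => isoOfLinearEquiv (V := V.shift (m + n))
    (W := (V.shift m).shift n) (LinearEquiv.refl ℂ V.carrier)
    (fun i v => by
      change v ∈ V.gr (i + (m + n)) ↔ v ∈ V.gr (i + n + m); rw [add_assoc, add_comm n m])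
    (fun v => by
      change sgn (m + n) • V.d v = sgn n • sgn m • V.d v; rw [smul_smul, add_comm, sgn_add])
    (fun _ _ => rfl) (fun _ _ => rfl)
    (fun x v => by
      change V.ω (Q.twist (m + n) x) v = V.ω (Q.twist m (Q.twist n x)) v; rw [Q.twist_add]))
    fun f => hom_ext fun v => rfl

theorem eqToHom_shift (V : AKDModule.{u, v} P Q) {m n : ℤ} (h : m = n)
    (h' : V.shift m = V.shift n) (v : V.carrier) : Hom.toLin (eqToHom h') v = v := by
  subst h; rfl

instance : HasShift (AKDModule.{u, v} P Q) ℤ :=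
  hasShiftMk _ _
    { F := shiftFun
      zero := shiftZero
      add := shiftAdd
      assoc_hom_app := fun m₁ m₂ m₃ V => hom_ext fun v =>
        (eqToHom_shift V (add_assoc m₁ m₂ m₃) _ v).symm
      zero_add_hom_app := fun n V => hom_ext fun v =>
        (eqToHom_shift V (zero_add n) _ v).symm
      add_zero_hom_app := fun n V => hom_ext fun v =>
        (eqToHom_shift V (add_zero n) _ v).symm }

/-! ### The homotopy category -/

/-- Homotopy of morphisms of `(A, K, D)`-modules: `f - g = h d + d h` with `h : V → W[-1]` a
morphism of graded `(A, K, D)`-modules. -/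
def Homotopic : HomRel (AKDModule.{u, v} P Q) := fun V W f g =>
  ∃ h : V.carrier →ₗ[ℂ] W.carrier,
    (∀ {i : ℤ} {v : V.carrier}, v ∈ V.gr i → h v ∈ W.gr (i - 1)) ∧
    (∀ a v, h (V.π a v) = W.π a (h v)) ∧
    (∀ k v, h (V.ν k v) = W.ν k (h v)) ∧
    (∀ {i : ℤ} {x : D}, x ∈ Q.gr i → ∀ v, h (V.ω x v) = sgn i • W.ω x (h v)) ∧
    ∀ v, f.toLin v - g.toLin v = h (V.d v) + W.d (h v)

instance : (Homotopic (P := P) (Q := Q)).IsCompatibleWithShift ℤ where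
  condition n V W f g := by
    rintro ⟨h, h1, h2, h3, h4, h5⟩
    refine ⟨sgn n • h, fun {i v} hv => ?_, fun a v => ?_, fun k v => ?_, fun {i x} hx v => ?_,
      fun v => ?_⟩
    · have := h1 hv
      rw [show i + n - 1 = i - 1 + n by ring] at this
      exact Submodule.smul_mem _ _ this
    · exact (congrArg (sgn n • ·) (h2 a v)).trans (map_smul (W.π a) _ _).symm
    · exact (congrArg (sgn n • ·) (h3 k v)).trans (map_smul (W.ν k) _ _).symm
    · have key : ∀ v : V.carrier,
          sgn n • h (V.ω (Q.twist n x) v) = sgn i • W.ω (Q.twist n x) (sgn n • h v) := by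
        intro v
        rw [Q.twist_of_mem n hx]
        simp only [map_smul, LinearMap.smul_apply]
        rw [h4 hx]
        simp only [smul_smul]
        congr 1; ring
      exact key v
    · have key : ∀ v : V.carrier,
          f.toLin v - g.toLin v = sgn n • h (sgn n • V.d v) + sgn n • W.d (sgn n • h v) := by
        intro v
        rw [map_smul, map_smul, sgn_smul_smul, sgn_smul_smul, h5]
      exact key v

instance : Congruence (Homotopic (P := P) (Q := Q) : HomRel (AKDModule.{u, v} P Q)) where
  equivalence {V W} :=
    { refl := fun f => ⟨0, fun _ => zero_mem _, by simp, by simp, by simp, by simp⟩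
      symm := by
        rintro f g ⟨h, h1, h2, h3, h4, h5⟩
        exact ⟨-h, fun hv => neg_mem (h1 hv), fun a v => by simp [h2], fun k v => by simp [h3],
          fun hx v => by simp [h4 hx], fun v => by
            rw [← neg_sub, h5]; simp [add_comm]⟩
      trans := by
        rintro f g e ⟨h, h1, h2, h3, h4, h5⟩ ⟨h', h1', h2', h3', h4', h5'⟩
        exact ⟨h + h', fun hv => add_mem (h1 hv) (h1' hv), fun a v => by simp [h2, h2'],
          fun k v => by simp [h3, h3'], fun hx v => by simp [h4 hx, h4' hx], fun v => by
            rw [← sub_add_sub_cancel _ (g.toLin v), h5, h5']; simp; abel⟩ }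
  comp_left := by
    rintro U V W e f g ⟨h, h1, h2, h3, h4, h5⟩
    exact ⟨h ∘ₗ e.toLin, fun hv => h1 (e.map_mem hv), fun a v => by simp [h2, e.map_π],
      fun k v => by simp [h3, e.map_ν], fun hx v => by simp [h4 hx, e.map_ω], fun v => by
        simp [h5, e.map_d]⟩
  comp_right := by
    rintro U V W f g e ⟨h, h1, h2, h3, h4, h5⟩
    exact ⟨e.toLin ∘ₗ h, fun hv => e.map_mem (h1 hv), fun a v => by simp [h2, e.map_π],
      fun k v => by simp [h3, e.map_ν], fun hx v => by simp [h4 hx, e.map_ω], fun v => by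
        simp [← map_sub, h5, e.map_d]⟩

variable (P Q) in
/-- The homotopy category `K(A, K, D)`. -/
abbrev HoCat := Quotient (Homotopic : HomRel (AKDModule.{u, v} P Q))

variable (P Q) in
/-- The functor from `(A, K, D)`-modules to the homotopy category. -/
abbrev toHo : AKDModule.{u, v} P Q ⥤ HoCat.{u, v} P Q := Quotient.functor Homotopic

/-! ### Cones and distinguished triangles -/

/-- The cone `C_f = V[1] ⊕ W` of a morphism `f : V ⟶ W`. -/
def cone {V W : AKDModule.{u, v} P Q} (f : V ⟶ W) : AKDModule.{u, v} P Q where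
  carrier := V.carrier × W.carrier
  gr i := (V.gr (i + 1)).prod (W.gr i)
  internal := isInternal_prod (V.shift 1).internal W.internal
  d := LinearMap.prod (-(V.d ∘ₗ LinearMap.fst ℂ V.carrier W.carrier))
    (f.toLin ∘ₗ LinearMap.fst ℂ V.carrier W.carrier + W.d ∘ₗ LinearMap.snd ℂ V.carrier W.carrier)
  d_mem h := ⟨neg_mem (V.d_mem h.1), add_mem (f.map_mem h.1) (W.d_mem h.2)⟩
  d_d v := Prod.ext (by simp [V.d_d]) (by simp [W.d_d, f.map_d])
  π := (LinearMap.prodMapAlgHom ℂ V.carrier W.carrier).comp (V.π.prod W.π)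
  π_mem a _ _ h := ⟨V.π_mem a h.1, W.π_mem a h.2⟩
  π_d a v := Prod.ext (by simp [V.π_d]) (by simp [W.π_d, f.map_π])
  ν := (LinearMap.prodMapAlgHom ℂ V.carrier W.carrier : Module.End ℂ V.carrier ×
    Module.End ℂ W.carrier →* Module.End ℂ (V.carrier × W.carrier)).comp (V.ν.prod W.ν)
  ν_algebraic := isAlgebraic_of_isRegular
    (LinearMap.ext fun v => Prod.ext (by simp) (by simp)) (fun k l v => by simp) fun v => by
    obtain ⟨t, ht⟩ := ((V.ν_algebraic.isRegular v.1).map (LinearMap.inl ℂ _ W.carrier)).add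
      ((W.ν_algebraic.isRegular v.2).map (LinearMap.inr ℂ V.carrier _))
    exact ⟨t, fun k => (ht k).trans (Prod.ext (add_zero _) (zero_add _))⟩
  ν_mem k _ _ h := ⟨V.ν_mem k h.1, W.ν_mem k h.2⟩
  ν_d k v := Prod.ext (by simp [V.ν_d]) (by simp [W.ν_d, f.map_ν])
  ω := (LinearMap.prodMapAlgHom ℂ V.carrier W.carrier).comp
    ((V.ω.comp (Q.twist 1)).prod W.ω)
  ω_mem hx h := ⟨(V.shift 1).ω_mem hx h.1, W.ω_mem hx h.2⟩
  d_ω {i x} hx v := by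
    have h1 : f.toLin (V.ω (Q.twist 1 x) v.1) = sgn i • W.ω x (f.toLin v.1) := by
      rw [Q.twist_of_mem 1 hx, one_mul, f.map_ω, map_smul]; rfl
    refine Prod.ext ?_ ?_
    · change -V.d (V.ω (Q.twist 1 x) v.1) =
        V.ω (Q.twist 1 (Q.d x)) v.1 + sgn i • V.ω (Q.twist 1 x) (-(V.d v.1))
      rw [Q.twist_of_mem 1 hx, Q.twist_of_mem 1 (Q.d_mem hx)]
      simp only [map_smul, LinearMap.smul_apply, one_mul, V.d_ω hx, sgn_add_one, map_neg, smul_add,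
        smul_neg, neg_add, sgn_smul_smul, neg_smul, LinearMap.neg_apply]
    · change f.toLin (V.ω (Q.twist 1 x) v.1) + W.d (W.ω x v.2) =
        W.ω (Q.d x) v.2 + sgn i • W.ω x (f.toLin v.1 + W.d v.2)
      rw [h1, W.d_ω hx, map_add, smul_add]
      abel
  π_equivariant k a v := Prod.ext (V.π_equivariant k a _) (W.π_equivariant k a _)
  ω_equivariant k a v := Prod.ext ((V.shift 1).ω_equivariant k a _) (W.ω_equivariant k a _)
  π_ω a x v := Prod.ext (V.π_ω a _ _) (W.π_ω a x _)
  deriv_ν ξ v := (((V.shift 1).deriv_ν ξ v.1).map (LinearMap.inl ℂ _ W.carrier)).add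
      ((W.deriv_ν ξ v.2).map (LinearMap.inr ℂ V.carrier _)) |>.mono
        (fun k => Prod.ext (add_zero _) (zero_add _)) (Prod.ext (add_zero _) (zero_add _))

/-- The inclusion `W ⟶ C_f`. -/
def coneInl {V W : AKDModule.{u, v} P Q} (f : V ⟶ W) : W ⟶ cone f where
  toLin := (LinearMap.inr ℂ V.carrier W.carrier : W.carrier →ₗ[ℂ] V.carrier × W.carrier)
  map_mem h := ⟨zero_mem _, h⟩
  map_d v := Prod.ext (by change 0 = -V.d 0; simp) (by change W.d v = f.toLin 0 + W.d v; simp)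
  map_π a v := Prod.ext (map_zero (V.π a)).symm rfl
  map_ν k v := Prod.ext (map_zero (V.ν k)).symm rfl
  map_ω x v := Prod.ext (map_zero (V.ω _)).symm rfl

/-- The projection `C_f ⟶ V[1]`. -/
def coneProj {V W : AKDModule.{u, v} P Q} (f : V ⟶ W) : cone f ⟶ V⟦(1 : ℤ)⟧ where
  toLin := (LinearMap.fst ℂ V.carrier W.carrier : V.carrier × W.carrier →ₗ[ℂ] V.carrier)
  map_mem {i v} h := (show v ∈ (V.gr (i + 1)).prod (W.gr i) from h).1
  map_d v := by
    have key : ∀ v : V.carrier, -V.d v = sgn 1 • V.d v := fun v => by simp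
    exact key v.1
  map_π _ _ := rfl
  map_ν _ _ := rfl
  map_ω _ _ := rfl

open Pretriangulated in
/-- The standard triangle `V ⟶ W ⟶ C_f ⟶ V[1]`. -/
def standardTriangle {V W : AKDModule.{u, v} P Q} (f : V ⟶ W) :
    Triangle (AKDModule.{u, v} P Q) :=
  Triangle.mk f (coneInl f) (coneProj f)

open Pretriangulated in
variable (P Q) in
/-- The distinguished triangles of `K(A, K, D)`: those isomorphic to the image of a standard
triangle. -/
def distinguished : Set (Triangle (HoCat.{u, v} P Q)) :=
  {Δ | ∃ (V W : AKDModule.{u, v} P Q) (f : V ⟶ W),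
    Nonempty (Δ ≅ (toHo P Q).mapTriangle.obj (standardTriangle f))}

end AKDModule

open AKDModule in
/-- An exact functor between homotopy categories: it commutes with translation and sends
distinguished triangles to distinguished triangles. -/
def IsExactFunctor {A : Type*} {K : Type*} {D : Type*} [Ring A] [Algebra ℂ A] [Group K]
    [AffineAlgebraicGroup K] [Ring D] [Algebra ℂ D] {P : HCPair A K} {Q : HCDGAlgebra D K}
    {B : Type*} {T : Type*} {E : Type*} [Ring B] [Algebra ℂ B] [Group T]
    [AffineAlgebraicGroup T] [Ring E] [Algebra ℂ E] {P' : HCPair B T} {Q' : HCDGAlgebra E T}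
    (F : HoCat P Q ⥤ HoCat P' Q') : Prop :=
  ∃ _ : F.CommShift ℤ, ∀ Δ ∈ distinguished P Q, F.mapTriangle.obj Δ ∈ distinguished P' Q'

end AKD

/-! ## The standard complex of a Lie algebra -/

/-- The relations of the enveloping algebra of the DG Lie algebra `𝔩 → 𝔩` in degrees `-1`, `0`.
The pair `(X, ξ)` stands for `X` in degree `0` plus `ξ` in degree `-1`. -/
inductive StdRel (L : Type u) [LieRing L] [LieAlgebra ℂ L] :
    TensorAlgebra ℂ (L × L) → TensorAlgebra ℂ (L × L) → Prop
  | even_even (X Y : L) : StdRel L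
      (TensorAlgebra.ι ℂ (X, 0) * TensorAlgebra.ι ℂ (Y, 0))
      (TensorAlgebra.ι ℂ (Y, 0) * TensorAlgebra.ι ℂ (X, 0) + TensorAlgebra.ι ℂ (⁅X, Y⁆, 0))
  | even_odd (X ξ : L) : StdRel L
      (TensorAlgebra.ι ℂ (X, 0) * TensorAlgebra.ι ℂ (0, ξ))
      (TensorAlgebra.ι ℂ (0, ξ) * TensorAlgebra.ι ℂ (X, 0) + TensorAlgebra.ι ℂ (0, ⁅X, ξ⁆))
  | odd_odd (ξ η : L) : StdRel L
      (TensorAlgebra.ι ℂ (0, ξ) * TensorAlgebra.ι ℂ (0, η))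
      (-(TensorAlgebra.ι ℂ (0, η) * TensorAlgebra.ι ℂ (0, ξ)))

/-- The standard complex `N(𝔩)` of a Lie algebra, as the enveloping DG algebra of the DG Lie
algebra `𝔩 → 𝔩`. -/
def StdComplex (L : Type u) [LieRing L] [LieAlgebra ℂ L] : Type u := RingQuot (StdRel L)

namespace StdComplex

variable {L : Type u} [LieRing L] [LieAlgebra ℂ L]

instance : Ring (StdComplex L) := inferInstanceAs (Ring (RingQuot (StdRel L)))
instance : Algebra ℂ (StdComplex L) := inferInstanceAs (Algebra ℂ (RingQuot (StdRel L)))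

/-- The quotient map from the tensor algebra. -/
def mk : TensorAlgebra ℂ (L × L) →ₐ[ℂ] StdComplex L := RingQuot.mkAlgHom ℂ (StdRel L)

theorem mk_rel {a b : TensorAlgebra ℂ (L × L)} (h : StdRel L a b) : mk a = mk b :=
  RingQuot.mkAlgHom_rel ℂ h

/-- The generators of degree `0`. -/
def x : L →ₗ[ℂ] StdComplex L :=
  mk.toLinearMap ∘ₗ TensorAlgebra.ι ℂ ∘ₗ LinearMap.inl ℂ L L

/-- The generators of degree `-1`. -/
def y : L →ₗ[ℂ] StdComplex L :=
  mk.toLinearMap ∘ₗ TensorAlgebra.ι ℂ ∘ₗ LinearMap.inr ℂ L L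

theorem x_lie (X Y : L) : (x ⁅X, Y⁆ : StdComplex L) = x X * x Y - x Y * x X := by
  have := mk_rel (StdRel.even_even X Y)
  rw [map_mul, map_add, map_mul] at this
  exact eq_sub_of_add_eq' this.symm

theorem y_lie (X ξ : L) : (y ⁅X, ξ⁆ : StdComplex L) = x X * y ξ - y ξ * x X := by
  have := mk_rel (StdRel.even_odd X ξ)
  rw [map_mul, map_add, map_mul] at this
  exact eq_sub_of_add_eq' this.symm

theorem y_mul_y (ξ η : L) : (y ξ * y η : StdComplex L) = -(y η * y ξ) := by
  have := mk_rel (StdRel.odd_odd ξ η)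
  rw [map_mul, map_neg, map_mul] at this
  exact this

section Lift

variable {B : Type*} [Ring B] [Algebra ℂ B]

/-- The universal property of `N(𝔩)` as an algebra. -/
def lift (f g : L →ₗ[ℂ] B) (hff : ∀ X Y, f ⁅X, Y⁆ = f X * f Y - f Y * f X)
    (hfg : ∀ X ξ, g ⁅X, ξ⁆ = f X * g ξ - g ξ * f X) (hgg : ∀ ξ η, g ξ * g η = -(g η * g ξ)) :
    StdComplex L →ₐ[ℂ] B :=
  RingQuot.liftAlgHom ℂ ⟨TensorAlgebra.lift ℂ (f.coprod g), by
    rintro _ _ (⟨X, Y⟩ | ⟨X, ξ⟩ | ⟨ξ, η⟩)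
    · simp [hff]
    · simp [hfg]
    · simp only [map_mul, map_neg, TensorAlgebra.lift_ι_apply, LinearMap.coprod_apply, map_zero,
        zero_add]
      exact hgg ξ η⟩

variable {f g : L →ₗ[ℂ] B} {hff : ∀ X Y, f ⁅X, Y⁆ = f X * f Y - f Y * f X}
    {hfg : ∀ X ξ, g ⁅X, ξ⁆ = f X * g ξ - g ξ * f X} {hgg : ∀ ξ η, g ξ * g η = -(g η * g ξ)}

@[simp] theorem lift_x (X : L) : lift f g hff hfg hgg (x X) = f X :=
  (RingQuot.liftAlgHom_mkAlgHom_apply ℂ _ _ _).trans (by simp)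

@[simp] theorem lift_y (ξ : L) : lift f g hff hfg hgg (y ξ) = g ξ :=
  (RingQuot.liftAlgHom_mkAlgHom_apply ℂ _ _ _).trans (by simp)

theorem algHom_ext {f g : StdComplex L →ₐ[ℂ] B} (hx : ∀ X, f (x X) = g (x X))
    (hy : ∀ ξ, f (y ξ) = g (y ξ)) : f = g := by
  refine RingQuot.ringQuot_ext' ℂ f g (TensorAlgebra.hom_ext (LinearMap.prod_ext ?_ ?_))
  · exact LinearMap.ext hx
  · exact LinearMap.ext hy

end Lift

@[elab_as_elim]
theorem induction {p : StdComplex L → Prop} (n : StdComplex L) (one : p 1)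
    (add : ∀ a b, p a → p b → p (a + b)) (smul : ∀ (c : ℂ) a, p a → p (c • a))
    (x_mul : ∀ X a, p a → p (x X * a)) (y_mul : ∀ ξ a, p a → p (y ξ * a)) : p n := by
  let S : Subalgebra ℂ (StdComplex L) :=
    { carrier := {a | ∀ b, p b → p (a * b)}
      mul_mem' := fun {a b} ha hb c hc => by rw [mul_assoc]; exact ha _ (hb _ hc)
      add_mem' := fun {a b} ha hb c hc => by rw [add_mul]; exact add _ _ (ha _ hc) (hb _ hc)
      algebraMap_mem' := fun r b hb => by rw [← Algebra.smul_def]; exact smul _ _ hb }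
  let f : StdComplex L →ₐ[ℂ] S := lift
    { toFun := fun X => ⟨x X, x_mul X⟩
      map_add' := fun _ _ => Subtype.ext (map_add _ _ _)
      map_smul' := fun _ _ => Subtype.ext (map_smul _ _ _) }
    { toFun := fun X => ⟨y X, y_mul X⟩
      map_add' := fun _ _ => Subtype.ext (map_add _ _ _)
      map_smul' := fun _ _ => Subtype.ext (map_smul _ _ _) }
    (fun X Y => Subtype.ext (x_lie X Y)) (fun X Y => Subtype.ext (y_lie X Y))
    (fun X Y => Subtype.ext (y_mul_y X Y))
  have : S.val.comp f = AlgHom.id ℂ _ := algHom_ext (fun X => by simp [f]) (fun X => by simp [f])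
  have h : ((f n : S) : StdComplex L) = n := AlgHom.congr_fun this n
  have := (f n).2 1 one
  rwa [mul_one, h] at this

/-! ### The grading -/

/-- Products of generators, with their degree. -/
inductive IsMonomial : ℤ → StdComplex L → Prop
  | one : IsMonomial 0 1
  | x_mul (X : L) {i : ℤ} {n : StdComplex L} : IsMonomial i n → IsMonomial i (x X * n)
  | y_mul (ξ : L) {i : ℤ} {n : StdComplex L} : IsMonomial i n → IsMonomial (i - 1) (y ξ * n)

variable (L) in
/-- The component of degree `i`: spanned by the products of generators of total degree `i`. -/
def gr (i : ℤ) : Submodule ℂ (StdComplex L) := Submodule.span ℂ {n | IsMonomial i n}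

theorem IsMonomial.mul {i j : ℤ} {m n : StdComplex L} (hm : IsMonomial i m)
    (hn : IsMonomial j n) : IsMonomial (i + j) (m * n) := by
  induction hm with
  | one => simpa using hn
  | x_mul X _ ih => rw [mul_assoc]; exact ih.x_mul X
  | @y_mul ξ i _ _ ih =>
    rw [mul_assoc, show i - 1 + j = i + j - 1 by ring]; exact ih.y_mul ξ

theorem gr_le_iff {i : ℤ} {S : Submodule ℂ (StdComplex L)} :
    gr L i ≤ S ↔ ∀ n, IsMonomial i n → n ∈ S := Submodule.span_le

theorem one_mem : (1 : StdComplex L) ∈ gr L 0 := Submodule.subset_span IsMonomial.one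

theorem mul_mem {i j : ℤ} {m n : StdComplex L} (hm : m ∈ gr L i) (hn : n ∈ gr L j) :
    m * n ∈ gr L (i + j) := by
  have h1 : ∀ m, IsMonomial i m → gr L j ≤ (gr L (i + j)).comap (LinearMap.mulLeft ℂ m) :=
    fun m hm => gr_le_iff.2 fun n hn => Submodule.subset_span (hm.mul hn)
  have h2 : gr L i ≤ (gr L (i + j)).comap (LinearMap.mulRight ℂ n) :=
    gr_le_iff.2 fun m hm => h1 m hm hn
  exact h2 hm

theorem x_mem (X : L) : (x X : StdComplex L) ∈ gr L 0 := by
  have h : (x X * 1 : StdComplex L) ∈ gr L 0 := Submodule.subset_span (IsMonomial.one.x_mul X)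
  rwa [mul_one] at h

theorem y_mem (ξ : L) : (y ξ : StdComplex L) ∈ gr L (-1) := by
  have h : (y ξ * 1 : StdComplex L) ∈ gr L (0 - 1) :=
    Submodule.subset_span (IsMonomial.one.y_mul ξ)
  rwa [mul_one, zero_sub] at h

theorem y_mul_mem (ξ : L) {i : ℤ} {n : StdComplex L} (hn : n ∈ gr L i) :
    y ξ * n ∈ gr L (i - 1) := by
  rw [show i - 1 = -1 + i by ring]; exact mul_mem (y_mem ξ) hn

theorem x_mul_mem (X : L) {i : ℤ} {n : StdComplex L} (hn : n ∈ gr L i) :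
    x X * n ∈ gr L i := by
  simpa using mul_mem (x_mem X) hn

theorem iSup_gr : ⨆ i, gr L i = ⊤ := by
  rw [eq_top_iff]
  rintro n -
  induction n using induction with
  | one => exact Submodule.mem_iSup_of_mem 0 one_mem
  | add a b ha hb => exact add_mem ha hb
  | smul c a ha => exact Submodule.smul_mem _ c ha
  | x_mul X a ha =>
    have : ⨆ i, gr L i ≤ (⨆ i, gr L i).comap (LinearMap.mulLeft ℂ (x X)) :=
      iSup_le fun i n hn => Submodule.mem_iSup_of_mem i (x_mul_mem X hn)
    exact this ha
  | y_mul ξ a ha =>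
    have : ⨆ i, gr L i ≤ (⨆ i, gr L i).comap (LinearMap.mulLeft ℂ (y ξ)) :=
      iSup_le fun i n hn => Submodule.mem_iSup_of_mem (i - 1) (y_mul_mem ξ hn)
    exact this ha

theorem isInternal : DirectSum.IsInternal (gr L) := by
  let c : StdComplex L →ₐ[ℂ] StdComplex L := lift x ((2 : ℂ)⁻¹ • y) x_lie
    (fun X ξ => by simp [y_lie, smul_sub]) (fun ξ η => by simp [y_mul_y ξ η])
  refine isInternal_of_scale c.toLinearMap (fun i => ?_) iSup_gr
  have : gr L i ≤ LinearMap.ker (c.toLinearMap - (2 : ℂ) ^ i • LinearMap.id) := by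
    refine gr_le_iff.2 fun n hn => ?_
    rw [LinearMap.mem_ker, LinearMap.sub_apply, sub_eq_zero]
    change c n = (2 : ℂ) ^ i • n
    induction hn with
    | one => simp
    | x_mul X _ ih => rw [map_mul, ih]; simp [c]
    | y_mul ξ _ ih =>
      rw [map_mul, ih, zpow_sub_one₀ two_ne_zero]; simp [c, smul_smul]
  intro n hn
  exact sub_eq_zero.1 (LinearMap.mem_ker.1 (this hn))

/-- The grading involution `n ↦ (-1)^(deg n) n`. -/
def sigma : StdComplex L →ₐ[ℂ] StdComplex L :=
  lift x (-y) x_lie (fun X ξ => by simp [y_lie]; abel) (fun ξ η => by simp [y_mul_y ξ η])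

@[simp] theorem sigma_x (X : L) : sigma (x X) = x X := lift_x X
@[simp] theorem sigma_y (ξ : L) : sigma (y ξ) = -y ξ := lift_y ξ

theorem sigma_sigma (n : StdComplex L) : sigma (sigma n) = n :=
  AlgHom.congr_fun (algHom_ext (f := sigma.comp sigma) (g := AlgHom.id ℂ (StdComplex L))
    (by simp) (by simp)) n

theorem sigma_of_mem {i : ℤ} {n : StdComplex L} (hn : n ∈ gr L i) : sigma n = sgn i • n := by
  have : gr L i ≤ LinearMap.ker (sigma.toLinearMap - sgn i • LinearMap.id) := by
    clear hn
    refine gr_le_iff.2 fun n hn => ?_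
    rw [LinearMap.mem_ker, LinearMap.sub_apply, sub_eq_zero]
    change sigma n = sgn i • n
    induction hn with
    | one => simp
    | x_mul X _ ih => rw [map_mul, ih]; simp
    | y_mul ξ _ ih => rw [map_mul, ih, sgn_sub_one]; simp
  exact sub_eq_zero.1 (LinearMap.mem_ker.1 (this hn))

/-! ### The differential -/

/-- Auxiliary: `n ↦ (σ n, d n; 0, n)`, which is multiplicative exactly because `d` is a
superderivation. -/
def diffMatrix : StdComplex L →ₐ[ℂ] Matrix (Fin 2) (Fin 2) (StdComplex L) :=
  lift
    { toFun := fun X => !![x X, 0; 0, x X]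
      map_add' := fun X Y => by ext i j; fin_cases i <;> fin_cases j <;> simp
      map_smul' := fun c X => by ext i j; fin_cases i <;> fin_cases j <;> simp }
    { toFun := fun ξ => !![-y ξ, x ξ; 0, y ξ]
      map_add' := fun X Y => by ext i j; fin_cases i <;> fin_cases j <;> simp [add_comm]
      map_smul' := fun c X => by ext i j; fin_cases i <;> fin_cases j <;> simp }
    (fun X Y => by
      ext i j; fin_cases i <;> fin_cases j <;> simp [x_lie])
    (fun X Y => by
      ext i j; fin_cases i <;> fin_cases j <;> simp [x_lie, y_lie]; abel)
    (fun X Y => by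
      have h : x X * y Y - y X * x Y + (x Y * y X - y Y * x X) = (0 : StdComplex L) := by
        have h1 := y_lie X Y
        have h2 := y_lie Y X
        rw [← lie_skew, map_neg] at h2
        have : x X * y Y - y X * x Y + (x Y * y X - y Y * x X) =
          (x X * y Y - y Y * x X) + (x Y * y X - y X * x Y : StdComplex L) := by abel
        rw [this, ← h1, ← h2, add_neg_cancel]
      have h' : x X * y Y - y X * x Y = -(x Y * y X - y Y * x X : StdComplex L) :=
        eq_neg_of_add_eq_zero_left h
      ext i j; fin_cases i <;> fin_cases j <;> simp [y_mul_y X Y]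
      rw [← sub_eq_neg_add, h']; abel)

/-- The differential: the superderivation with `d (x X) = 0` and `d (y ξ) = x ξ`. -/
def d : StdComplex L →ₗ[ℂ] StdComplex L where
  toFun n := diffMatrix n 0 1
  map_add' m n := by simp
  map_smul' c n := by simp

theorem diffMatrix_x (X : L) : diffMatrix (x X) = !![x X, 0; 0, x X] := lift_x X
theorem diffMatrix_y (ξ : L) : diffMatrix (y ξ) = !![-y ξ, x ξ; 0, y ξ] := lift_y ξ

theorem diffMatrix_apply (n : StdComplex L) : diffMatrix n = !![sigma n, d n; 0, n] := by
  have h : diffMatrix n 0 0 = sigma n ∧ diffMatrix n 1 0 = 0 ∧ diffMatrix n 1 1 = n := by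
    induction n using induction with
    | one => simp
    | add a b ha hb => simp [ha, hb]
    | smul c a ha => simp [ha]
    | x_mul X a ha => simp [diffMatrix_x, Matrix.mul_apply, ha]
    | y_mul X a ha => simp [diffMatrix_y, Matrix.mul_apply, ha]
  ext i j
  fin_cases i <;> fin_cases j
  · exact h.1
  · rfl
  · exact h.2.1
  · exact h.2.2

theorem d_mul' (m n : StdComplex L) : d (m * n) = d m * n + sigma m * d n := by
  change diffMatrix (m * n) 0 1 = _
  rw [map_mul, diffMatrix_apply m, diffMatrix_apply n]
  simp [add_comm]

@[simp] theorem d_x (X : L) : d (x X : StdComplex L) = 0 := by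
  change diffMatrix (x X) 0 1 = _
  simp [diffMatrix_x]

@[simp] theorem d_y (ξ : L) : d (y ξ : StdComplex L) = x ξ := by
  change diffMatrix (y ξ) 0 1 = _
  simp [diffMatrix_y]

@[simp] theorem d_one : d (1 : StdComplex L) = 0 := by
  change diffMatrix 1 0 1 = _
  simp

theorem d_x_mul (X : L) (n : StdComplex L) : d (x X * n) = x X * d n := by simp [d_mul']
theorem d_y_mul (ξ : L) (n : StdComplex L) : d (y ξ * n) = x ξ * n - y ξ * d n := by
  simp [d_mul', sub_eq_add_neg]

theorem d_d (n : StdComplex L) : d (d n) = 0 := by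
  induction n using induction with
  | one => simp
  | add a b ha hb => simp [ha, hb]
  | smul c a ha => simp [ha]
  | x_mul X a ha => simp [d_x_mul, ha]
  | y_mul X a ha => simp [d_x_mul, d_y_mul, ha]

theorem d_mem {i : ℤ} {n : StdComplex L} (hn : n ∈ gr L i) : d n ∈ gr L (i + 1) := by
  have : gr L i ≤ (gr L (i + 1)).comap d := by
    clear hn
    refine gr_le_iff.2 fun n hn => ?_
    change d n ∈ gr L (i + 1)
    induction hn with
    | one => simp
    | x_mul X _ ih => rw [d_x_mul]; exact x_mul_mem X ih
    | @y_mul ξ i n hn ih =>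
      rw [d_y_mul]
      have := y_mul_mem ξ ih
      rw [add_sub_cancel_right] at this
      rw [sub_add_cancel]
      exact sub_mem (x_mul_mem ξ (Submodule.subset_span hn)) this
  exact this hn

theorem d_sigma (n : StdComplex L) : d (sigma n) = -sigma (d n) := by
  induction n using induction with
  | one => simp
  | add a b ha hb => simp [ha, hb, add_comm]
  | smul c a ha => simp [ha]
  | x_mul X a ha => simp [d_x_mul, ha]
  | y_mul X a ha => simp [d_x_mul, d_y_mul, ha]

/-! ### Functoriality -/

section Map

variable {L' : Type v} [LieRing L'] [LieAlgebra ℂ L'] {L'' : Type w} [LieRing L'']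
  [LieAlgebra ℂ L'']

/-- The morphism `N(𝔩) → N(𝔩')` induced by a morphism of Lie algebras. -/
def map (g : L →ₗ⁅ℂ⁆ L') : StdComplex L →ₐ[ℂ] StdComplex L' :=
  lift (x ∘ₗ (g : L →ₗ[ℂ] L')) (y ∘ₗ (g : L →ₗ[ℂ] L')) (by simp [x_lie]) (by simp [y_lie])
    (fun ξ η => y_mul_y _ _)

@[simp] theorem map_x (g : L →ₗ⁅ℂ⁆ L') (X : L) : map g (x X) = x (g X) := lift_x X
@[simp] theorem map_y (g : L →ₗ⁅ℂ⁆ L') (X : L) : map g (y X) = y (g X) := lift_y X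

theorem map_map (g : L →ₗ⁅ℂ⁆ L') (h : L' →ₗ⁅ℂ⁆ L'') (n : StdComplex L) :
    map h (map g n) = map (h.comp g) n :=
  AlgHom.congr_fun (algHom_ext (f := (map h).comp (map g)) (by simp) (by simp)) n

theorem map_id (n : StdComplex L) : map (LieHom.id : L →ₗ⁅ℂ⁆ L) n = n :=
  AlgHom.congr_fun (algHom_ext (f := map LieHom.id) (g := AlgHom.id ℂ _) (by simp) (by simp)) n

theorem map_mem (g : L →ₗ⁅ℂ⁆ L') {i : ℤ} {n : StdComplex L} (hn : n ∈ gr L i) :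
    map g n ∈ gr L' i := by
  have : gr L i ≤ (gr L' i).comap (map g).toLinearMap := by
    clear hn
    refine gr_le_iff.2 fun n hn => ?_
    change map g n ∈ gr L' i
    induction hn with
    | one => simpa using one_mem
    | x_mul X _ ih => rw [map_mul, map_x]; exact x_mul_mem _ ih
    | y_mul ξ _ ih => rw [map_mul, map_y]; exact y_mul_mem _ ih
  exact this hn

theorem map_d (g : L →ₗ⁅ℂ⁆ L') (n : StdComplex L) : d (map g n) = map g (d n) := by
  induction n using induction with
  | one => simp
  | add a b ha hb => simp [ha, hb]
  | smul c a ha => simp [ha]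
  | x_mul X a ha => simp [d_x_mul, ha]
  | y_mul X a ha => simp [d_y_mul, ha]

end Map

/-! ### Right multiplication as a left action, and the principal antiautomorphism -/

/-- The right multiplication of `N(𝔩)` on itself twisted to a left action: `x X` acts by
`n ↦ - n (x X)` and `y ξ` acts by `n ↦ -(-1)^(deg n) n (y ξ)`. -/
def rightAction : StdComplex L →ₐ[ℂ] Module.End ℂ (StdComplex L) :=
  lift
    { toFun := fun X => -LinearMap.mulRight ℂ (x X)
      map_add' := fun X Y => by ext; simp [mul_add, add_comm]
      map_smul' := fun c X => by ext; simp }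
    { toFun := fun ξ => -(LinearMap.mulRight ℂ (y ξ) ∘ₗ sigma.toLinearMap)
      map_add' := fun X Y => by ext; simp [mul_add, add_comm]
      map_smul' := fun c X => by ext; simp }
    (fun X Y => by ext n; simp [x_lie, mul_sub, mul_assoc])
    (fun X Y => by ext n; simp [y_lie, mul_sub, mul_assoc])
    (fun X Y => by ext n; simp [mul_assoc, y_mul_y X Y, sigma_sigma])

theorem rightAction_x_mul (X : L) (m n : StdComplex L) :
    rightAction (x X * m) n = -(rightAction m n * x X) := by
  rw [map_mul, rightAction, lift_x]; rfl

theorem rightAction_y_mul (ξ : L) (m n : StdComplex L) :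
    rightAction (y ξ * m) n = -(sigma (rightAction m n) * y ξ) := by
  rw [map_mul, rightAction, lift_y]; rfl

@[simp] theorem rightAction_x (X : L) (n : StdComplex L) :
    rightAction (x X) n = -(n * x X) := by
  rw [rightAction, lift_x]; rfl

@[simp] theorem rightAction_y (ξ : L) (n : StdComplex L) :
    rightAction (y ξ) n = -(sigma n * y ξ) := by
  rw [rightAction, lift_y]; rfl

/-- The principal antiautomorphism `ι` of `N(𝔩)`. -/
def iota : StdComplex L →ₗ[ℂ] StdComplex L where
  toFun m := rightAction m 1
  map_add' a b := by simp
  map_smul' c a := by simp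

@[simp] theorem iota_one : iota (1 : StdComplex L) = 1 := by simp [iota]
@[simp] theorem iota_x (X : L) : iota (x X : StdComplex L) = -x X := by
  simp [iota]
@[simp] theorem iota_y (X : L) : iota (y X : StdComplex L) = -y X := by
  simp [iota]

theorem mem_induction {i : ℤ} {p : ℤ → StdComplex L → Prop} {n : StdComplex L} (hn : n ∈ gr L i)
    (one : p 0 1) (add : ∀ i a b, p i a → p i b → p i (a + b)) (zero : ∀ i, p i 0)
    (smul : ∀ i (c : ℂ) a, p i a → p i (c • a))
    (x_mul : ∀ i X a, a ∈ gr L i → p i a → p i (x X * a))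
    (y_mul : ∀ i ξ a, a ∈ gr L i → p i a → p (i - 1) (y ξ * a)) : p i n := by
  have h : ∀ n, IsMonomial i n → p i n := by
    clear hn
    intro n hn
    induction hn with
    | one => exact one
    | x_mul X h ih => exact x_mul _ X _ (Submodule.subset_span h) ih
    | y_mul X h ih => exact y_mul _ X _ (Submodule.subset_span h) ih
  exact Submodule.span_induction (p := fun n _ => p i n) (fun n hn => h n hn) (zero i)
    (fun a b _ _ ha hb => add i a b ha hb) (fun c a _ ha => smul i c a ha) hn

/-- The twisted action is `(m, n) ↦ (-1)^(deg m deg n) n ι(m)`. -/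
theorem rightAction_apply {i j : ℤ} {m n : StdComplex L} (hm : m ∈ gr L i) (hn : n ∈ gr L j) :
    rightAction m n = sgn (i * j) • (n * iota m) := by
  change rightAction m n = sgn (i * j) • (n * rightAction m 1)
  refine mem_induction (p := fun i m => rightAction m n = sgn (i * j) • (n * rightAction m 1)) hm
    ?_ ?_ ?_ ?_ ?_ ?_
  · simp
  · intro i a b ha hb
    simp [ha, hb, mul_add]
  · simp
  · intro i c a ha
    rw [map_smul, LinearMap.smul_apply, ha, LinearMap.smul_apply, mul_smul_comm, smul_comm]
  · intro i X a ha ih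
    rw [rightAction_x_mul, rightAction_x_mul, ih]
    simp [mul_assoc]
  · intro i X a ha ih
    rw [rightAction_y_mul, rightAction_y_mul, ih, map_smul, map_mul, sigma_of_mem hn, sub_mul,
      one_mul, sgn_sub]
    simp [mul_assoc, smul_smul]

theorem rightAction_mem {i j : ℤ} {m n : StdComplex L} (hm : m ∈ gr L i) (hn : n ∈ gr L j) :
    rightAction m n ∈ gr L (i + j) := by
  refine mem_induction (p := fun i m => rightAction m n ∈ gr L (i + j)) hm ?_ ?_ ?_ ?_ ?_ ?_
  · simpa using hn
  · intro i a b ha hb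
    rw [map_add]; exact add_mem ha hb
  · simp
  · intro i c a ha
    rw [map_smul]; exact Submodule.smul_mem _ c ha
  · intro i X a ha ih
    rw [rightAction_x_mul]
    simpa using neg_mem (mul_mem ih (x_mem X))
  · intro i X a ha ih
    rw [rightAction_y_mul, sigma_of_mem ih, smul_mul_assoc]
    have := neg_mem (Submodule.smul_mem _ (sgn (i + j)) (mul_mem ih (y_mem X)))
    rwa [show i + j + -1 = i - 1 + j by ring] at this

theorem iota_mem {i : ℤ} {m : StdComplex L} (hm : m ∈ gr L i) : iota m ∈ gr L i := by
  have h := rightAction_mem hm one_mem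
  rwa [add_zero] at h

theorem iota_mul {i j : ℤ} {m n : StdComplex L} (hm : m ∈ gr L i) (hn : n ∈ gr L j) :
    iota (m * n) = sgn (i * j) • (iota n * iota m) := by
  change rightAction (m * n) 1 = _
  rw [map_mul]
  exact rightAction_apply hm (iota_mem hn)

theorem rightAction_left_x (m : StdComplex L) (X : L) (n : StdComplex L) :
    rightAction m (x X * n) = x X * rightAction m n := by
  induction m using induction with
  | one => simp
  | add a b ha hb => simp [ha, hb, mul_add]
  | smul c a ha => simp [ha]
  | x_mul Y a ha => simp [ha, mul_assoc]
  | y_mul Y a ha => simp [ha, mul_assoc]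

theorem rightAction_left_y (m : StdComplex L) (ξ : L) (n : StdComplex L) :
    rightAction m (y ξ * n) = y ξ * rightAction (sigma m) n := by
  induction m using induction with
  | one => simp
  | add a b ha hb => simp [ha, hb, mul_add]
  | smul c a ha => simp [ha]
  | x_mul Y a ha => simp [ha, mul_assoc]
  | y_mul Y a ha => simp [ha, mul_assoc]

theorem d_rightAction (m n : StdComplex L) :
    d (rightAction m n) = rightAction (d m) n + rightAction (sigma m) (d n) := by
  induction m using induction with
  | one => simp
  | add a b ha hb => simp [ha, hb]; abel
  | smul c a ha => simp [ha]
  | x_mul X a ha => simp [d_x_mul, d_mul', ha, add_mul]; abel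
  | y_mul X a ha =>
    simp [d_y_mul, d_mul', ha, add_mul, d_sigma, sigma_sigma]
    abel

/-! ### Finite generation over `U(𝔩)` -/

/-- The span of the ordered products of the `y ξ`, `ξ` in a list. -/
def wedge : List L → Submodule ℂ (StdComplex L)
  | [] => ℂ ∙ 1
  | ξ :: l => wedge l ⊔ (wedge l).map (LinearMap.mulLeft ℂ (y ξ))

theorem wedge_finiteDimensional (l : List L) : FiniteDimensional ℂ (wedge l) := by
  induction l with
  | nil => exact inferInstanceAs (FiniteDimensional ℂ (ℂ ∙ (1 : StdComplex L)))
  | cons ξ l ih =>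
    exact inferInstanceAs (FiniteDimensional ℂ
      ↥(wedge l ⊔ (wedge l).map (LinearMap.mulLeft ℂ (y ξ))))

theorem one_mem_wedge (l : List L) : (1 : StdComplex L) ∈ wedge l := by
  induction l with
  | nil => exact Submodule.mem_span_singleton_self 1
  | cons ξ l ih => exact Submodule.mem_sup_left ih

theorem y_mul_mem_wedge (l : List L) {ξ : L} (hξ : ξ ∈ l) {n : StdComplex L} (hn : n ∈ wedge l) :
    y ξ * n ∈ wedge l := by
  induction l generalizing n with
  | nil => simp at hξ
  | cons η l ih =>
    have hyy : (y η * y η : StdComplex L) = 0 := by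
      have := y_mul_y η η
      have h2 : (2 : ℂ) • (y η * y η : StdComplex L) = 0 := by
        rw [two_smul]; exact eq_neg_iff_add_eq_zero.1 this
      exact (smul_eq_zero.1 h2).resolve_left two_ne_zero
    obtain ⟨a, ha, b, hb, rfl⟩ := Submodule.mem_sup.1 hn
    obtain ⟨b, hb, rfl⟩ := hb
    rw [mul_add]
    rcases List.mem_cons.1 hξ with rfl | h
    · refine add_mem (Submodule.mem_sup_right ⟨a, ha, rfl⟩) ?_
      rw [LinearMap.mulLeft_apply, ← mul_assoc, hyy, zero_mul]
      exact zero_mem _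
    · refine add_mem (Submodule.mem_sup_left (ih h ha)) (Submodule.mem_sup_right ?_)
      refine ⟨-(y ξ * b), neg_mem (ih h hb), ?_⟩
      rw [LinearMap.mulLeft_apply, LinearMap.mulLeft_apply, ← mul_assoc, y_mul_y ξ η, mul_neg,
        neg_mul, mul_assoc]

/-- `N(𝔩)` is generated over `U(𝔩)` by a finite-dimensional subspace if `𝔩` is
finite-dimensional. -/
theorem exists_generators [FiniteDimensional ℂ L] : ∃ M : Submodule ℂ (StdComplex L),
    FiniteDimensional ℂ M ∧ ∀ S : Submodule ℂ (StdComplex L), M ≤ S →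
      (∀ X, ∀ n ∈ S, x X * n ∈ S) → S = ⊤ := by
  let b := Module.finBasis ℂ L
  let l := List.ofFn b
  have hy : ∀ ξ, ∀ n ∈ wedge l, y ξ * n ∈ wedge l := by
    intro ξ n hn
    rw [← b.sum_repr ξ, map_sum, Finset.sum_mul]
    refine sum_mem fun i _ => ?_
    rw [map_smul, smul_mul_assoc]
    exact Submodule.smul_mem _ _ (y_mul_mem_wedge l (List.mem_ofFn.2 ⟨i, rfl⟩) hn)
  refine ⟨wedge l, wedge_finiteDimensional l, fun S hS hx => ?_⟩
  -- the smallest such subspace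
  let S₀ : Submodule ℂ (StdComplex L) :=
    sInf {S | wedge l ≤ S ∧ ∀ X, ∀ n ∈ S, x X * n ∈ S}
  have h1 : wedge l ≤ S₀ := le_sInf fun S hS => hS.1
  have h2 : ∀ X, ∀ n ∈ S₀, x X * n ∈ S₀ := fun X n hn =>
    Submodule.mem_sInf.2 fun S hS => hS.2 X n (Submodule.mem_sInf.1 hn S hS)
  let S₁ : Submodule ℂ (StdComplex L) :=
    { carrier := {n | n ∈ S₀ ∧ ∀ ξ, y ξ * n ∈ S₀}
      add_mem' := fun ha hb => ⟨add_mem ha.1 hb.1, fun ξ => by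
        rw [mul_add]; exact add_mem (ha.2 ξ) (hb.2 ξ)⟩
      zero_mem' := ⟨zero_mem _, fun ξ => by simp⟩
      smul_mem' := fun c a ha => ⟨Submodule.smul_mem _ c ha.1, fun ξ => by
        rw [mul_smul_comm]; exact Submodule.smul_mem _ c (ha.2 ξ)⟩ }
  have h3 : S₀ ≤ S₁ := by
    refine sInf_le ⟨fun n hn => ⟨h1 hn, fun ξ => h1 (hy ξ n hn)⟩, fun X n hn => ⟨h2 X n hn.1,
      fun ξ => ?_⟩⟩
    have : y ξ * (x X * n) = x X * (y ξ * n) - y ⁅X, ξ⁆ * n := by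
      rw [y_lie, sub_mul, mul_assoc, mul_assoc]; abel
    rw [this]
    exact sub_mem (h2 X _ (hn.2 ξ)) (hn.2 _)
  have h4 : S₀ ≤ S := sInf_le ⟨hS, hx⟩
  rw [eq_top_iff]
  rintro n -
  refine h4 ?_
  induction n using induction with
  | one => exact h1 (one_mem_wedge l)
  | add a b ha hb => exact add_mem ha hb
  | smul c a ha => exact Submodule.smul_mem _ c ha
  | x_mul X a ha => exact h2 X a ha
  | y_mul X a ha => exact (h3 ha).2 X

/-! ### `N(𝔨)` as a Harish-Chandra DG algebra -/

section HarishChandra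

variable (K : Type u) [Group K] [AffineAlgebraicGroup K]

/-- The action of `K` on `N(𝔨)` induced by the adjoint action. -/
def chi : K →* (StdComplex (LieAlg K) ≃ₐ[ℂ] StdComplex (LieAlg K)) where
  toFun k := AlgEquiv.ofAlgHom (map (Ad k)) (map (Ad k⁻¹))
    (AlgHom.ext fun n => by
      rw [AlgHom.comp_apply, map_map, ← Ad_mul, mul_inv_cancel, Ad_one, map_id]; rfl)
    (AlgHom.ext fun n => by
      rw [AlgHom.comp_apply, map_map, ← Ad_mul, inv_mul_cancel, Ad_one, map_id]; rfl)
  map_one' := AlgEquiv.ext fun n => by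
    change map (Ad 1) n = n
    rw [Ad_one, map_id]
  map_mul' k l := AlgEquiv.ext fun n => by
    change map (Ad (k * l)) n = map (Ad k) (map (Ad l) n)
    rw [map_map, ← Ad_mul]

variable {K}

theorem chi_apply (k : K) (n : StdComplex (LieAlg K)) : chi K k n = map (Ad k) n := rfl

@[simp] theorem chi_x (k : K) (X : LieAlg K) : chi K k (x X) = x (Ad k X) := map_x _ _
@[simp] theorem chi_y (k : K) (X : LieAlg K) : chi K k (y X) = y (Ad k X) := map_y _ _

theorem hasDerivOne_chi (ξ : LieAlg K) (n : StdComplex (LieAlg K)) :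
    HasDerivOne ξ (fun k => chi K k n) (x ξ * n - n * x ξ) := by
  induction n using induction with
  | one => simpa using HasDerivOne.const ξ (1 : StdComplex (LieAlg K))
  | add a b ha hb =>
    refine (ha.add hb).mono (fun k => (map_add _ _ _).symm) ?_
    rw [mul_add, add_mul]; abel
  | smul c a ha =>
    refine (ha.smul c).mono (fun k => (map_smul _ _ _).symm) ?_
    rw [mul_smul_comm, smul_mul_assoc, smul_sub]
  | x_mul X a ha =>
    refine (((hasDerivOne_Ad ξ X).map x).bilin ha (LinearMap.mul ℂ _)).mono (fun k => ?_) ?_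
    · rw [map_mul, chi_x]; rfl
    · simp only [LinearMap.mul_apply', Ad_one, map_one, AlgEquiv.one_apply, LieHom.id_apply, x_lie]
      noncomm_ring
  | y_mul X a ha =>
    refine (((hasDerivOne_Ad ξ X).map y).bilin ha (LinearMap.mul ℂ _)).mono (fun k => ?_) ?_
    · rw [map_mul, chi_y]; rfl
    · simp only [LinearMap.mul_apply', Ad_one, map_one, AlgEquiv.one_apply, LieHom.id_apply, y_lie]
      noncomm_ring

variable (K) in
/-- The Harish-Chandra DG algebra `N(𝔨)`. -/
def hc : HCDGAlgebra (StdComplex (LieAlg K)) K where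
  gr := gr (LieAlg K)
  internal := isInternal
  one_mem := one_mem
  mul_mem := mul_mem
  d := d
  d_mem := d_mem
  d_d := d_d
  d_mul hx n := by rw [d_mul', sigma_of_mem hx, smul_mul_assoc]
  χ := chi K
  χ_algebraic := isAlgebraic_of_isRegular (LinearMap.ext fun n => by simp)
    (fun k l n => by simp) fun n => (hasDerivOne_chi 0 n).isRegular
  χ_mem k _ _ h := map_mem _ h
  χ_d k n := map_d _ n
  ρ := x
  ρ_mem := x_mem
  d_ρ := d_x
  ρ_lie := x_lie
  ρ_Ad k ξ := (chi_x k ξ).symm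
  deriv_χ := hasDerivOne_chi

end HarishChandra

end StdComplex

/-! ## Change of groups -/

section ChangeOfGroups

variable {A : Type w} {K T : Type u} [Ring A] [Algebra ℂ A] [Group K] [AffineAlgebraicGroup K]
  [Group T] [AffineAlgebraicGroup T]

/-- The Harish-Chandra pair `(A, T)` obtained from `(A, K)` and a morphism `γ : T → K`. -/
def HCPair.restrict (P : HCPair A K) (γ : GroupMorphism T K) : HCPair A T where
  φ := P.φ.comp γ.hom
  φ_algebraic := P.φ_algebraic.comp γ
  ψ := P.ψ ∘ₗ (γ.differential : LieAlg T →ₗ[ℂ] LieAlg K)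
  ψ_lie ξ η := by
    change P.ψ (γ.differential ⁅ξ, η⁆) = _
    rw [LieHom.map_lie]
    exact P.ψ_lie _ _
  ψ_Ad t ξ := by
    change P.ψ (γ.differential (Ad t ξ)) = P.φ (γ.hom t) (P.ψ (γ.differential ξ))
    rw [γ.differential_Ad]
    exact P.ψ_Ad _ _
  deriv_φ ξ a := (P.deriv_φ (γ.differential ξ) a).comp γ

variable {P : HCPair A K} (γ : GroupMorphism T K)

open AKDModule

/-- The `(A, T, N(𝔱))`-module underlying an `(A, K, N(𝔨))`-module. -/
def forgetObj (V : AKDModule.{u, v} P (StdComplex.hc K)) :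
    AKDModule.{u, v} (P.restrict γ) (StdComplex.hc T) where
  carrier := V.carrier
  gr := V.gr
  internal := V.internal
  d := V.d
  d_mem := V.d_mem
  d_d := V.d_d
  π := V.π
  π_mem := V.π_mem
  π_d := V.π_d
  ν := V.ν.comp γ.hom
  ν_algebraic := V.ν_algebraic.comp γ
  ν_mem t := V.ν_mem (γ.hom t)
  ν_d t := V.ν_d (γ.hom t)
  ω := V.ω.comp (StdComplex.map γ.differential)
  ω_mem hx hv := V.ω_mem (StdComplex.map_mem γ.differential hx) hv
  d_ω {i x} hx v := by
    have h := V.d_ω (StdComplex.map_mem γ.differential hx) v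
    have h' : (StdComplex.hc K).d (StdComplex.map γ.differential x) =
      StdComplex.map γ.differential ((StdComplex.hc T).d x) := StdComplex.map_d _ _
    rw [h'] at h
    exact h
  π_equivariant t a v := by
    have h := V.π_equivariant (γ.hom t) a v
    rw [← map_inv] at h
    exact h
  ω_equivariant t x v := by
    have h := V.ω_equivariant (γ.hom t) (StdComplex.map γ.differential x) v
    have h' : (StdComplex.hc K).χ (γ.hom t) (StdComplex.map γ.differential x) =
        StdComplex.map γ.differential ((StdComplex.hc T).χ t x) := by
      change StdComplex.map (Ad (γ.hom t)) (StdComplex.map γ.differential x) =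
        StdComplex.map γ.differential (StdComplex.map (Ad t) x)
      rw [StdComplex.map_map, StdComplex.map_map]
      congr 1
      congr 1
      ext ξ
      exact (γ.differential_Ad t ξ).symm
    rw [← map_inv, h'] at h
    exact h
  π_ω a x v := V.π_ω a _ v
  deriv_ν ξ v := by
    have h := (V.deriv_ν (γ.differential ξ) v).comp γ
    refine h.mono (fun _ => rfl) ?_
    have h' : (StdComplex.hc K).ρ (γ.differential ξ) =
      StdComplex.map γ.differential ((StdComplex.hc T).ρ ξ) := (StdComplex.map_x _ _).symm
    rw [h']
    rfl

variable (P) in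
/-- The forgetful functor from `(A, K, N(𝔨))`-modules to `(A, T, N(𝔱))`-modules. -/
def forget : AKDModule.{u, v} P (StdComplex.hc K) ⥤
    AKDModule.{u, v} (P.restrict γ) (StdComplex.hc T) where
  obj := forgetObj γ
  map {V W} f := ⟨f.toLin, fun h => f.map_mem h, fun v => f.map_d v, fun a v => f.map_π a v,
    fun t v => f.map_ν (γ.hom t) v, fun x v => f.map_ω (StdComplex.map γ.differential x) v⟩

variable (P) in
/-- The forgetful functor between the homotopy categories. -/
def forgetHo : HoCat.{u, v} P (StdComplex.hc K) ⥤
    HoCat.{u, v} (P.restrict γ) (StdComplex.hc T) :=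
  CategoryTheory.Quotient.lift Homotopic (forget P γ ⋙ toHo _ _) (by
    rintro V W f g ⟨h, h1, h2, h3, h4, h5⟩
    exact CategoryTheory.Quotient.sound Homotopic ⟨h, h1, h2, fun t v => h3 (γ.hom t) v,
      fun {i x} hx v => h4 (StdComplex.map_mem γ.differential hx) v, h5⟩)

end ChangeOfGroups

/-! ## Auxiliary facts on regular functions -/

section Aux

variable {K : Type u} [Group K] [AffineAlgebraicGroup K] {V : Type v} [AddCommGroup V]
  [Module ℂ V] {N : Type w} [AddCommGroup N] [Module ℂ N]

/-- The derivative of `y ↦ f (F y) y`. -/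
theorem HasDerivOne.eval {ξ : LieAlg K} {F : K → N} {n : N} (hF : HasDerivOne ξ F n)
    (f : N →ₗ[ℂ] (K → V)) (f' : N →ₗ[ℂ] V)
    (hf : ∀ n, HasDerivOne ξ (fun y => f n y) (f' n)) :
    HasDerivOne ξ (fun y => f (F y) y) (f n 1 + f' (F 1)) := by
  obtain ⟨t, ht, rfl⟩ := hF
  have key : ∀ t : Reg K ⊗[ℂ] N, HasDerivOne ξ (fun y => f (extend (evalAt y) t) y)
      (f (extend (tangent ξ) t) 1 + f' (extend (evalAt 1) t)) := by
    intro t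
    induction t with
    | zero =>
      refine (HasDerivOne.const ξ (0 : V)).mono (fun y => ?_) ?_ <;> simp
    | tmul g m =>
      refine ((hasDerivOne_reg ξ g).bilin (hf m) (LinearMap.lsmul ℂ V)).mono (fun y => ?_) ?_
      · simp
      · simp
    | add a b ha hb =>
      refine (ha.add hb).mono (fun y => ?_) ?_
      · simp
      · simp only [map_add, Pi.add_apply]; abel
  exact (key t).mono (fun y => by rw [ht]) (by rw [ht])

/-- The right regular representation on `R(K, V)` is algebraic. -/
theorem IsRegular.orbit {F : K → V} (h : IsRegular F) :
    IsRegular (fun k => (fun x => F (x * k) : K → V)) := by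
  obtain ⟨t, ht⟩ := h
  have key : ∀ t : Reg K ⊗[ℂ] V,
      IsRegular (fun k => (fun x => extend (evalAt (x * k)) t : K → V)) := by
    intro t
    induction t with
    | zero => exact ⟨0, fun k => by funext x; simp⟩
    | tmul f v =>
      obtain ⟨n, g, h, H⟩ := f.exists_mul
      refine ⟨∑ i, h i ⊗ₜ[ℂ] (fun x => (g i).val x • v), fun k => ?_⟩
      funext x
      simp only [map_sum, extend_tmul, evalAt_apply, Finset.sum_apply, Pi.smul_apply, H,
        Finset.sum_smul, smul_smul, mul_comm]
    | add a b ha hb =>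
      obtain ⟨r, hr⟩ := ha.add hb
      exact ⟨r, fun k => (hr k).trans (by funext x; simp)⟩
  simpa only [ht] using key t

end Aux

namespace StdComplex

variable {L : Type u} [LieRing L] [LieAlgebra ℂ L] {H : Type v} [AddCommGroup H] [Module ℂ H]

/-- The representation of `N(𝔩)` determined by the action of the generators. -/
def liftEnd (f g : L →ₗ[ℂ] Module.End ℂ H)
    (hff : ∀ X Y h, f ⁅X, Y⁆ h = f X (f Y h) - f Y (f X h))
    (hfg : ∀ X ξ h, g ⁅X, ξ⁆ h = f X (g ξ h) - g ξ (f X h))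
    (hgg : ∀ ξ η h, g ξ (g η h) = -g η (g ξ h)) : StdComplex L →ₐ[ℂ] Module.End ℂ H :=
  lift f g (fun X Y => LinearMap.ext (hff X Y)) (fun X Y => LinearMap.ext (hfg X Y))
    (fun X Y => LinearMap.ext (hgg X Y))

variable {f g : L →ₗ[ℂ] Module.End ℂ H}
  {hff : ∀ X Y h, f ⁅X, Y⁆ h = f X (f Y h) - f Y (f X h)}
  {hfg : ∀ X ξ h, g ⁅X, ξ⁆ h = f X (g ξ h) - g ξ (f X h)}
  {hgg : ∀ ξ η h, g ξ (g η h) = -g η (g ξ h)}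

theorem liftEnd_x_mul (X : L) (a : StdComplex L) (h : H) :
    liftEnd f g hff hfg hgg (x X * a) h = f X (liftEnd f g hff hfg hgg a h) := by
  rw [liftEnd, map_mul, lift_x]; rfl

theorem liftEnd_y_mul (X : L) (a : StdComplex L) (h : H) :
    liftEnd f g hff hfg hgg (y X * a) h = g X (liftEnd f g hff hfg hgg a h) := by
  rw [liftEnd, map_mul, lift_y]; rfl

end StdComplex

/-! ## The equivariant Zuckerman functor -/

namespace Zuckerman

open StdComplex

variable {A : Type w} {K T : Type u} [Ring A] [Algebra ℂ A] [Group K] [AffineAlgebraicGroup K]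
  [Group T] [AffineAlgebraicGroup T] {P : HCPair A K} {γ : GroupMorphism T K}
  (V : AKDModule.{u, u} (P.restrict γ) (hc T))

/-- `G = λ_𝔨(X) F`, where `λ_𝔨` is the tensor product of the left regular action on `R(K)` with
the action `π` on `V`: `(λ_𝔨(X) F)(k) = π(X) F(k) + d/dt F(exp(-tX) k)` at `t = 0`. -/
def IsLambda (X : LieAlg K) (F G : K → V.carrier) : Prop :=
  ∀ k, HasDerivOne X (fun y => F (y * k)) (V.π (P.ψ X) (F k) - G k)

/-- `f : N(𝔨) → R(K, V)` is an element of degree `p` of `Hom_(𝔨, T, N(𝔱))(N(𝔨), R(K, V))`. -/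
structure IsEqHom (p : ℤ) (f : StdComplex (LieAlg K) →ₗ[ℂ] (K → V.carrier)) : Prop where
  regular : ∀ n, IsRegular (f n)
  degree : ∀ {j : ℤ} {n : StdComplex (LieAlg K)}, n ∈ gr (LieAlg K) j → ∀ k, f n k ∈ V.gr (j + p)
  lie : ∀ X n, IsLambda V X (f n) (f (x X * n))
  group : ∀ t n k, f (chi K (γ.hom t) n) k = V.ν t (f n ((γ.hom t)⁻¹ * k))
  std : ∀ {i : ℤ} {m : StdComplex (LieAlg T)}, m ∈ gr (LieAlg T) i → ∀ n k,
    f (rightAction (map γ.differential m) n) k = sgn (p * i) • V.ω m (f n k)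

variable {V}

theorem IsLambda.add {X : LieAlg K} {F G F' G' : K → V.carrier} (h : IsLambda V X F G)
    (h' : IsLambda V X F' G') : IsLambda V X (F + F') (G + G') := fun k =>
  ((h k).add (h' k)).mono (fun _ => rfl) (by simp only [Pi.add_apply, map_add]; abel)

theorem IsLambda.smul {X : LieAlg K} {F G : K → V.carrier} (h : IsLambda V X F G) (c : ℂ) :
    IsLambda V X (c • F) (c • G) := fun k =>
  ((h k).smul c).mono (fun _ => rfl) (by simp only [Pi.smul_apply, map_smul, smul_sub])

theorem IsLambda.zero {X : LieAlg K} : IsLambda V X 0 0 := fun k =>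
  (HasDerivOne.const X (0 : V.carrier)).mono (fun _ => rfl) (by simp)

variable (V)

/-- The component of degree `p` of `Γ^eq(V)`. -/
def component (p : ℤ) : Submodule ℂ (StdComplex (LieAlg K) →ₗ[ℂ] (K → V.carrier)) where
  carrier := {f | IsEqHom V p f}
  add_mem' {f g} hf hg :=
    { regular := fun n => (hf.regular n).add (hg.regular n)
      degree := fun hn k => add_mem (hf.degree hn k) (hg.degree hn k)
      lie := fun X n => (hf.lie X n).add (hg.lie X n)
      group := fun t n k => by
        simp only [LinearMap.add_apply, Pi.add_apply, hf.group, hg.group, map_add]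
      std := fun hm n k => by
        simp only [LinearMap.add_apply, Pi.add_apply, hf.std hm, hg.std hm, map_add, smul_add] }
  zero_mem' :=
    { regular := fun _ => IsRegular.zero
      degree := fun _ _ => zero_mem _
      lie := fun _ _ => IsLambda.zero
      group := fun t n k => by simp
      std := fun _ n k => by simp }
  smul_mem' c f hf :=
    { regular := fun n => (hf.regular n).smul c
      degree := fun hn k => Submodule.smul_mem _ c (hf.degree hn k)
      lie := fun X n => (hf.lie X n).smul c
      group := fun t n k => by
        simp only [LinearMap.smul_apply, Pi.smul_apply, hf.group, map_smul]
      std := fun hm n k => by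
        simp only [LinearMap.smul_apply, Pi.smul_apply, hf.std hm, map_smul]
        rw [smul_comm] }

/-- The total space of `Γ^eq(V)`. -/
def total : Submodule ℂ (StdComplex (LieAlg K) →ₗ[ℂ] (K → V.carrier)) := ⨆ p, component V p

theorem component_le (p : ℤ) : component V p ≤ total V := le_iSup (component V) p

/-- The operator `f ↦ (n ↦ k ↦ α_k (f (β_k n) (θ k)))`. -/
def op (α : K → Module.End ℂ V.carrier) (β : K → Module.End ℂ (StdComplex (LieAlg K)))
    (θ : K → K) : Module.End ℂ (StdComplex (LieAlg K) →ₗ[ℂ] (K → V.carrier)) where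
  toFun f := LinearMap.pi fun k => α k ∘ₗ LinearMap.proj (θ k) ∘ₗ f ∘ₗ β k
  map_add' f g := by ext n k; simp
  map_smul' c f := by ext n k; simp

variable {V}

/-- An operator respecting the components up to a shift preserves the total space. -/
theorem mem_total_of_component {B : Module.End ℂ (StdComplex (LieAlg K) →ₗ[ℂ] (K → V.carrier))}
    (e : ℤ) (h : ∀ p, ∀ f ∈ component V p, B f ∈ component V (p + e)) :
    ∀ f ∈ total V, B f ∈ total V := fun f hf => by
  have : total V ≤ (total V).comap B :=
    iSup_le fun p f hf => component_le V (p + e) (h p f hf)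
  exact this hf

theorem total_regular {f : StdComplex (LieAlg K) →ₗ[ℂ] (K → V.carrier)} (hf : f ∈ total V)
    (n : StdComplex (LieAlg K)) : IsRegular (f n) :=
  Submodule.iSup_induction (component V) (motive := fun f => IsRegular (f n)) hf
    (fun _ _ hf => hf.regular n) IsRegular.zero fun _ _ => IsRegular.add

theorem total_lie {f : StdComplex (LieAlg K) →ₗ[ℂ] (K → V.carrier)} (hf : f ∈ total V)
    (X : LieAlg K) (n : StdComplex (LieAlg K)) : IsLambda V X (f n) (f (x X * n)) :=
  Submodule.iSup_induction (component V)
    (motive := fun f => IsLambda V X (f n) (f (x X * n))) hf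
    (fun _ _ hf => hf.lie X n) IsLambda.zero fun _ _ => IsLambda.add

variable (V)

/-- The grading involution of `V`. -/
def sigmaV : Module.End ℂ V.carrier := scale V.internal sgn

theorem sigmaV_of_mem {i : ℤ} {v : V.carrier} (hv : v ∈ V.gr i) : sigmaV V v = sgn i • v :=
  scale_of_mem V.internal sgn hv

theorem sigmaV_sigmaV (v : V.carrier) : sigmaV V (sigmaV V v) = v :=
  grading_induction V.internal v
    (fun i v hv => by rw [sigmaV_of_mem V hv, map_smul, sigmaV_of_mem V hv, sgn_smul_smul])
    (by simp) fun v w hv hw => by rw [map_add, map_add, hv, hw]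

theorem d_sigmaV (v : V.carrier) : V.d (sigmaV V v) = -sigmaV V (V.d v) :=
  grading_induction V.internal v
    (fun i v hv => by
      rw [sigmaV_of_mem V hv, map_smul, sigmaV_of_mem V (V.d_mem hv), sgn_add_one, neg_smul,
        neg_neg])
    (by simp) fun v w hv hw => by simp only [map_add, hv, hw, neg_add]

theorem π_sigmaV (a : A) (v : V.carrier) : V.π a (sigmaV V v) = sigmaV V (V.π a v) :=
  grading_induction V.internal v
    (fun i v hv => by rw [sigmaV_of_mem V hv, map_smul, sigmaV_of_mem V (V.π_mem a hv)])
    (by simp) fun v w hv hw => by simp only [map_add, hv, hw]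

/-! ### The operators -/

/-- `π_Γ(a) f = π_R(a) ∘ f`, with `(π_R(a) F)(k) = π(φ(k) a) F(k)`. -/
def piOp (a : A) : Module.End ℂ (StdComplex (LieAlg K) →ₗ[ℂ] (K → V.carrier)) :=
  op V (fun k => V.π (P.φ k a)) (fun _ => 1) id

/-- `ν_Γ(l) f = ν_R(l) ∘ f`, with `(ν_R(l) F)(k) = F(k l)`. -/
def nuOp (l : K) : Module.End ℂ (StdComplex (LieAlg K) →ₗ[ℂ] (K → V.carrier)) :=
  op V (fun _ => 1) (fun _ => 1) fun k => k * l

/-- `f ↦ (-1)^(deg f) f`. -/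
def signOp : Module.End ℂ (StdComplex (LieAlg K) →ₗ[ℂ] (K → V.carrier)) :=
  op V (fun _ => sigmaV V) (fun _ => sigma.toLinearMap) id

/-- The differential of the `Hom`-complex: `d f = d ∘ f - (-1)^(deg f) f ∘ d`. -/
def dOp : Module.End ℂ (StdComplex (LieAlg K) →ₗ[ℂ] (K → V.carrier)) :=
  op V (fun _ => V.d) (fun _ => 1) id - op V (fun _ => 1) (fun _ => d) id ∘ₗ signOp V

/-- `f ↦ (n ↦ k ↦ f (z (Ad k X) n) k)`. -/
def mulOp (z : LieAlg K →ₗ[ℂ] StdComplex (LieAlg K)) :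
    LieAlg K →ₗ[ℂ] Module.End ℂ (StdComplex (LieAlg K) →ₗ[ℂ] (K → V.carrier)) where
  toFun X := op V (fun _ => 1) (fun k => LinearMap.mulLeft ℂ (z (Ad k X))) id
  map_add' X Y := by
    ext f n k
    simp [op, add_mul]
  map_smul' c X := by
    ext f n k
    simp [op]

section Apply

variable {V} (f : StdComplex (LieAlg K) →ₗ[ℂ] (K → V.carrier)) (n : StdComplex (LieAlg K)) (k : K)

theorem piOp_apply (a : A) : piOp V a f n k = V.π (P.φ k a) (f n k) := rfl
theorem nuOp_apply (l : K) : nuOp V l f n k = f n (k * l) := rfl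
theorem signOp_apply : signOp V f n k = sigmaV V (f (sigma n) k) := rfl
theorem dOp_apply : dOp V f n k = V.d (f n k) - sigmaV V (f (sigma (d n)) k) := rfl
theorem mulOp_apply (z : LieAlg K →ₗ[ℂ] StdComplex (LieAlg K)) (X : LieAlg K) :
    mulOp V z X f n k = f (z (Ad k X) * n) k := rfl

end Apply

theorem signOp_of_mem {p : ℤ} {f : StdComplex (LieAlg K) →ₗ[ℂ] (K → V.carrier)}
    (hf : f ∈ component V p) : signOp V f = sgn p • f := by
  refine linearMap_ext_grading StdComplex.isInternal fun j n hn => ?_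
  funext k
  have h := hf.degree hn k
  rw [signOp_apply, sigma_of_mem hn, map_smul, Pi.smul_apply, map_smul, sigmaV_of_mem V h,
    sgn_add, mul_smul, sgn_smul_smul]
  rfl

/-- The action of the generators of degree `0`: `f ↦ (n ↦ k ↦ -f (Ad k(X) n) k)`. -/
def evenOp : LieAlg K →ₗ[ℂ] Module.End ℂ (StdComplex (LieAlg K) →ₗ[ℂ] (K → V.carrier)) where
  toFun X := -mulOp V x X
  map_add' X Y := by
    ext f n k
    simp only [map_add, LinearMap.neg_apply, LinearMap.add_apply, Pi.neg_apply, Pi.add_apply]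
    abel
  map_smul' c X := by
    ext f n k
    simp only [map_smul, LinearMap.neg_apply, LinearMap.smul_apply, Pi.neg_apply,
      Pi.smul_apply, RingHom.id_apply, smul_neg]

/-- The action of the generators of degree `-1`: `f ↦ (n ↦ k ↦ -(-1)^(deg f) f (Ad k(ξ) n) k)`. -/
def oddOp : LieAlg K →ₗ[ℂ] Module.End ℂ (StdComplex (LieAlg K) →ₗ[ℂ] (K → V.carrier)) where
  toFun ξ := -(mulOp V y ξ ∘ₗ signOp V)
  map_add' X Y := by
    ext f n k
    simp only [map_add, LinearMap.neg_apply, LinearMap.add_apply, Pi.neg_apply, Pi.add_apply,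
      LinearMap.comp_apply]
    abel
  map_smul' c X := by
    ext f n k
    simp only [map_smul, LinearMap.neg_apply, LinearMap.smul_apply, Pi.neg_apply,
      Pi.smul_apply, RingHom.id_apply, smul_neg, LinearMap.comp_apply]

section OmegaAux

variable {V} (f : StdComplex (LieAlg K) →ₗ[ℂ] (K → V.carrier)) (n : StdComplex (LieAlg K)) (k : K)
  (X Y : LieAlg K)

theorem evenOp_apply : evenOp V X f n k = -f (x (Ad k X) * n) k := rfl

theorem oddOp_apply : oddOp V X f n k = sigmaV V (f (y (Ad k X) * sigma n) k) := by
  change -sigmaV V (f (sigma (y (Ad k X) * n)) k) = _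
  rw [map_mul, sigma_y, neg_mul, map_neg, Pi.neg_apply, map_neg, neg_neg]

theorem evenOp_lie : evenOp V ⁅X, Y⁆ f = evenOp V X (evenOp V Y f) - evenOp V Y (evenOp V X f) := by
  refine LinearMap.ext fun n => funext fun k => ?_
  rw [LinearMap.sub_apply, Pi.sub_apply, evenOp_apply, evenOp_apply, evenOp_apply, evenOp_apply,
    evenOp_apply, neg_neg, neg_neg, LieHom.map_lie, x_lie, sub_mul, map_sub, mul_assoc, mul_assoc,
    Pi.sub_apply, neg_sub]

theorem oddOp_lie : oddOp V ⁅X, Y⁆ f = evenOp V X (oddOp V Y f) - oddOp V Y (evenOp V X f) := by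
  refine LinearMap.ext fun n => funext fun k => ?_
  rw [LinearMap.sub_apply, Pi.sub_apply, evenOp_apply, oddOp_apply, oddOp_apply, oddOp_apply,
    evenOp_apply, map_neg, LieHom.map_lie, y_lie, sub_mul, map_sub, mul_assoc, mul_assoc,
    Pi.sub_apply, map_sub, map_mul sigma, sigma_x, sub_neg_eq_add, neg_add_eq_sub]

theorem oddOp_oddOp : oddOp V X (oddOp V Y f) = -oddOp V Y (oddOp V X f) := by
  refine LinearMap.ext fun n => funext fun k => ?_
  rw [LinearMap.neg_apply, Pi.neg_apply, oddOp_apply, oddOp_apply, oddOp_apply, oddOp_apply,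
    map_mul sigma, map_mul sigma, sigma_y, sigma_y, neg_mul, neg_mul, mul_neg, mul_neg,
    ← mul_assoc, ← mul_assoc, y_mul_y (Ad k Y) (Ad k X), neg_mul, neg_neg, map_neg, Pi.neg_apply,
    map_neg, map_neg, neg_neg]

end OmegaAux

/-- The action `ω_Γ` of `N(𝔨)`, determined by the action of the generators. It is given by
`(ω_Γ(n) f)(m)(k) = (-1)^(deg n deg f) f(Ad k(ι n) m)(k)`. -/
def omegaOp : StdComplex (LieAlg K) →ₐ[ℂ]
    Module.End ℂ (StdComplex (LieAlg K) →ₗ[ℂ] (K → V.carrier)) :=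
  liftEnd (evenOp V) (oddOp V) (fun X Y f => evenOp_lie f X Y) (fun X Y f => oddOp_lie f X Y)
    (fun X Y f => oddOp_oddOp f X Y)

theorem omegaOp_x_mul (X : LieAlg K) (a : StdComplex (LieAlg K))
    (f : StdComplex (LieAlg K) →ₗ[ℂ] (K → V.carrier)) :
    omegaOp V (x X * a) f = evenOp V X (omegaOp V a f) := liftEnd_x_mul X a f

theorem omegaOp_y_mul (X : LieAlg K) (a : StdComplex (LieAlg K))
    (f : StdComplex (LieAlg K) →ₗ[ℂ] (K → V.carrier)) :
    omegaOp V (y X * a) f = oddOp V X (omegaOp V a f) := liftEnd_y_mul X a f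

theorem omegaOp_one (f : StdComplex (LieAlg K) →ₗ[ℂ] (K → V.carrier)) :
    omegaOp V 1 f = f := LinearMap.congr_fun (map_one (omegaOp V)) f

end Zuckerman

namespace Zuckerman

open StdComplex

variable {A : Type w} {K T : Type u} [Ring A] [Algebra ℂ A] [Group K] [AffineAlgebraicGroup K]
  [Group T] [AffineAlgebraicGroup T] {P : HCPair A K} {γ : GroupMorphism T K}
  (V : AKDModule.{u, u} (P.restrict γ) (hc T))

/-! ### Commutation relations -/

section Commutation

variable {V} (f : StdComplex (LieAlg K) →ₗ[ℂ] (K → V.carrier))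

theorem signOp_signOp : signOp V (signOp V f) = f := by
  ext n k
  rw [signOp_apply, signOp_apply, sigma_sigma, sigmaV_sigmaV]

theorem dOp_evenOp (X : LieAlg K) : dOp V (evenOp V X f) = evenOp V X (dOp V f) := by
  refine LinearMap.ext fun n => funext fun k => ?_
  rw [dOp_apply, evenOp_apply, evenOp_apply, evenOp_apply, dOp_apply, d_x_mul, map_mul sigma,
    sigma_x, map_neg, map_neg, neg_sub, neg_sub_neg]

theorem dOp_oddOp (ξ : LieAlg K) :
    dOp V (oddOp V ξ f) = evenOp V ξ f - oddOp V ξ (dOp V f) := by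
  refine LinearMap.ext fun n => funext fun k => ?_
  rw [LinearMap.sub_apply, Pi.sub_apply, dOp_apply, evenOp_apply, oddOp_apply, oddOp_apply,
    oddOp_apply, dOp_apply, d_y_mul, map_sub sigma, map_mul sigma, map_mul sigma, sigma_x, sigma_y,
    d_sigma, map_neg sigma, sigma_sigma, sigma_sigma, neg_mul_neg, map_sub f, map_sub (sigmaV V),
    Pi.sub_apply, map_sub (sigmaV V), sigmaV_sigmaV, map_sub (sigmaV V), sigmaV_sigmaV, sigmaV_sigmaV,
    d_sigmaV]
  abel

theorem d_omegaOp (m : StdComplex (LieAlg K)) : dOp V (omegaOp V m f) =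
    omegaOp V (d m) f + omegaOp V (sigma m) (dOp V f) := by
  induction m using StdComplex.induction with
  | one => rw [omegaOp_one, d_one, map_one, omegaOp_one, map_zero, LinearMap.zero_apply, zero_add]
  | add a b ha hb => simp only [map_add, LinearMap.add_apply, ha, hb]; abel
  | smul c a ha => simp only [map_smul, LinearMap.smul_apply, ha, smul_add]
  | x_mul X a ha =>
    rw [omegaOp_x_mul, dOp_evenOp, ha, d_x_mul, map_mul sigma, sigma_x, omegaOp_x_mul,
      omegaOp_x_mul, map_add]
  | y_mul ξ a ha =>
    rw [omegaOp_y_mul, dOp_oddOp, ha, d_y_mul, map_mul sigma, sigma_y, neg_mul, map_sub,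
      map_neg, LinearMap.sub_apply, LinearMap.neg_apply, omegaOp_x_mul, omegaOp_y_mul,
      omegaOp_y_mul, map_add]
    abel

theorem piOp_omegaOp (a : A) (m : StdComplex (LieAlg K)) :
    piOp V a (omegaOp V m f) = omegaOp V m (piOp V a f) := by
  have he : ∀ X f, piOp V a (evenOp V X f) = evenOp V X (piOp V a f) := fun X f => by
    refine LinearMap.ext fun n => funext fun k => ?_
    rw [piOp_apply, evenOp_apply, evenOp_apply, piOp_apply, map_neg]
  have ho : ∀ X f, piOp V a (oddOp V X f) = oddOp V X (piOp V a f) := fun X f => by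
    refine LinearMap.ext fun n => funext fun k => ?_
    rw [piOp_apply, oddOp_apply, oddOp_apply, piOp_apply, π_sigmaV]
  induction m using StdComplex.induction with
  | one => rw [omegaOp_one, omegaOp_one]
  | add a b ha hb => simp only [map_add, LinearMap.add_apply, ha, hb]
  | smul c a ha => simp only [map_smul, LinearMap.smul_apply, ha]
  | x_mul X a ha => rw [omegaOp_x_mul, he, ha, omegaOp_x_mul]
  | y_mul ξ a ha => rw [omegaOp_y_mul, ho, ha, omegaOp_y_mul]

theorem nuOp_omegaOp (l : K) (m : StdComplex (LieAlg K)) :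
    nuOp V l (omegaOp V m f) = omegaOp V (chi K l m) (nuOp V l f) := by
  have he : ∀ X f, nuOp V l (evenOp V X f) = evenOp V (Ad l X) (nuOp V l f) := fun X f => by
    refine LinearMap.ext fun n => funext fun k => ?_
    rw [nuOp_apply, evenOp_apply, evenOp_apply, nuOp_apply, Ad_mul, LieHom.comp_apply]
  have ho : ∀ X f, nuOp V l (oddOp V X f) = oddOp V (Ad l X) (nuOp V l f) := fun X f => by
    refine LinearMap.ext fun n => funext fun k => ?_
    rw [nuOp_apply, oddOp_apply, oddOp_apply, nuOp_apply, Ad_mul, LieHom.comp_apply]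
  induction m using StdComplex.induction with
  | one => rw [omegaOp_one, map_one, omegaOp_one]
  | add a b ha hb => simp only [map_add, LinearMap.add_apply, ha, hb]
  | smul c a ha => simp only [map_smul, LinearMap.smul_apply, ha]
  | x_mul X a ha => rw [omegaOp_x_mul, he, ha, map_mul (chi K l), chi_x, omegaOp_x_mul]
  | y_mul ξ a ha => rw [omegaOp_y_mul, ho, ha, map_mul (chi K l), chi_y, omegaOp_y_mul]

end Commutation

/-! ### The operators respect the components -/

section Components

variable {V} {p : ℤ} {f : StdComplex (LieAlg K) →ₗ[ℂ] (K → V.carrier)}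

theorem piOp_mem (a : A) (hf : f ∈ component V p) : piOp V a f ∈ component V p where
  regular n := (P.φ_algebraic.isRegular a).bilin (hf.regular n) V.π.toLinearMap
  degree hn k := V.π_mem _ (hf.degree hn k)
  lie X n k := by
    have h1 : HasDerivOne X (fun y => P.φ (y * k) a)
        (P.ψ X * P.φ k a - P.φ k a * P.ψ X) :=
      (P.deriv_φ X (P.φ k a)).mono (fun y => by rw [map_mul]; rfl) rfl
    refine (h1.bilin (hf.lie X n k) V.π.toLinearMap).mono (fun y => rfl) ?_
    simp only [one_mul, AlgHom.toLinearMap_apply, map_sub, map_mul, LinearMap.sub_apply,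
      Module.End.mul_apply, piOp_apply]
    abel
  group t n k := by
    rw [piOp_apply, piOp_apply, hf.group]
    have h := V.π_equivariant t (P.φ ((γ.hom t)⁻¹ * k) a) (V.ν t (f n ((γ.hom t)⁻¹ * k)))
    have e1 : (P.restrict γ).φ t (P.φ ((γ.hom t)⁻¹ * k) a) = P.φ k a := by
      change P.φ (γ.hom t) _ = _
      rw [← AlgEquiv.mul_apply, ← map_mul, mul_inv_cancel_left]
    have e2 : V.ν t⁻¹ (V.ν t (f n ((γ.hom t)⁻¹ * k))) = f n ((γ.hom t)⁻¹ * k) := by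
      rw [← Module.End.mul_apply, ← map_mul, inv_mul_cancel, map_one]; rfl
    rwa [e1, e2] at h
  std hm n k := by
    rw [piOp_apply, piOp_apply, hf.std hm, map_smul, V.π_ω]

theorem nuOp_mem (l : K) (hf : f ∈ component V p) : nuOp V l f ∈ component V p where
  regular n := (hf.regular n).mul_right l
  degree hn k := hf.degree hn _
  lie X n k := (hf.lie X n (k * l)).mono (fun y => by rw [nuOp_apply, mul_assoc]) rfl
  group t n k := by rw [nuOp_apply, nuOp_apply, hf.group, mul_assoc]
  std hm n k := by rw [nuOp_apply, nuOp_apply, hf.std hm]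

theorem signOp_mem (hf : f ∈ component V p) : signOp V f ∈ component V p := by
  rw [signOp_of_mem V hf]
  exact Submodule.smul_mem _ _ hf

theorem dOp_apply_of_mem (hf : f ∈ component V p) (n : StdComplex (LieAlg K)) (k : K) :
    dOp V f n k = V.d (f n k) - sgn p • f (d n) k := by
  have h := congrFun (LinearMap.congr_fun (signOp_of_mem V hf) (d n)) k
  rw [dOp_apply, ← signOp_apply, h]
  rfl

theorem dOp_mem (hf : f ∈ component V p) : dOp V f ∈ component V (p + 1) where
  regular n := by
    obtain ⟨t, ht⟩ := ((hf.regular n).map V.d).add ((hf.regular (d n)).smul (-sgn p))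
    refine ⟨t, fun k => (ht k).trans ?_⟩
    change V.d (f n k) + -sgn p • f (d n) k = _
    rw [dOp_apply_of_mem hf, neg_smul, ← sub_eq_add_neg]
  degree {j n} hn k := by
    rw [dOp_apply_of_mem hf]
    have h1 := V.d_mem (hf.degree hn k)
    have h2 := hf.degree (d_mem hn) k
    rw [add_assoc] at h1
    rw [show j + 1 + p = j + (p + 1) by ring] at h2
    exact sub_mem h1 (Submodule.smul_mem _ _ h2)
  lie X n k := by
    refine (((hf.lie X n k).map V.d).add ((hf.lie X (d n) k).smul (-sgn p))).mono
      (fun y => by rw [dOp_apply_of_mem hf, neg_smul, ← sub_eq_add_neg]) ?_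
    rw [dOp_apply_of_mem hf, dOp_apply_of_mem hf, d_x_mul]
    simp only [map_sub, map_smul, V.π_d, neg_smul, smul_sub]
    abel
  group t n k := by
    rw [dOp_apply_of_mem hf, dOp_apply_of_mem hf, hf.group, V.ν_d, chi_apply, map_d, ← chi_apply,
      hf.group, map_sub, map_smul]
  std {i m} hm n k := by
    have hm' : map γ.differential m ∈ gr (LieAlg K) i := map_mem _ hm
    have e := V.d_ω hm (f n k)
    have e' : (hc T).d m = d m := rfl
    rw [e'] at e
    rw [dOp_apply_of_mem hf, dOp_apply_of_mem hf, hf.std hm, d_rightAction, sigma_of_mem hm',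
      map_d, map_smul rightAction, LinearMap.smul_apply, map_add, map_smul f, Pi.add_apply,
      Pi.smul_apply, hf.std hm, hf.std (d_mem hm), map_smul, e, map_sub, map_smul]
    simp only [smul_add, smul_sub, smul_smul, mul_add, add_mul, mul_one, one_mul, sgn_add]
    have h1 : sgn p * (sgn (p * i) * sgn p) = sgn (p * i) := by
      rw [mul_left_comm, sgn_mul_self, mul_one]
    have h2 : sgn p * (sgn i * sgn (p * i)) = sgn (p * i) * sgn i * sgn p := by ring
    rw [h1, h2]
    abel

theorem mulOp_mem {z : LieAlg K →ₗ[ℂ] StdComplex (LieAlg K)} (e : ℤ)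
    (hz : ∀ X, z X ∈ gr (LieAlg K) e) (hz_lie : ∀ X Y, z ⁅Y, X⁆ = x Y * z X - z X * x Y)
    (hz_chi : ∀ k X, chi K k (z X) = z (Ad k X))
    (hz_right : ∀ {i : ℤ} {m : StdComplex (LieAlg K)}, m ∈ gr (LieAlg K) i → ∀ X n,
      z X * rightAction m n = sgn (e * i) • rightAction m (z X * n))
    (X : LieAlg K) (hf : f ∈ component V p) : mulOp V z X f ∈ component V (p + e) := by
  have key : ∀ (Y : LieAlg K) (n : StdComplex (LieAlg K)) (k : K),
      HasDerivOne Y (fun y => f (z (Ad (y * k) X) * n) (y * k))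
        (V.π (P.ψ Y) (f (z (Ad k X) * n) k) - f (z (Ad k X) * (x Y * n)) k) := by
    intro Y n k
    have h1 : HasDerivOne Y (fun y => z (Ad y (Ad k X)) * n) (z ⁅Y, Ad k X⁆ * n) :=
      (hasDerivOne_Ad Y (Ad k X)).map (LinearMap.mulRight ℂ n ∘ₗ z)
    let fk : StdComplex (LieAlg K) →ₗ[ℂ] (K → V.carrier) :=
      LinearMap.pi fun y => LinearMap.proj (y * k) ∘ₗ f
    let f' : StdComplex (LieAlg K) →ₗ[ℂ] V.carrier :=
      V.π (P.ψ Y) ∘ₗ LinearMap.proj k ∘ₗ f -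
        LinearMap.proj k ∘ₗ f ∘ₗ LinearMap.mulLeft ℂ (x Y)
    have h2 := h1.eval fk f' fun n => hf.lie Y n k
    refine h2.mono (fun y => ?_) ?_
    · rw [Ad_mul]; rfl
    · change f (z ⁅Y, Ad k X⁆ * n) (1 * k) + (V.π (P.ψ Y) (f (z (Ad 1 (Ad k X)) * n) k) -
        f (x Y * (z (Ad 1 (Ad k X)) * n)) k) = _
      rw [Ad_one, LieHom.id_apply, one_mul, hz_lie, sub_mul, map_sub, Pi.sub_apply, mul_assoc,
        mul_assoc]
      abel
  exact
  { regular := fun n =>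
      ((key 0 n 1).mono (fun y => by rw [mul_one]; rfl) rfl : HasDerivOne 0
        (mulOp V z X f n) _).isRegular
    degree := fun {j n} hn k => by
      rw [show j + (p + e) = e + j + p by ring]
      exact hf.degree (mul_mem (hz _) hn) k
    lie := fun Y n k => key Y n k
    group := fun t n k => by
      rw [mulOp_apply, mulOp_apply, ← hf.group, map_mul (chi K _), hz_chi]
      rw [← LieHom.comp_apply, ← Ad_mul, mul_inv_cancel_left]
    std := fun {i m} hm n k => by
      rw [mulOp_apply, mulOp_apply, hz_right (map_mem _ hm), map_smul, Pi.smul_apply, hf.std hm,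
        smul_smul, ← sgn_add]
      congr 2
      ring }

theorem mulOp_x_mem (X : LieAlg K) (hf : f ∈ component V p) :
    mulOp V x X f ∈ component V p := by
  have h := mulOp_mem 0 x_mem (fun X Y => x_lie Y X) chi_x
    (fun {i m} hm X n => by rw [rightAction_left_x]; simp) X hf
  rwa [add_zero] at h

theorem mulOp_y_mem (X : LieAlg K) (hf : f ∈ component V p) :
    mulOp V y X f ∈ component V (p - 1) :=
  mulOp_mem (-1) y_mem (fun X Y => y_lie Y X) chi_y
    (fun {i m} hm X n => by
      rw [rightAction_left_y, sigma_of_mem hm, map_smul, LinearMap.smul_apply, mul_smul_comm,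
        neg_one_mul, sgn_neg, sgn_smul_smul]) X hf

theorem evenOp_mem (X : LieAlg K) (hf : f ∈ component V p) : evenOp V X f ∈ component V p :=
  neg_mem (mulOp_x_mem X hf)

theorem oddOp_mem (X : LieAlg K) (hf : f ∈ component V p) : oddOp V X f ∈ component V (p - 1) :=
  neg_mem (mulOp_y_mem X (signOp_mem hf))

theorem oddOp_apply_of_mem (X : LieAlg K) (hf : f ∈ component V p) (n : StdComplex (LieAlg K))
    (k : K) : oddOp V X f n k = -(sgn p • f (y (Ad k X) * n) k) := by
  have h := congrFun (LinearMap.congr_fun (signOp_of_mem V hf) (y (Ad k X) * n)) k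
  exact congrArg Neg.neg h

theorem omegaOp_mem {i : ℤ} {m : StdComplex (LieAlg K)} (hm : m ∈ gr (LieAlg K) i)
    (hf : f ∈ component V p) : omegaOp V m f ∈ component V (p + i) := by
  refine mem_induction (p := fun i m => omegaOp V m f ∈ component V (p + i)) hm ?_ ?_ ?_ ?_ ?_ ?_
  · rw [omegaOp_one, add_zero]; exact hf
  · intro i a b ha hb
    rw [map_add]; exact add_mem ha hb
  · intro i
    rw [map_zero]; exact zero_mem _
  · intro i c a ha
    rw [map_smul]; exact Submodule.smul_mem _ c ha
  · intro i X a _ ih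
    rw [omegaOp_x_mul]; exact evenOp_mem X ih
  · intro i X a _ ih
    rw [omegaOp_y_mul, ← add_sub_assoc]; exact oddOp_mem X ih

/-- The formula for the action `ω_Γ`. -/
theorem omegaOp_apply {i : ℤ} {m : StdComplex (LieAlg K)} (hm : m ∈ gr (LieAlg K) i)
    (hf : f ∈ component V p) (n : StdComplex (LieAlg K)) (k : K) :
    omegaOp V m f n k = sgn (i * p) • f (chi K k (iota m) * n) k := by
  refine mem_induction (p := fun i m => ∀ n, omegaOp V m f n k =
    sgn (i * p) • f (chi K k (iota m) * n) k) hm ?_ ?_ ?_ ?_ ?_ ?_ n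
  · intro n
    rw [omegaOp_one, zero_mul, sgn_zero, one_smul, iota_one, map_one, one_mul]
  · intro i a b ha hb n
    simp only [map_add, LinearMap.add_apply, Pi.add_apply, ha, hb, add_mul, smul_add]
  · intro i n; simp
  · intro i c a ha n
    simp only [map_smul, LinearMap.smul_apply, Pi.smul_apply, ha, smul_mul_assoc]
    rw [smul_comm]
  · intro i X a _ ih n
    have h : iota (x X * a) = -(iota a * x X) := rightAction_x_mul X a 1
    rw [omegaOp_x_mul, evenOp_apply, ih, h, map_neg, map_mul (chi K _),
      chi_x, neg_mul, mul_assoc, map_neg, Pi.neg_apply, smul_neg]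
  · intro i X a ha ih n
    have h : iota (y X * a) = -(sgn i • (iota a * y X)) := by
      have : iota (y X * a) = -(sigma (iota a) * y X) := rightAction_y_mul X a 1
      rw [sigma_of_mem (iota_mem ha), smul_mul_assoc] at this
      exact this
    rw [omegaOp_y_mul, oddOp_apply_of_mem X (omegaOp_mem ha hf), ih, h, map_neg, map_smul, map_mul (chi K _), chi_y, neg_mul, smul_mul_assoc, mul_assoc,
      map_neg, map_smul, Pi.neg_apply, Pi.smul_apply, smul_neg, smul_smul, smul_smul, sub_mul,
      one_mul, sgn_add, sgn_sub]
    congr 2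
    ring

end Components

end Zuckerman

namespace Zuckerman

open StdComplex

variable {A : Type w} {K T : Type u} [Ring A] [Algebra ℂ A] [Group K] [AffineAlgebraicGroup K]
  [Group T] [AffineAlgebraicGroup T] {P : HCPair A K} {γ : GroupMorphism T K}
  (V : AKDModule.{u, u} (P.restrict γ) (hc T))

/-! ### The module `Γ^eq(V)` -/

/-- The total space of `Γ^eq(V)`, as a vector space. -/
def Space : Type u := ↥(total V)

instance : AddCommGroup (Space V) := inferInstanceAs (AddCommGroup ↥(total V))
instance : Module ℂ (Space V) := inferInstanceAs (Module ℂ ↥(total V))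

/-- An element of `Γ^eq(V)` as a linear map `N(𝔨) → R(K, V)`. -/
def val : Space V →ₗ[ℂ] (StdComplex (LieAlg K) →ₗ[ℂ] (K → V.carrier)) := (total V).subtype

variable {V} in
theorem val_mem (f : Space V) : val V f ∈ total V := Subtype.property f

variable {V} in
/-- Construct an element of `Γ^eq(V)`. -/
def Space.mk (f : StdComplex (LieAlg K) →ₗ[ℂ] (K → V.carrier)) (hf : f ∈ total V) : Space V :=
  ⟨f, hf⟩

variable {V} in
@[simp] theorem val_mk (f : StdComplex (LieAlg K) →ₗ[ℂ] (K → V.carrier)) (hf : f ∈ total V) :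
    val V (Space.mk f hf) = f := rfl

variable {V} in
theorem Space.ext {f g : Space V} (h : val V f = val V g) : f = g := Subtype.ext h

variable {V} in
theorem Space.ext' {f g : Space V} (h : ∀ n k, val V f n k = val V g n k) : f = g :=
  Space.ext (LinearMap.ext fun n => funext fun k => h n k)

/-- Restriction of an operator to the total space. -/
def restrictOp (B : Module.End ℂ (StdComplex (LieAlg K) →ₗ[ℂ] (K → V.carrier)))
    (hB : ∀ f ∈ total V, B f ∈ total V) : Module.End ℂ (Space V) where
  toFun f := Space.mk (B (val V f)) (hB _ (val_mem f))
  map_add' f g := Space.ext (by simp only [val_mk, map_add])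
  map_smul' c f := Space.ext (by simp only [val_mk, map_smul, RingHom.id_apply])

@[simp] theorem val_restrictOp (B hB) (f : Space V) :
    val V (restrictOp V B hB f) = B (val V f) := rfl

/-- The grading of the total space. -/
def totalGr (p : ℤ) : Submodule ℂ (Space V) := (component V p).comap (val V)

variable {V} in
theorem mem_totalGr {p : ℤ} {f : Space V} : f ∈ totalGr V p ↔ val V f ∈ component V p := Iff.rfl

theorem iSup_totalGr : ⨆ p, totalGr V p = ⊤ := by
  have hinj : Function.Injective (val V) := fun f g h => Space.ext h
  have hrange : LinearMap.range (val V) = total V := Submodule.range_subtype _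
  apply Submodule.map_injective_of_injective hinj
  rw [Submodule.map_iSup, Submodule.map_top, hrange]
  refine iSup_congr fun p => ?_
  rw [totalGr, Submodule.map_comap_eq, hrange]
  exact inf_eq_right.2 (component_le V p)

/-- Auxiliary: the operator multiplying elements of degree `p` by `2^p`. -/
def scaleOp : Module.End ℂ (StdComplex (LieAlg K) →ₗ[ℂ] (K → V.carrier)) :=
  op V (fun _ => scale V.internal fun i => 2 ^ i)
      (fun _ => scale StdComplex.isInternal fun i => 2 ^ (-i)) id

theorem scaleOp_apply (f : StdComplex (LieAlg K) →ₗ[ℂ] (K → V.carrier)) (n k) :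
    scaleOp V f n k = scale V.internal (fun i => 2 ^ i)
      (f (scale StdComplex.isInternal (fun i => 2 ^ (-i)) n) k) := rfl

theorem scaleOp_of_mem {p : ℤ} {f : StdComplex (LieAlg K) →ₗ[ℂ] (K → V.carrier)}
    (hf : f ∈ component V p) : scaleOp V f = (2 : ℂ) ^ p • f := by
  refine linearMap_ext_grading StdComplex.isInternal fun j n hn => ?_
  funext k
  rw [LinearMap.smul_apply, Pi.smul_apply, scaleOp_apply, scale_of_mem _ _ hn, map_smul,
    Pi.smul_apply, map_smul, scale_of_mem _ _ (hf.degree hn k), smul_smul,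
    ← zpow_add₀ two_ne_zero]
  congr 2
  ring

theorem isInternal_total : DirectSum.IsInternal (totalGr V) := by
  have hE' : ∀ f ∈ total V, scaleOp V f ∈ total V :=
    mem_total_of_component 0 fun p f hf => by
      rw [scaleOp_of_mem V hf, add_zero]; exact Submodule.smul_mem _ _ hf
  refine isInternal_of_scale (restrictOp V (scaleOp V) hE') (fun p f hf => Space.ext ?_)
    (iSup_totalGr V)
  rw [val_restrictOp, map_smul]
  exact scaleOp_of_mem V hf

theorem piOp_total (a : A) : ∀ f ∈ total V, piOp V a f ∈ total V :=
  mem_total_of_component 0 fun _ _ hf => by rw [add_zero]; exact piOp_mem a hf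

theorem nuOp_total (l : K) : ∀ f ∈ total V, nuOp V l f ∈ total V :=
  mem_total_of_component 0 fun _ _ hf => by rw [add_zero]; exact nuOp_mem l hf

theorem dOp_total : ∀ f ∈ total V, dOp V f ∈ total V :=
  mem_total_of_component 1 fun _ _ hf => dOp_mem hf

theorem omegaOp_total (m : StdComplex (LieAlg K)) : ∀ f ∈ total V, omegaOp V m f ∈ total V := by
  intro f hf
  refine grading_induction StdComplex.isInternal m (fun i m hm => ?_) ?_ fun a b ha hb => ?_
  · exact mem_total_of_component i (fun _ _ hf => omegaOp_mem hm hf) f hf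
  · rw [map_zero]; exact zero_mem _
  · rw [map_add]; exact add_mem ha hb

/-- The differential of `Γ^eq(V)`. -/
def dΓ : Module.End ℂ (Space V) := restrictOp V (dOp V) (dOp_total V)

/-- The action of `A` on `Γ^eq(V)`. -/
def πΓ : A →ₐ[ℂ] Module.End ℂ (Space V) where
  toFun a := restrictOp V (piOp V a) (piOp_total V a)
  map_one' := LinearMap.ext fun f => Space.ext' fun n k => by
    rw [val_restrictOp, piOp_apply, map_one, map_one]; rfl
  map_mul' a b := LinearMap.ext fun f => Space.ext' fun n k => by
    rw [Module.End.mul_apply, val_restrictOp, val_restrictOp, val_restrictOp, piOp_apply,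
      piOp_apply, piOp_apply, map_mul, map_mul]; rfl
  map_zero' := LinearMap.ext fun f => Space.ext' fun n k => by
    rw [val_restrictOp, piOp_apply, map_zero, map_zero]; rfl
  map_add' a b := LinearMap.ext fun f => Space.ext' fun n k => by
    rw [LinearMap.add_apply, map_add, val_restrictOp, val_restrictOp, val_restrictOp, piOp_apply,
      map_add, map_add]; rfl
  commutes' c := LinearMap.ext fun f => Space.ext' fun n k => by
    rw [val_restrictOp, piOp_apply, AlgEquiv.commutes, AlgHom.commutes]; rfl

/-- The action of `K` on `Γ^eq(V)`. -/
def νΓ : K →* Module.End ℂ (Space V) where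
  toFun l := restrictOp V (nuOp V l) (nuOp_total V l)
  map_one' := LinearMap.ext fun f => Space.ext' fun n k => by
    rw [val_restrictOp, nuOp_apply, mul_one]; rfl
  map_mul' a b := LinearMap.ext fun f => Space.ext' fun n k => by
    rw [Module.End.mul_apply, val_restrictOp, val_restrictOp, val_restrictOp, nuOp_apply,
      nuOp_apply, nuOp_apply, mul_assoc]

/-- The action of `N(𝔨)` on `Γ^eq(V)`. -/
def ωΓ : StdComplex (LieAlg K) →ₐ[ℂ] Module.End ℂ (Space V) where
  toFun m := restrictOp V (omegaOp V m) (omegaOp_total V m)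
  map_one' := LinearMap.ext fun f => Space.ext (by rw [val_restrictOp, map_one]; rfl)
  map_mul' a b := LinearMap.ext fun f => Space.ext (by rw [val_restrictOp, map_mul]; rfl)
  map_zero' := LinearMap.ext fun f => Space.ext (by rw [val_restrictOp, map_zero]; rfl)
  map_add' a b := LinearMap.ext fun f => Space.ext (by rw [val_restrictOp, map_add]; rfl)
  commutes' c := LinearMap.ext fun f => Space.ext (by rw [val_restrictOp, AlgHom.commutes]; rfl)

section Apply

variable {V} (f : Space V) (n : StdComplex (LieAlg K)) (k : K)

theorem val_πΓ (a : A) : val V (πΓ V a f) = piOp V a (val V f) := rfl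
theorem val_νΓ (l : K) : val V (νΓ V l f) = nuOp V l (val V f) := rfl
theorem val_dΓ : val V (dΓ V f) = dOp V (val V f) := rfl
theorem val_ωΓ (m : StdComplex (LieAlg K)) : val V (ωΓ V m f) = omegaOp V m (val V f) := rfl

/-- `π_Γ(a) f = π_R(a) ∘ f`. -/
theorem πΓ_apply (a : A) : val V (πΓ V a f) n k = V.π (P.φ k a) (val V f n k) := rfl

/-- `ν_Γ(l) f = ν_R(l) ∘ f`. -/
theorem νΓ_apply (l : K) : val V (νΓ V l f) n k = val V f n (k * l) := rfl

/-- `d f = d ∘ f - (-1)^(deg f) f ∘ d`. -/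
theorem dΓ_apply {p : ℤ} (hf : f ∈ totalGr V p) :
    val V (dΓ V f) n k = V.d (val V f n k) - sgn p • val V f (d n) k := dOp_apply_of_mem hf n k

/-- `(ω_Γ(m) f)(n)(k) = (-1)^(deg m deg f) f(Ad k(ι m) n)(k)`. -/
theorem ωΓ_apply {p i : ℤ} (hf : f ∈ totalGr V p) {m : StdComplex (LieAlg K)}
    (hm : m ∈ gr (LieAlg K) i) :
    val V (ωΓ V m f) n k = sgn (i * p) • val V f (chi K k (iota m) * n) k :=
  omegaOp_apply hm hf n k

end Apply

theorem dΓ_dΓ (f : Space V) : dΓ V (dΓ V f) = 0 := by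
  refine Space.ext' fun n k => ?_
  rw [val_dΓ, val_dΓ, dOp_apply, dOp_apply, dOp_apply, map_sub, V.d_d, zero_sub, map_sub,
    d_sigmaV, neg_neg, d_sigma, d_d]
  simp only [map_zero, neg_zero, LinearMap.zero_apply, Pi.zero_apply, sub_zero, sub_self]

theorem νΓ_algebraic : IsAlgebraic fun l => (νΓ V l : Space V →ₗ[ℂ] Space V) := by
  obtain ⟨M, hM, hgen⟩ := exists_generators (L := LieAlg K)
  let E : Space V →ₗ[ℂ] (M →ₗ[ℂ] (K → V.carrier)) :=
    { toFun := fun f => val V f ∘ₗ M.subtype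
      map_add' := fun f g => by rw [map_add, LinearMap.add_comp]
      map_smul' := fun c f => by rw [map_smul, LinearMap.smul_comp]; rfl }
  have hE : Function.Injective E := by
    rw [← LinearMap.ker_eq_bot, eq_bot_iff]
    intro f hf
    have hf' : ∀ n ∈ M, val V f n = 0 := fun n hn => LinearMap.congr_fun hf ⟨n, hn⟩
    have h := hgen (LinearMap.ker (val V f)) hf' fun X n hn => by
      rw [LinearMap.mem_ker] at hn ⊢
      funext k
      have h1 := total_lie (val_mem f) X n k
      rw [hn] at h1
      have h2 := h1.unique (HasDerivOne.const X (0 : V.carrier))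
      rw [Pi.zero_apply, map_zero, zero_sub, neg_eq_zero] at h2
      exact h2
    exact Space.ext ((LinearMap.ker_eq_top.1 h).trans (map_zero (val V)).symm)
  refine isAlgebraic_of_injective (map_one (νΓ V))
    (fun k l f => LinearMap.congr_fun (map_mul (νΓ V) k l) f) E hE fun f => ?_
  let b := Module.finBasis ℂ M
  have h1 : ∀ i, HasDerivOne (0 : LieAlg K)
      (fun l => LinearMap.smulRightₗ (b.coord i) (fun x => val V f (b i) (x * l) : K → V.carrier))
      _ := fun i =>
    (((total_regular (val_mem f) (b i : StdComplex (LieAlg K))).orbit.map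
      (LinearMap.smulRightₗ (b.coord i))).hasDerivOne 0).choose_spec
  have h2 := HasDerivOne.sum Finset.univ h1
  refine (h2.mono (fun l => ?_) rfl).isRegular
  refine LinearMap.ext fun n => ?_
  change _ = nuOp V l (val V f) n
  have h3 : (n : StdComplex (LieAlg K)) = ∑ i, b.repr n i • (b i : StdComplex (LieAlg K)) := by
    have h4 := congrArg M.subtype (b.sum_repr n)
    rw [map_sum] at h4
    exact h4.symm
  rw [h3, map_sum, LinearMap.sum_apply]
  refine Finset.sum_congr rfl fun i _ => ?_
  rw [map_smul]
  rfl

theorem deriv_νΓ (ξ : LieAlg K) (f : Space V) :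
    HasDerivOne ξ (fun l => νΓ V l f) (πΓ V (P.ψ ξ) f + ωΓ V (x ξ) f) := by
  obtain ⟨w, hw⟩ := ((νΓ_algebraic V).isRegular f).hasDerivOne ξ
  have h : w = πΓ V (P.ψ ξ) f + ωΓ V (x ξ) f := by
    refine Space.ext' fun n k => ?_
    let ev : Space V →ₗ[ℂ] V.carrier := LinearMap.proj k ∘ₗ LinearMap.applyₗ n ∘ₗ val V
    have h1 : HasDerivOne ξ (fun l => val V f n (k * l)) (val V w n k) := hw.map ev
    have h2 := (total_lie (val_mem f) (Ad k ξ) n k).conj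
    have h3 := omegaOp_x_mul V ξ 1 (val V f)
    rw [mul_one, omegaOp_one] at h3
    rw [h1.unique h2, P.ψ_Ad, map_add, LinearMap.add_apply, Pi.add_apply, πΓ_apply, val_ωΓ,
      h3, evenOp_apply, sub_eq_add_neg]
  exact h ▸ hw

/-- The `(A, K, N(𝔨))`-module `Γ^eq(V) = Hom_(𝔨, T, N(𝔱))(N(𝔨), R(K, V))`. -/
def obj : AKDModule.{u, u} P (hc K) where
  carrier := Space V
  gr := totalGr V
  internal := isInternal_total V
  d := dΓ V
  d_mem hf := dOp_mem hf
  d_d := dΓ_dΓ V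
  π := πΓ V
  π_mem a _ _ hf := piOp_mem a hf
  π_d a f := Space.ext' fun n k => by
    rw [val_dΓ, val_πΓ, val_πΓ, val_dΓ, dOp_apply, piOp_apply, piOp_apply, piOp_apply, dOp_apply,
      V.π_d, map_sub, π_sigmaV]
  ν := νΓ V
  ν_algebraic := νΓ_algebraic V
  ν_mem l _ _ hf := nuOp_mem l hf
  ν_d l f := Space.ext' fun n k => by
    rw [val_dΓ, val_νΓ, val_νΓ, val_dΓ, dOp_apply, nuOp_apply, nuOp_apply, nuOp_apply, dOp_apply]
  ω := ωΓ V
  ω_mem {i j m f} hm hf := by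
    have h : omegaOp V m (val V f) ∈ component V (j + i) := omegaOp_mem hm hf
    rw [add_comm] at h
    exact h
  d_ω {i m} hm f := Space.ext (by
    rw [map_add, map_smul, val_dΓ, val_ωΓ, val_ωΓ, val_ωΓ, val_dΓ, d_omegaOp, sigma_of_mem hm,
      map_smul]
    rfl)
  π_equivariant l a f := Space.ext' fun n k => by
    rw [val_νΓ, val_πΓ, val_πΓ, val_νΓ, piOp_apply, nuOp_apply, piOp_apply, nuOp_apply,
      mul_inv_cancel_right, map_mul]
    rfl
  ω_equivariant l m f := Space.ext (by
    have h : (hc K).χ l m = chi K l m := rfl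
    rw [val_νΓ, val_ωΓ, val_ωΓ, val_νΓ, nuOp_omegaOp, h]
    congr 1
    ext n k
    rw [nuOp_apply, nuOp_apply, mul_inv_cancel_right])
  π_ω a m f := Space.ext (piOp_omegaOp (val V f) a m)
  deriv_ν := deriv_νΓ V

variable {V} {W : AKDModule.{u, u} (P.restrict γ) (hc T)}

/-- `f ↦ (n ↦ k ↦ φ (f n k))`. -/
def mapOp (φ : V.carrier →ₗ[ℂ] W.carrier) : (StdComplex (LieAlg K) →ₗ[ℂ] (K → V.carrier)) →ₗ[ℂ]
    (StdComplex (LieAlg K) →ₗ[ℂ] (K → W.carrier)) where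
  toFun f := LinearMap.pi fun k => φ ∘ₗ LinearMap.proj k ∘ₗ f
  map_add' f g := by ext n k; simp
  map_smul' c f := by ext n k; simp

theorem mapOp_apply (φ : V.carrier →ₗ[ℂ] W.carrier)
    (f : StdComplex (LieAlg K) →ₗ[ℂ] (K → V.carrier)) (n : StdComplex (LieAlg K)) (k : K) :
    mapOp φ f n k = φ (f n k) := rfl

theorem mapOp_mem (φ : V ⟶ W) {p : ℤ} {f : StdComplex (LieAlg K) →ₗ[ℂ] (K → V.carrier)}
    (hf : f ∈ component V p) : mapOp φ.toLin f ∈ component W p where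
  regular n := (hf.regular n).map φ.toLin
  degree hn k := φ.map_mem (hf.degree hn k)
  lie X n k := ((hf.lie X n k).map φ.toLin).mono (fun _ => rfl) (by
    rw [map_sub, φ.map_π]; rfl)
  group t n k := by rw [mapOp_apply, mapOp_apply, hf.group, φ.map_ν]
  std hm n k := by rw [mapOp_apply, mapOp_apply, hf.std hm, map_smul, φ.map_ω]

theorem mapOp_total (φ : V ⟶ W) : ∀ f ∈ total V, mapOp φ.toLin f ∈ total W := fun f hf => by
  have : total V ≤ (total W).comap (mapOp φ.toLin) :=
    iSup_le fun p f hf => component_le W p (mapOp_mem φ hf)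
  exact this hf

theorem map_sigmaV (φ : V ⟶ W) (v : V.carrier) : φ.toLin (sigmaV V v) = sigmaV W (φ.toLin v) :=
  grading_induction V.internal v
    (fun i v hv => by rw [sigmaV_of_mem V hv, map_smul, sigmaV_of_mem W (φ.map_mem hv)])
    (by simp) fun v w hv hw => by simp only [map_add, hv, hw]

theorem mapOp_omegaOp (φ : V ⟶ W) (m : StdComplex (LieAlg K))
    (f : StdComplex (LieAlg K) →ₗ[ℂ] (K → V.carrier)) :
    mapOp φ.toLin (omegaOp V m f) = omegaOp W m (mapOp φ.toLin f) := by
  have he : ∀ X f, mapOp φ.toLin (evenOp V X f) = evenOp W X (mapOp φ.toLin f) := fun X f => by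
    refine LinearMap.ext fun n => funext fun k => ?_
    exact map_neg φ.toLin _
  have ho : ∀ X f, mapOp φ.toLin (oddOp V X f) = oddOp W X (mapOp φ.toLin f) := fun X f => by
    refine LinearMap.ext fun n => funext fun k => ?_
    rw [oddOp_apply, mapOp_apply, mapOp_apply, oddOp_apply, map_sigmaV]
  induction m using StdComplex.induction with
  | one => rw [omegaOp_one, omegaOp_one]
  | add a b ha hb => simp only [map_add, LinearMap.add_apply, ha, hb]
  | smul c a ha => simp only [map_smul, LinearMap.smul_apply, ha]
  | x_mul X a ha => rw [omegaOp_x_mul, he, ha, omegaOp_x_mul]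
  | y_mul ξ a ha => rw [omegaOp_y_mul, ho, ha, omegaOp_y_mul]

/-- `f ↦ φ ∘ f` on the total spaces. -/
def mapSpace (φ : V ⟶ W) : Space V →ₗ[ℂ] Space W where
  toFun f := Space.mk (mapOp φ.toLin (val V f)) (mapOp_total φ _ (val_mem f))
  map_add' f g := Space.ext (by simp only [val_mk, map_add])
  map_smul' c f := Space.ext (by simp only [val_mk, map_smul, RingHom.id_apply])

theorem val_mapSpace (φ : V ⟶ W) (f : Space V) :
    val W (mapSpace φ f) = mapOp φ.toLin (val V f) := rfl

/-- `Γ^eq(φ)(f) = φ ∘ f`. -/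
def homMap (φ : V ⟶ W) : obj V ⟶ obj W where
  toLin := mapSpace φ
  map_mem hf := mapOp_mem φ hf
  map_d := show ∀ f : Space V, mapSpace φ (dΓ V f) = dΓ W (mapSpace φ f) from
    fun f => Space.ext' fun n k => by
      rw [val_mapSpace, val_dΓ, val_dΓ, val_mapSpace, mapOp_apply, dOp_apply, dOp_apply,
        mapOp_apply, mapOp_apply, map_sub, φ.map_d, map_sigmaV]
  map_π := show ∀ a, ∀ f : Space V, mapSpace φ (πΓ V a f) = πΓ W a (mapSpace φ f) from
    fun a f => Space.ext' fun n k => by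
      rw [val_mapSpace, val_πΓ, val_πΓ, val_mapSpace, mapOp_apply, piOp_apply, piOp_apply,
        mapOp_apply, φ.map_π]
  map_ν := show ∀ l, ∀ f : Space V, mapSpace φ (νΓ V l f) = νΓ W l (mapSpace φ f) from
    fun l f => Space.ext' fun n k => rfl
  map_ω := show ∀ m, ∀ f : Space V, mapSpace φ (ωΓ V m f) = ωΓ W m (mapSpace φ f) from
    fun m f => Space.ext (mapOp_omegaOp φ m (val V f))

end Zuckerman

/-- The equivariant Zuckerman functor `Γ^eq_{K,T}` from `(A, T, N(𝔱))`-modules to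
`(A, K, N(𝔨))`-modules. -/
def zuckerman {A : Type w} {K T : Type u} [Ring A] [Algebra ℂ A] [Group K]
    [AffineAlgebraicGroup K] [Group T] [AffineAlgebraicGroup T] (P : HCPair A K)
    (γ : GroupMorphism T K) :
    AKDModule.{u, u} (P.restrict γ) (StdComplex.hc T) ⥤ AKDModule.{u, u} P (StdComplex.hc K) where
  obj V := Zuckerman.obj V
  map φ := Zuckerman.homMap φ

end

end HC

/-! The functor Γ^eq is already right adjoint to the forgetful functor between the categories of
modules, by a form of coinduction, and the whole adjunction descends to homotopy classes.

An element f of Γ^eq(V) is a function of n ∈ N(𝔨) and k ∈ K. Translating f by N(𝔨) and K and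
evaluating at n = 1, k = 1 recovers all of its values, so f is determined by the numbers (vectors of
V) that the counit f ↦ f(1)(1) takes on its translates. Conversely a vector w of an (A, K,
N(𝔨))-module W has its own translates, and the unit sends w to the function whose value at (n, k) is
(-1)^(deg n deg w) ω(ι n) ν(k) w. To treat the signs once and for all, `iotaAction` packages v·n =
(-1)^(deg n deg v) ω(ι n) v as a right action of N(𝔨), and the grading involution `invol` turns
(-1)^(deg v) into a linear operator. What has to be checked for the unit then becomes a list of
properties of this right action: the 𝔨-condition is the identity dν = π∘ψ + ω∘ρ, the T-condition is
`ν_iotaAct`, the N(𝔱)-condition is `iotaAct_rightAction`, and compatibility with differentials is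
the Leibniz rule `d_iotaAct`. One triangle identity is w·1 = w. The other is `counitLin_iotaΓ`, that
is (f·n)(1)(1) = f(n)(1), applied to the translates ν_Γ(k) f. Together these give
`zuckermanAdjunction`.

If h is a homotopy from φ to ψ, then f ↦ h ∘ f is a homotopy from Γ^eq(φ) to Γ^eq(ψ): it lowers
degrees by one, so the two terms h ∘ f ∘ d that appear in hd + dh carry opposite signs and cancel
(`homMap_homotopic`). The forgetful functor keeps h unchanged. Both functors therefore pass to the
quotients, and the unit, the counit and the triangle identities are the images of those for modules.

For exactness, Γ^eq(V[n]) and Γ^eq(V)[n] consist of the same linear maps, and the signs in their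
structures agree (`shiftIso`). A cone C_φ is V[1] ⊕ W as a graded module with all the actions; only
its differential mixes the summands. Hence Γ^eq(C_φ) splits as Γ^eq(V)[1] ⊕ Γ^eq(W), and its
differential is seen to be that of the cone of Γ^eq(φ) (`coneIso`). Standard triangles thus go to
standard triangles up to isomorphism, and so distinguished triangles go to distinguished ones. -/

namespace HC

noncomputable section

/-! ## The action of `N(𝔨)` twisted by the principal antiautomorphism -/

namespace AKDModule

/-! ### The grading involution and its commutation with the actions. -/

section Sigma

variable {A : Type*} {K : Type u} {D : Type*} [Ring A] [Algebra ℂ A] [Group K]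
  [AffineAlgebraicGroup K] [Ring D] [Algebra ℂ D] {P : HCPair A K} {Q : HCDGAlgebra D K}
  (V : AKDModule.{u, v} P Q)

/-- The grading involution `v ↦ (-1)^(deg v) v`. -/
def invol : Module.End ℂ V.carrier := scale V.internal sgn

variable {V}

theorem invol_of_mem {i : ℤ} {v : V.carrier} (hv : v ∈ V.gr i) : V.invol v = sgn i • v :=
  scale_of_mem V.internal sgn hv

theorem invol_invol (v : V.carrier) : V.invol (V.invol v) = v :=
  grading_induction V.internal v
    (fun i v hv => by rw [invol_of_mem hv, map_smul, invol_of_mem hv, sgn_smul_smul])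
    (by simp) fun v w hv hw => by rw [map_add, map_add, hv, hw]

theorem d_invol (v : V.carrier) : V.d (V.invol v) = -V.invol (V.d v) :=
  grading_induction V.internal v
    (fun i v hv => by
      rw [invol_of_mem hv, map_smul, invol_of_mem (V.d_mem hv), sgn_add_one, neg_smul, neg_neg])
    (by simp) fun v w hv hw => by simp only [map_add, hv, hw, neg_add]

theorem π_invol (a : A) (v : V.carrier) : V.π a (V.invol v) = V.invol (V.π a v) :=
  grading_induction V.internal v
    (fun i v hv => by rw [invol_of_mem hv, map_smul, invol_of_mem (V.π_mem a hv)])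
    (by simp) fun v w hv hw => by simp only [map_add, hv, hw]

theorem ν_invol (k : K) (v : V.carrier) : V.ν k (V.invol v) = V.invol (V.ν k v) :=
  grading_induction V.internal v
    (fun i v hv => by rw [invol_of_mem hv, map_smul, invol_of_mem (V.ν_mem k hv)])
    (by simp) fun v w hv hw => by simp only [map_add, hv, hw]

/-- An operator of degree i changes the parity of deg v by i. With (-1)^(deg v) written as the
operator `invol`, the sign rules become identities valid for inhomogeneous v, which lets them be
used in inductions over products of generators. -/
theorem ω_invol {i : ℤ} {x : D} (hx : x ∈ Q.gr i) (v : V.carrier) :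
    V.ω x (V.invol v) = sgn i • V.invol (V.ω x v) :=
  grading_induction V.internal v
    (fun j v hv => by
      rw [invol_of_mem hv, map_smul, invol_of_mem (V.ω_mem hx hv), sgn_add, mul_smul,
        sgn_smul_smul])
    (by simp) fun v w hv hw => by simp only [map_add, smul_add, hv, hw]

theorem ν_inv_ν (k : K) (v : V.carrier) : V.ν k⁻¹ (V.ν k v) = v := by
  rw [← Module.End.mul_apply, ← map_mul, inv_mul_cancel, map_one]; rfl

/-- Equivariance in the form used below: ν(k) moves past an operator at the cost of k acting on its
label. The next lemma does the same for ω. -/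
theorem ν_π (k : K) (a : A) (v : V.carrier) : V.ν k (V.π a v) = V.π (P.φ k a) (V.ν k v) := by
  rw [V.π_equivariant, ν_inv_ν]

theorem ν_ω (k : K) (x : D) (v : V.carrier) : V.ν k (V.ω x v) = V.ω (Q.χ k x) (V.ν k v) := by
  rw [V.ω_equivariant, ν_inv_ν]

theorem Hom.map_invol {V W : AKDModule.{u, v} P Q} (f : V ⟶ W) (v : V.carrier) :
    f.toLin (V.invol v) = W.invol (f.toLin v) :=
  grading_induction V.internal v
    (fun i v hv => by rw [invol_of_mem hv, map_smul, invol_of_mem (f.map_mem hv)])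
    (by simp) fun v w hv hw => by simp only [map_add, hv, hw]

end Sigma

/-! ### The right action of N(𝔨) on an (A, K, N(𝔨))-module. -/

section IotaAction

open StdComplex

variable {A : Type*} {K : Type u} [Ring A] [Algebra ℂ A] [Group K] [AffineAlgebraicGroup K]
  {P : HCPair A K} (W : AKDModule.{u, v} P (hc K))

/-- The sign rules and relations are written out on the generators x X (degree 0) and y ξ (degree
-1), because every identity for the right action is proved by induction over products of these. -/
theorem ω_x_invol (X : LieAlg K) (v : W.carrier) :
    W.ω (x X) (W.invol v) = W.invol (W.ω (x X) v) := by
  rw [ω_invol (show x X ∈ (hc K).gr 0 from x_mem X), sgn_zero, one_smul]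

theorem ω_y_invol (ξ : LieAlg K) (v : W.carrier) :
    W.ω (y ξ) (W.invol v) = -W.invol (W.ω (y ξ) v) := by
  rw [ω_invol (show y ξ ∈ (hc K).gr (-1) from y_mem ξ), sgn_neg, sgn_one, neg_one_smul]

theorem d_ω_x (X : LieAlg K) (v : W.carrier) : W.d (W.ω (x X) v) = W.ω (x X) (W.d v) := by
  rw [W.d_ω (show x X ∈ (hc K).gr 0 from x_mem X), sgn_zero, one_smul,
    show (hc K).d (x X) = 0 from d_x X, map_zero, LinearMap.zero_apply, zero_add]

theorem d_ω_y (ξ : LieAlg K) (v : W.carrier) :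
    W.d (W.ω (y ξ) v) = W.ω (x ξ) v - W.ω (y ξ) (W.d v) := by
  rw [W.d_ω (show y ξ ∈ (hc K).gr (-1) from y_mem ξ), sgn_neg, sgn_one, neg_one_smul,
    show (hc K).d (y ξ) = x ξ from d_y ξ, sub_eq_add_neg]

theorem ω_x_lie (X Y : LieAlg K) (v : W.carrier) :
    W.ω (x ⁅X, Y⁆) v = W.ω (x X) (W.ω (x Y) v) - W.ω (x Y) (W.ω (x X) v) := by
  rw [x_lie, map_sub, map_mul, map_mul]; rfl

theorem ω_y_lie (X Y : LieAlg K) (v : W.carrier) :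
    W.ω (y ⁅X, Y⁆) v = W.ω (x X) (W.ω (y Y) v) - W.ω (y Y) (W.ω (x X) v) := by
  rw [y_lie, map_sub, map_mul, map_mul]; rfl

theorem ω_y_ω_y (X Y : LieAlg K) (v : W.carrier) :
    W.ω (y X) (W.ω (y Y) v) = -W.ω (y Y) (W.ω (y X) v) := by
  have h := congrArg (fun n => W.ω n v) (y_mul_y X Y)
  rw [map_mul, map_neg, map_mul] at h
  exact h

/-- The right action `v · n = (-1)^(deg n deg v) ω(ι n) v` of `N(𝔨)` on an
`(A, K, N(𝔨))`-module. -/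
def iotaAction : StdComplex (LieAlg K) →ₐ[ℂ] (Module.End ℂ W.carrier)ᵐᵒᵖ :=
  -- The target is the opposite algebra because the action is on the right. The minus signs are ι on
  -- the generators, and composing ω(y ξ) with `invol` supplies (-1)^(deg y deg v).
  lift
    ((MulOpposite.opLinearEquiv ℂ).toLinearMap ∘ₗ (-(W.ω.toLinearMap ∘ₗ x)))
    ((MulOpposite.opLinearEquiv ℂ).toLinearMap ∘ₗ
      (-(LinearMap.mulRight ℂ W.invol ∘ₗ W.ω.toLinearMap ∘ₗ y)))
    (fun X Y => MulOpposite.unop_injective <| LinearMap.ext fun v => by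
      simp [ω_x_lie])
    (fun X Y => MulOpposite.unop_injective <| LinearMap.ext fun v => by
      simp [ω_y_lie, ω_x_invol])
    -- Since ω(y) anticommutes with `invol`, which squares to 1, the two copies of `invol` in a
    -- product of two odd generators reduce to the same sign in either order, and the
    -- anticommutation of the ω(y) survives.
    (fun X Y => MulOpposite.unop_injective <| LinearMap.ext fun v => by
      simp [ω_y_invol, invol_invol, ω_y_ω_y W X Y])

/-- `v ↦ (-1)^(deg n deg v) ω(ι n) v`, linearly in `n`. -/
def iotaAct : StdComplex (LieAlg K) →ₗ[ℂ] Module.End ℂ W.carrier :=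
  (MulOpposite.opLinearEquiv ℂ).symm.toLinearMap ∘ₗ W.iotaAction.toLinearMap

variable (X : LieAlg K) (m n : StdComplex (LieAlg K)) (v : W.carrier)

theorem iotaAct_one : W.iotaAct 1 v = v := by
  simp [iotaAct]

theorem iotaAct_mul : W.iotaAct (m * n) v = W.iotaAct n (W.iotaAct m v) := by
  simp [iotaAct]

theorem iotaAct_x : W.iotaAct (x X) v = -W.ω (x X) v := by
  simp [iotaAct, iotaAction]

theorem iotaAct_y : W.iotaAct (y X) v = -W.ω (y X) (W.invol v) := by
  simp [iotaAct, iotaAction]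

theorem iotaAct_x_mul : W.iotaAct (x X * n) v = -W.iotaAct n (W.ω (x X) v) := by
  rw [iotaAct_mul, iotaAct_x, map_neg]

theorem iotaAct_y_mul : W.iotaAct (y X * n) v = -W.iotaAct n (W.ω (y X) (W.invol v)) := by
  rw [iotaAct_mul, iotaAct_y, map_neg]

variable {W m n v}

/-- In a right action the leftmost letter of a product acts first on v, so an induction on n must
let v, and here also its degree j, vary. The inductions that peel off this letter below generalize
the vector for the same reason. -/
theorem iotaAct_mem {i j : ℤ} (hn : n ∈ StdComplex.gr (LieAlg K) i) (hv : v ∈ W.gr j) :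
    W.iotaAct n v ∈ W.gr (i + j) := by
  refine mem_induction (p := fun i n => ∀ j, ∀ v ∈ W.gr j, W.iotaAct n v ∈ W.gr (i + j)) hn
    ?_ ?_ ?_ ?_ ?_ ?_ j v hv
  · intro j v hv
    rwa [iotaAct_one, zero_add]
  · intro i a b ha hb j v hv
    rw [map_add]; exact add_mem (ha j v hv) (hb j v hv)
  · intro i j v _
    rw [map_zero]; exact zero_mem _
  · intro i c a ha j v hv
    rw [map_smul]; exact Submodule.smul_mem _ c (ha j v hv)
  · intro i X a _ ih j v hv
    rw [iotaAct_x_mul]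
    have h := W.ω_mem (show x X ∈ (hc K).gr 0 from x_mem X) hv
    rw [zero_add] at h
    exact neg_mem (ih j _ h)
  · intro i X a _ ih j v hv
    rw [iotaAct_y_mul, invol_of_mem hv, map_smul, map_smul]
    have h := ih _ _ (W.ω_mem (show y X ∈ (hc K).gr (-1) from y_mem X) hv)
    rw [show i + (-1 + j) = i - 1 + j by ring] at h
    exact neg_mem (Submodule.smul_mem _ _ h)

variable (W m n v)

theorem π_iotaAct (a : A) : W.π a (W.iotaAct n v) = W.iotaAct n (W.π a v) := by
  induction n using StdComplex.induction generalizing v with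
  | one => simp only [iotaAct_one]
  | add b c hb hc => simp only [map_add, LinearMap.add_apply, hb, hc]
  | smul c b hb => simp only [map_smul, LinearMap.smul_apply, hb]
  | x_mul X b hb => rw [iotaAct_x_mul, iotaAct_x_mul, map_neg, hb, W.π_ω]
  | y_mul X b hb => rw [iotaAct_y_mul, iotaAct_y_mul, map_neg, hb, W.π_ω, π_invol]

theorem ν_iotaAct (k : K) : W.ν k (W.iotaAct n v) = W.iotaAct (chi K k n) (W.ν k v) := by
  induction n using StdComplex.induction generalizing v with
  | one => simp only [map_one, iotaAct_one]
  | add b c hb hc => simp only [map_add, LinearMap.add_apply, hb, hc]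
  | smul c b hb => simp only [map_smul, LinearMap.smul_apply, hb]
  | x_mul X b hb =>
    rw [iotaAct_x_mul, map_mul, chi_x, iotaAct_x_mul, map_neg, hb, ν_ω]
    exact congrArg (fun z => -W.iotaAct _ (W.ω z _)) (chi_x k X)
  | y_mul X b hb =>
    rw [iotaAct_y_mul, map_mul, chi_y, iotaAct_y_mul, map_neg, hb, ν_ω, ν_invol]
    exact congrArg (fun z => -W.iotaAct _ (W.ω z _)) (chi_y k X)

/-- The degree of v·n is deg v + deg n. The factor (-1)^(deg n) is cancelled by `sigma`, which
leaves the sign of v alone. -/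
theorem invol_iotaAct : W.invol (W.iotaAct (sigma n) v) = W.iotaAct n (W.invol v) := by
  induction n using StdComplex.induction generalizing v with
  | one => simp only [map_one, iotaAct_one]
  | add b c hb hc => simp only [map_add, LinearMap.add_apply, hb, hc]
  | smul c b hb => simp only [map_smul, LinearMap.smul_apply, hb]
  | x_mul X b hb =>
    rw [map_mul, sigma_x, iotaAct_x_mul, iotaAct_x_mul, map_neg, hb, ω_x_invol]
  | y_mul X b hb =>
    rw [map_mul, sigma_y, neg_mul, map_neg, LinearMap.neg_apply, iotaAct_y_mul, iotaAct_y_mul,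
      neg_neg, hb, ω_y_invol W X (W.invol v), map_neg, neg_neg]

/-- This is the Leibniz rule d(v·n) = (dv)·n + (-1)^(deg v) v·(dn) of a right DG module, with the
sign carried by `invol`. It is what makes the unit a chain map. For an odd generator, the term with
x ξ produced by differentiating ω(y ξ) matches the one coming from d(y ξ) = x ξ. -/
theorem d_iotaAct :
    W.d (W.iotaAct n v) = W.iotaAct n (W.d v) + W.iotaAct (StdComplex.d n) (W.invol v) := by
  induction n using StdComplex.induction generalizing v with
  | one => simp only [iotaAct_one, d_one, map_zero, LinearMap.zero_apply, add_zero]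
  | add b c hb hc => simp only [map_add, LinearMap.add_apply, hb, hc]; abel
  | smul c b hb => simp only [map_smul, LinearMap.smul_apply, hb, smul_add]
  | x_mul X b hb =>
    rw [d_x_mul, iotaAct_x_mul, iotaAct_x_mul, iotaAct_x_mul, map_neg, hb, d_ω_x, ω_x_invol,
      neg_add]
  | y_mul X b hb =>
    have h : W.invol (W.ω (y X) (W.invol v)) = -W.ω (y X) v := by
      rw [ω_y_invol, map_neg, invol_invol]
    rw [d_y_mul, map_sub, LinearMap.sub_apply, iotaAct_x_mul, iotaAct_y_mul, iotaAct_y_mul,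
      iotaAct_y_mul, map_neg, hb, d_ω_y, d_invol, h, invol_invol]
    simp only [map_sub, map_neg]
    abel

end IotaAction

end AKDModule

/-! ## The adjunction between modules -/

namespace AKDModule

open StdComplex

/-- Up to the sign (-1)^(deg m deg n), `rightAction m n` is n·ι(m). Acting on v by n and then by
ι(m) on the right is ω(ι ι m) = ω(m) after the action of n, since ι is an involution. Of the signs,
only (-1)^(deg m deg v) remains. This is the N(𝔱)-condition for the unit, read for m coming from 𝔱.
-/
theorem iotaAct_rightAction {A : Type*} {K : Type u} [Ring A] [Algebra ℂ A] [Group K]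
    [AffineAlgebraicGroup K] {P : HCPair A K} (W : AKDModule.{u, v} P (hc K)) {i p : ℤ}
    {m : StdComplex (LieAlg K)} (hm : m ∈ StdComplex.gr (LieAlg K) i)
    (n : StdComplex (LieAlg K)) {v : W.carrier} (hv : v ∈ W.gr p) :
    W.iotaAct (rightAction m n) v = sgn (p * i) • W.ω m (W.iotaAct n v) := by
  refine mem_induction (p := fun i m => W.iotaAct (rightAction m n) v =
    sgn (p * i) • W.ω m (W.iotaAct n v)) hm ?_ ?_ ?_ ?_ ?_ ?_
  · simp
  · intro i a b ha hb
    simp only [map_add, LinearMap.add_apply, ha, hb, smul_add]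
  · simp
  · intro i c a ha
    simp only [map_smul, LinearMap.smul_apply, ha]
    rw [smul_comm]
  · intro i X a _ ih
    rw [rightAction_x_mul, map_neg, LinearMap.neg_apply, iotaAct_mul, iotaAct_x, neg_neg, ih,
      map_smul, map_mul]
    rfl
  -- The odd letter acts through `invol`. Moving that involution inside onto v yields the factor
  -- (-1)^p, which turns the exponent p i into p (i - 1).
  · intro i X a _ ih
    rw [rightAction_y_mul, map_neg, LinearMap.neg_apply, iotaAct_mul, iotaAct_y, neg_neg,
      invol_iotaAct, invol_of_mem hv, map_smul, ih, map_smul, map_smul, map_mul, smul_smul,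
      mul_sub, mul_one, sgn_sub, mul_comm (sgn p)]
    rfl

/-- Morphisms preserve ω and degrees, the only ingredients of the right action. This gives
naturality of the unit. -/
theorem map_iotaAct {A : Type*} {K : Type u} [Ring A] [Algebra ℂ A] [Group K]
    [AffineAlgebraicGroup K] {P : HCPair A K} {V W : AKDModule.{u, v} P (hc K)} (f : V ⟶ W)
    (n : StdComplex (LieAlg K)) (v : V.carrier) :
    f.toLin (V.iotaAct n v) = W.iotaAct n (f.toLin v) := by
  induction n using StdComplex.induction generalizing v with
  | one => rw [iotaAct_one, iotaAct_one]
  | add b c hb hc => simp only [map_add, LinearMap.add_apply, hb, hc]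
  | smul c b hb => simp only [map_smul, LinearMap.smul_apply, hb]
  | x_mul X b hb => rw [iotaAct_x_mul, iotaAct_x_mul, map_neg, hb, f.map_ω]
  | y_mul X b hb => rw [iotaAct_y_mul, iotaAct_y_mul, map_neg, hb, f.map_ω, f.map_invol]

end AKDModule

namespace Zuckerman

open StdComplex AKDModule

variable {A : Type w} {K T : Type u} [Ring A] [Algebra ℂ A] [Group K] [AffineAlgebraicGroup K]
  [Group T] [AffineAlgebraicGroup T] {P : HCPair A K} (γ : GroupMorphism T K)

/-! ### The unit of the adjunction on modules. -/

section Unit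

variable (W : AKDModule.{u, u} P (hc K))

/-- `w ↦ (n ↦ k ↦ (-1)^(deg n deg w) ω(ι n) ν(k) w)`. -/
def unitFun : W.carrier →ₗ[ℂ] (StdComplex (LieAlg K) →ₗ[ℂ] (K → W.carrier)) where
  toFun w := LinearMap.pi fun k => LinearMap.applyₗ (W.ν k w) ∘ₗ W.iotaAct
  map_add' a b := by ext n k; simp
  map_smul' c a := by ext n k; simp

/-- The 𝔨-condition is where dν = π∘ψ + ω∘ρ enters. Differentiating ν(y k) w at y = 1 in the
direction X gives a term with π(ψ X), which commutes with the right action, and a term with ω(x X),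
which the right action of n turns into minus that of (x X) n. The T- and N(𝔱)-conditions are
`ν_iotaAct` and `iotaAct_rightAction`. -/
theorem unitFun_mem {p : ℤ} {w : W.carrier} (hw : w ∈ W.gr p) :
    (unitFun W w : StdComplex (LieAlg K) →ₗ[ℂ] (K → (forgetObj γ W).carrier)) ∈
      component (forgetObj γ W) p where
  regular n := (W.ν_algebraic.isRegular w).map (W.iotaAct n)
  degree hn k := iotaAct_mem hn (W.ν_mem k hw)
  lie X n k := by
    have h : W.iotaAct n (W.π (P.ψ X) (W.ν k w) + W.ω (x X) (W.ν k w)) =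
        W.π (P.ψ X) (W.iotaAct n (W.ν k w)) - W.iotaAct (x X * n) (W.ν k w) := by
      rw [iotaAct_x_mul, map_add, ← π_iotaAct, sub_neg_eq_add]
    have h' : ∀ y, W.iotaAct n (W.ν y (W.ν k w)) = W.iotaAct n (W.ν (y * k) w) := fun y => by
      rw [map_mul]; rfl
    exact ((W.deriv_ν X (W.ν k w)).map (W.iotaAct n)).mono h' h
  group t n k := by
    have h : W.iotaAct (chi K (γ.hom t) n) (W.ν k w) =
        W.ν (γ.hom t) (W.iotaAct n (W.ν ((γ.hom t)⁻¹ * k) w)) := by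
      rw [ν_iotaAct, ← Module.End.mul_apply (W.ν _), ← map_mul, mul_inv_cancel_left]
    exact h
  std hm n k := iotaAct_rightAction W (map_mem γ.differential hm) n (W.ν_mem k hw)

theorem unitFun_total (w : W.carrier) :
    (unitFun W w : StdComplex (LieAlg K) →ₗ[ℂ] (K → (forgetObj γ W).carrier)) ∈
      total (forgetObj γ W) :=
  grading_induction W.internal w
    (fun p _ hw => component_le (forgetObj γ W) p (unitFun_mem γ W hw))
    (by rw [map_zero]; exact zero_mem _)
    fun a b ha hb => by rw [map_add]; exact add_mem ha hb

/-- The unit of the adjunction, as a linear map. -/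
def unitLin : W.carrier →ₗ[ℂ] Space (forgetObj γ W) where
  toFun w := Space.mk (unitFun W w) (unitFun_total γ W w)
  map_add' a b := Space.ext (map_add (unitFun W) a b)
  map_smul' c a := Space.ext (map_smul (unitFun W) c a)

theorem val_unitLin (w : W.carrier) (n : StdComplex (LieAlg K)) (k : K) :
    val (forgetObj γ W) (unitLin γ W w) n k = W.iotaAct n (W.ν k w) := rfl

/-- Moving ν(k) past ω(x X) replaces X by Ad k X, which is exactly the twist by k built into
`evenOp`. The same happens for y X and `oddOp`, where the remaining sign is that of the total
degree. As both sides are actions of the algebra N(𝔨), the two cases suffice for the full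
compatibility `unitLin_ω`. -/
theorem unitLin_x (X : LieAlg K) (w : W.carrier) :
    val (forgetObj γ W) (unitLin γ W (W.ω (x X) w)) =
      evenOp (forgetObj γ W) X (val (forgetObj γ W) (unitLin γ W w)) := by
  refine LinearMap.ext fun n => funext fun k => ?_
  have h : W.iotaAct n (W.ν k (W.ω (x X) w)) = -W.iotaAct (x (Ad k X) * n) (W.ν k w) := by
    rw [iotaAct_x_mul, neg_neg, ν_ω]
    exact congrArg (fun z => W.iotaAct n (W.ω z (W.ν k w))) (chi_x k X)
  exact h

theorem unitLin_y (X : LieAlg K) (w : W.carrier) :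
    val (forgetObj γ W) (unitLin γ W (W.ω (y X) w)) =
      oddOp (forgetObj γ W) X (val (forgetObj γ W) (unitLin γ W w)) := by
  refine LinearMap.ext fun n => funext fun k => ?_
  rw [oddOp_apply]
  have h : W.iotaAct n (W.ν k (W.ω (y X) w)) =
      W.invol (W.iotaAct (y (Ad k X) * sigma n) (W.ν k w)) := by
    rw [iotaAct_y_mul, ν_ω, map_neg, invol_iotaAct, ω_y_invol, map_neg, map_neg, neg_neg,
      invol_invol]
    exact congrArg (fun z => W.iotaAct n (W.ω z (W.ν k w))) (chi_y k X)
  exact h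

theorem unitLin_ω (m : StdComplex (LieAlg K)) (w : W.carrier) :
    unitLin γ W (W.ω m w) = ωΓ (forgetObj γ W) m (unitLin γ W w) := by
  apply Space.ext
  rw [val_ωΓ]
  induction m using StdComplex.induction with
  | one => rw [map_one, omegaOp_one]; rfl
  | add a b ha hb => simp only [map_add, LinearMap.add_apply, ha, hb]
  | smul c a ha => simp only [map_smul, LinearMap.smul_apply, ha]
  | x_mul X a ha => rw [omegaOp_x_mul, ← ha, ← unitLin_x, map_mul]; rfl
  | y_mul X a ha => rw [omegaOp_y_mul, ← ha, ← unitLin_y, map_mul]; rfl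

/-- The unit `W ⟶ Γ^eq(W)` of the adjunction. -/
def unitHom : W ⟶ obj (forgetObj γ W) where
  toLin := unitLin γ W
  map_mem hw := unitFun_mem γ W hw
  map_d := show ∀ w, unitLin γ W (W.d w) = dΓ (forgetObj γ W) (unitLin γ W w) from
    fun w => Space.ext' fun n k => by
      rw [val_dΓ, dOp_apply, val_unitLin, val_unitLin, val_unitLin]
      change _ = W.d _ - W.invol _
      -- The second term of the differential of the Hom complex removes precisely the term with dn
      -- in the Leibniz rule, leaving the right action of n on d(ν(k) w) = ν(k) dw.
      rw [d_iotaAct, W.ν_d, invol_iotaAct, add_sub_cancel_right]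
  map_π := show ∀ a w, unitLin γ W (W.π a w) = πΓ (forgetObj γ W) a (unitLin γ W w) from
    fun a w => Space.ext' fun n k => by
      rw [πΓ_apply, val_unitLin, val_unitLin, ν_π]
      exact (π_iotaAct W n (W.ν k w) (P.φ k a)).symm
  map_ν := show ∀ l w, unitLin γ W (W.ν l w) = νΓ (forgetObj γ W) l (unitLin γ W w) from
    fun l w => Space.ext' fun n k => by
      rw [νΓ_apply, val_unitLin, val_unitLin, map_mul]; rfl
  map_ω := unitLin_ω γ W

end Unit

/-! ### The counit, and the recovery of f from its translates. -/

section Counit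

variable {γ} (V : AKDModule.{u, u} (P.restrict γ) (hc T))

/-- The counit `Γ^eq(V) → V`, `f ↦ f(1)(1)`, as a linear map. -/
def counitLin : Space V →ₗ[ℂ] V.carrier := LinearMap.proj 1 ∘ₗ LinearMap.applyₗ 1 ∘ₗ val V

theorem counitLin_apply (f : Space V) : counitLin V f = val V f 1 1 := rfl

variable {V} in
-- The formulas for the differential and for the action of N(𝔨) with explicit signs hold for
-- homogeneous f only. Additive identities in f are reduced to that case here.
theorem space_induction {p : Space V → Prop} (f : Space V)
    (mem : ∀ i, ∀ f ∈ totalGr V i, p f) (zero : p 0) (add : ∀ f g, p f → p g → p (f + g)) : p f :=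
  grading_induction (isInternal_total V) f mem zero add

/-- The T-condition does not involve the degree p, so it passes from the components to their sums.
-/
theorem total_group (f : Space V) (t : T) (n : StdComplex (LieAlg K)) (k : K) :
    val V f (chi K (γ.hom t) n) k = V.ν t (val V f n ((γ.hom t)⁻¹ * k)) :=
  space_induction f (fun _ _ hf => hf.group t n k) (by simp)
    fun f g hf hg => by simp only [map_add, LinearMap.add_apply, Pi.add_apply, hf, hg]

/-- The counit `Γ^eq(V) ⟶ V` of the adjunction. -/
def counitHom : forgetObj γ (obj V) ⟶ V where
  toLin := counitLin V
  map_mem {i f} hf := by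
    have h := (show IsEqHom V i (val V f) from hf).degree StdComplex.one_mem 1
    rwa [zero_add] at h
  -- The term f(d 1) vanishes because d 1 = 0.
  map_d := show ∀ f, counitLin V (dΓ V f) = V.d (counitLin V f) from fun f => by
    rw [counitLin_apply, val_dΓ, dOp_apply, d_one, map_zero, map_zero, Pi.zero_apply, map_zero,
      sub_zero]
    rfl
  map_π := show ∀ a f, counitLin V (πΓ V a f) = V.π a (counitLin V f) from fun a f => by
    rw [counitLin_apply, πΓ_apply, map_one]; rfl
  map_ν := show ∀ t f, counitLin V (νΓ V (γ.hom t) f) = V.ν t (counitLin V f) from fun t f => by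
    -- At n = 1 and k = γ(t) the T-condition reads f(1)(γ(t)) = ν(t) f(1)(1). Thus right translation
    -- by γ(t), seen at k = 1, is the action of t on V.
    have h := total_group V f t 1 (γ.hom t)
    rw [map_one, inv_mul_cancel] at h
    rw [counitLin_apply, νΓ_apply, one_mul, h]; rfl
  map_ω := show ∀ m f, counitLin V (ωΓ V (map γ.differential m) f) = V.ω m (counitLin V f) from
    fun m f => by
    refine grading_induction (p := fun m => ∀ f, counitLin V (ωΓ V (map γ.differential m) f) =
      V.ω m (counitLin V f)) StdComplex.isInternal m (fun i m hm f => ?_) (fun f => by simp)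
      (fun a b ha hb f => by simp only [map_add, LinearMap.add_apply, ha, hb]) f
    refine space_induction (p := fun f => counitLin V (ωΓ V (map γ.differential m) f) =
      V.ω m (counitLin V f)) f (fun p f hf => ?_) (by simp)
      fun f g hf hg => by simp only [map_add, hf, hg]
    -- At n = 1 the twisted right multiplication by m gives ι(m), so the N(𝔱)-condition computes f(ι
    -- m)(1). Its sign is the one in the formula for ω_Γ(m) f, and the two cancel.
    have h := hf.std hm 1 1
    rw [counitLin_apply, ωΓ_apply f 1 1 hf (map_mem γ.differential hm), map_one, mul_one]
    change _ • val V f (rightAction (map γ.differential m) 1) 1 = _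
    rw [h, smul_smul, mul_comm p, sgn_mul_self, one_smul]
    rfl

/-- The grading involution of `Γ^eq(V)`. -/
def involΓ : Module.End ℂ (Space V) := (obj V).invol

/-- The right action of `N(𝔨)` on `Γ^eq(V)`. -/
def iotaΓ : StdComplex (LieAlg K) →ₗ[ℂ] Module.End ℂ (Space V) := (obj V).iotaAct

/-- The involution entering the right action is defined from the grading of Γ^eq(V), while `oddOp`
uses the pointwise operator `signOp`; both multiply by (-1)^p in degree p. -/
theorem val_involΓ (f : Space V) : val V (involΓ V f) = signOp V (val V f) := by
  refine space_induction (p := fun f => val V (involΓ V f) = signOp V (val V f)) f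
    (fun p f hf => ?_) (by simp only [map_zero])
    fun f g hf hg => by simp only [map_add, hf, hg]
  have h : involΓ V f = sgn p • f := invol_of_mem (V := obj V) hf
  rw [signOp_of_mem V hf, h, map_smul]

theorem iotaΓ_one (f : Space V) : iotaΓ V 1 f = f := iotaAct_one (obj V) f

theorem iotaΓ_x_mul (X : LieAlg K) (n : StdComplex (LieAlg K)) (f : Space V) :
    iotaΓ V (x X * n) f = -iotaΓ V n (ωΓ V (x X) f) := iotaAct_x_mul (obj V) X n f

theorem iotaΓ_y_mul (X : LieAlg K) (n : StdComplex (LieAlg K)) (f : Space V) :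
    iotaΓ V (y X * n) f = -iotaΓ V n (ωΓ V (y X) (involΓ V f)) := iotaAct_y_mul (obj V) X n f

/-- The right action on Γ^eq(V) is ω_Γ(ι n) up to sign, and ω_Γ(m) already substitutes ι(m) on the
left of the argument of f. The two antiautomorphisms and the two signs cancel, so that acting by n
and evaluating at 1 gives the value at n. Evaluation at k = 1 removes the twist by Ad k. This is the
core of the second triangle identity. -/
theorem counitLin_iotaΓ (n : StdComplex (LieAlg K)) (f : Space V) :
    counitLin V (iotaΓ V n f) = val V f n 1 := by
  induction n using StdComplex.induction generalizing f with
  | one => rw [iotaΓ_one]; rfl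
  | add a b ha hb => simp only [map_add, LinearMap.add_apply, Pi.add_apply, ha, hb]
  | smul c a ha => simp only [map_smul, LinearMap.smul_apply, Pi.smul_apply, ha]
  | x_mul X a ha =>
    have h := evenOp_apply (val V f) a 1 X
    rw [Ad_one, LieHom.id_apply] at h
    have h' := omegaOp_x_mul V X 1 (val V f)
    rw [mul_one, omegaOp_one] at h'
    rw [iotaΓ_x_mul, map_neg, ha, val_ωΓ, h', h, neg_neg]
  | y_mul X a ha =>
    -- An odd letter acts on f through the grading involution, so `oddOp` is evaluated on `signOp V
    -- (val V f)`. The sign built into `oddOp` then cancels against it, leaving -f((y X) a)(1).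
    have h := oddOp_apply (signOp V (val V f)) a 1 X
    rw [Ad_one, LieHom.id_apply, signOp_apply, sigmaV_sigmaV, map_mul, sigma_y, sigma_sigma,
      neg_mul, map_neg, Pi.neg_apply] at h
    have h' := omegaOp_y_mul V X 1 (signOp V (val V f))
    rw [mul_one, omegaOp_one] at h'
    rw [iotaΓ_y_mul, map_neg, ha, val_ωΓ, val_involΓ, h', h, neg_neg]

end Counit

/-! ### Naturality of the unit and the triangle identities. -/

section Triangles

theorem unitLin_naturality {W W' : AKDModule.{u, u} P (hc K)} (f : W ⟶ W') (w : W.carrier) :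
    unitLin γ W' (f.toLin w) = mapSpace ((forget P γ).map f) (unitLin γ W w) :=
  Space.ext' fun n k => by
    have h : W'.iotaAct n (W'.ν k (f.toLin w)) = f.toLin (W.iotaAct n (W.ν k w)) := by
      rw [map_iotaAct, f.map_ν]
    exact h

/-- Evaluating at n = 1 and k = 1 leaves the right action of 1 and ν(1), both the identity. -/
theorem counitLin_unitLin (W : AKDModule.{u, u} P (hc K)) (w : W.carrier) :
    counitLin (forgetObj γ W) (unitLin γ W w) = w := by
  have h : W.iotaAct 1 (W.ν 1 w) = w := by
    rw [iotaAct_one, map_one]; rfl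
  exact h

variable {γ} in
-- At (n, k) the left side is the counit of (ν_Γ(k) f)·n, hence (ν_Γ(k) f)(n)(1) by
-- `counitLin_iotaΓ`. This is f(n)(k), since ν_Γ is right translation.
theorem mapSpace_unitLin (V : AKDModule.{u, u} (P.restrict γ) (hc T)) (f : Space V) :
    mapSpace (counitHom V) (unitLin γ (obj V) f) = f :=
  Space.ext' fun n k => by
    have h : counitLin V (iotaΓ V n (νΓ V k f)) = val V f n k := by
      rw [counitLin_iotaΓ, νΓ_apply, one_mul]
    exact h

end Triangles

end Zuckerman

/-- The equivariant Zuckerman functor is right adjoint to the forgetful functor between the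
categories of modules. -/
def zuckermanAdjunction {A : Type w} {K T : Type u} [Ring A] [Algebra ℂ A] [Group K]
    [AffineAlgebraicGroup K] [Group T] [AffineAlgebraicGroup T] (P : HCPair A K)
    (γ : GroupMorphism T K) : forget P γ ⊣ zuckerman P γ :=
  Adjunction.mkOfUnitCounit
    { unit :=
        { app := Zuckerman.unitHom γ
          naturality := fun _ _ f => AKDModule.hom_ext fun w => Zuckerman.unitLin_naturality γ f w }
      counit :=
        { app := Zuckerman.counitHom
          naturality := fun _ _ _ => AKDModule.hom_ext fun _ => rfl }
      left_triangle := NatTrans.ext <| funext fun W => AKDModule.hom_ext fun w =>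
        Zuckerman.counitLin_unitLin γ W w
      right_triangle := NatTrans.ext <| funext fun V => AKDModule.hom_ext fun f =>
        Zuckerman.mapSpace_unitLin V f }

/-! ## Homotopies -/

namespace Zuckerman

open StdComplex AKDModule

variable {A : Type w} {K T : Type u} [Ring A] [Algebra ℂ A] [Group K] [AffineAlgebraicGroup K]
  [Group T] [AffineAlgebraicGroup T] {P : HCPair A K} {γ : GroupMorphism T K}
  {V W : AKDModule.{u, u} (P.restrict γ) (hc T)}

/-- Since h commutes with π and ν, it preserves the conditions for 𝔨 and T. Past ω(m) it picks up
(-1)^(deg m), which is the change from (-1)^(p deg m) to (-1)^((p - 1) deg m) required in degree p -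
1. -/
theorem mapOp_homotopy_mem {h : V.carrier →ₗ[ℂ] W.carrier}
    (h_mem : ∀ {i : ℤ} {v : V.carrier}, v ∈ V.gr i → h v ∈ W.gr (i - 1))
    (h_π : ∀ a v, h (V.π a v) = W.π a (h v))
    (h_ν : ∀ k v, h (V.ν k v) = W.ν k (h v))
    (h_ω : ∀ {i : ℤ} {x : StdComplex (LieAlg T)}, x ∈ (hc T).gr i → ∀ v,
      h (V.ω x v) = sgn i • W.ω x (h v))
    {p : ℤ} {f : StdComplex (LieAlg K) →ₗ[ℂ] (K → V.carrier)}
    (hf : f ∈ component V p) : mapOp h f ∈ component W (p - 1) where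
  regular n := (hf.regular n).map h
  degree hn k := by rw [← add_sub_assoc]; exact h_mem (hf.degree hn k)
  lie X n k := ((hf.lie X n k).map h).mono (fun _ => rfl) (by rw [map_sub, h_π]; rfl)
  group t n k := by rw [mapOp_apply, mapOp_apply, hf.group, h_ν]
  std hm n k := by
    rw [mapOp_apply, mapOp_apply, hf.std hm, map_smul, h_ω hm, smul_smul, sub_mul, one_mul, sgn_sub]

/-- Composition with h is the homotopy. It has degree -1 on the Hom complex, and this drop in degree
accounts for every sign. -/
theorem homMap_homotopic {φ ψ : V ⟶ W} (H : Homotopic φ ψ) :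
    Homotopic (homMap φ) (homMap ψ) := by
  obtain ⟨h, h1, h2, h3, h4, h5⟩ := H
  have hmem : ∀ p, ∀ f ∈ component V p, mapOp h f ∈ component W (p - 1) := fun p f hf =>
    mapOp_homotopy_mem h1 h2 h3 h4 hf
  have htotal : total V ≤ (total W).comap (mapOp h) :=
    iSup_le fun p f hf => component_le W (p - 1) (hmem p f hf)
  let Hs : Space V →ₗ[ℂ] Space W :=
    { toFun := fun f => Space.mk (mapOp h (val V f)) (htotal (val_mem f))
      map_add' := fun f g => Space.ext (by simp only [val_mk, map_add])
      map_smul' := fun c f => Space.ext (by simp only [val_mk, map_smul, RingHom.id_apply]) }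
  have hHs : ∀ f n k, val W (Hs f) n k = h (val V f n k) := fun f n k => rfl
  have mem : ∀ {p : ℤ} {f : Space V}, f ∈ totalGr V p → Hs f ∈ totalGr W (p - 1) :=
    fun {p f} hf => hmem p _ hf
  refine ⟨Hs, mem, ?_, fun _ _ => rfl, ?_, ?_⟩
  · change ∀ a, ∀ f : Space V, Hs (πΓ V a f) = πΓ W a (Hs f)
    exact fun a f => Space.ext' fun n k => by
      rw [hHs, πΓ_apply, πΓ_apply, hHs, h2]
  · change ∀ {i : ℤ} {m : StdComplex (LieAlg K)}, m ∈ gr (LieAlg K) i → ∀ f : Space V,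
      Hs (ωΓ V m f) = sgn i • ωΓ W m (Hs f)
    intro i m hm f
    refine space_induction (p := fun f => Hs (ωΓ V m f) = sgn i • ωΓ W m (Hs f)) f
      (fun p f hf => Space.ext' fun n k => ?_) (by simp only [map_zero, smul_zero])
      fun f g hf hg => by simp only [map_add, smul_add, hf, hg]
    -- The action of m carries (-1)^(i p) on f but (-1)^(i (p - 1)) on h ∘ f. The quotient (-1)^i is
    -- the sign demanded of a homotopy.
    rw [hHs, ωΓ_apply f n k hf hm, map_smul, map_smul, LinearMap.smul_apply, Pi.smul_apply,
      ωΓ_apply (Hs f) n k (mem hf) hm, hHs, smul_smul, mul_sub, mul_one, sgn_sub, mul_left_comm,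
      sgn_mul_self, mul_one]
  · change ∀ f : Space V, mapSpace φ f - mapSpace ψ f = Hs (dΓ V f) + dΓ W (Hs f)
    intro f
    refine space_induction (p := fun f => mapSpace φ f - mapSpace ψ f = Hs (dΓ V f) + dΓ W (Hs f))
      f (fun p f hf => Space.ext' fun n k => ?_) (by simp only [map_zero, sub_zero, add_zero])
      fun f g hf hg => by simp only [map_add, add_sub_add_comm, hf, hg]; abel
    -- The relation between φ, ψ and h is used pointwise at f(n)(k). The terms h(f(dn)(k)) arise
    -- once with -(-1)^p, from df, and once with -(-1)^(p - 1), from the differential of h ∘ f, and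
    -- cancel.
    have e := h5 (val V f n k)
    simp only [map_add, map_sub, LinearMap.add_apply, LinearMap.sub_apply, Pi.add_apply,
      Pi.sub_apply]
    rw [hHs, dΓ_apply f n k hf, dΓ_apply (Hs f) n k (mem hf), hHs, hHs, val_mapSpace, val_mapSpace,
      mapOp_apply, mapOp_apply, e, map_sub, map_smul, sgn_sub_one, neg_smul]
    abel

end Zuckerman

/-! ### The induced functor and the adjunction between homotopy categories. -/

open AKDModule in
/-- The functor between homotopy categories induced by the equivariant Zuckerman functor. -/
def zuckermanHo {A : Type w} {K T : Type u} [Ring A] [Algebra ℂ A] [Group K]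
    [AffineAlgebraicGroup K] [Group T] [AffineAlgebraicGroup T] (P : HCPair A K)
    (γ : GroupMorphism T K) :
    HoCat.{u, u} (P.restrict γ) (StdComplex.hc T) ⥤ HoCat.{u, u} P (StdComplex.hc K) :=
  CategoryTheory.Quotient.lift Homotopic (zuckerman P γ ⋙ toHo _ _) fun _ _ _ _ H =>
    CategoryTheory.Quotient.sound Homotopic (Zuckerman.homMap_homotopic H)

/-- The adjunction between the homotopy categories. -/
def zuckermanHoAdjunction {A : Type w} {K T : Type u} [Ring A] [Algebra ℂ A] [Group K]
    [AffineAlgebraicGroup K] [Group T] [AffineAlgebraicGroup T] (P : HCPair A K)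
    (γ : GroupMorphism T K) : forgetHo P γ ⊣ zuckermanHo P γ :=
  Adjunction.mkOfUnitCounit
    -- Both homotopy categories have the modules as objects and their morphisms are classes, so a
    -- transformation natural on representatives is natural on the quotient.
    { unit := Quotient.natTransLift _
        (Functor.whiskerRight (zuckermanAdjunction P γ).unit (AKDModule.toHo _ _))
      counit := Quotient.natTransLift _
        (Functor.whiskerRight (zuckermanAdjunction P γ).counit (AKDModule.toHo _ _))
      left_triangle := by
        refine NatTrans.ext (funext fun ⟨W⟩ => ?_)
        -- The triangle identity at the class of a module is the image under `toHo` of the identity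
        -- for that module.
        have h := congrArg (AKDModule.toHo _ _).map
          ((zuckermanAdjunction P γ).left_triangle_components W)
        rw [Functor.map_comp] at h
        simpa using! h
      right_triangle := by
        refine NatTrans.ext (funext fun ⟨V⟩ => ?_)
        have h := congrArg (AKDModule.toHo _ _).map
          ((zuckermanAdjunction P γ).right_triangle_components V)
        rw [Functor.map_comp] at h
        simpa using! h }

/-! ## Translations and cones -/

namespace Zuckerman

open StdComplex AKDModule

variable {A : Type w} {K T : Type u} [Ring A] [Algebra ℂ A] [Group K] [AffineAlgebraicGroup K]
  [Group T] [AffineAlgebraicGroup T] {P : HCPair A K} {γ : GroupMorphism T K}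

/-! ### Γ^eq commutes with translation. -/

section Shift

variable (n : ℤ) (V : AKDModule.{u, u} (P.restrict γ) (hc T))

theorem shift_ω {i : ℤ} {m : StdComplex (LieAlg T)} (hm : m ∈ gr (LieAlg T) i)
    (v : V.carrier) : (V.shift n).ω m v = sgn (n * i) • V.ω m v := by
  change V.ω ((hc T).twist n m) v = _
  rw [(hc T).twist_of_mem n hm, map_smul]; rfl

/-- The translation changes neither π nor ν. The sign (-1)^(n i) that it puts into ω combines with
(-1)^(p i) to (-1)^((p + n) i), so the N(𝔱)-condition in degree p for V[n] is the one in degree p +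
n for V. -/
theorem mem_component_shift {p : ℤ} {f : StdComplex (LieAlg K) →ₗ[ℂ] (K → V.carrier)} :
    f ∈ component (V.shift n) p ↔ f ∈ component V (p + n) := by
  have hstd : ∀ {i : ℤ} {m : StdComplex (LieAlg T)}, m ∈ gr (LieAlg T) i → ∀ v : V.carrier,
      sgn (p * i) • (V.shift n).ω m v = sgn ((p + n) * i) • V.ω m v := fun {i m} hm v => by
    refine (congrArg (sgn (p * i) • ·) (shift_ω n V hm v)).trans ?_
    change sgn (p * i) • sgn (n * i) • V.ω m v = _
    rw [smul_smul, ← sgn_add, ← add_mul]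
  constructor
  · intro hf
    exact
    { regular := hf.regular
      degree := fun hn k => by rw [← add_assoc]; exact hf.degree hn k
      lie := hf.lie
      group := hf.group
      std := fun hm n' k => (hf.std hm n' k).trans (hstd hm _) }
  · intro hf
    exact
    { regular := hf.regular
      degree := fun {j n'} hn k => by
        have h := hf.degree hn k
        rw [← add_assoc] at h
        exact h
      lie := hf.lie
      group := hf.group
      std := fun hm n' k => (hf.std hm n' k).trans (hstd hm _).symm }

theorem mem_total_shift {f : StdComplex (LieAlg K) →ₗ[ℂ] (K → V.carrier)} :
    f ∈ total (V.shift n) ↔ f ∈ total V := by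
  constructor
  · intro hf
    exact Submodule.iSup_induction (component (V.shift n)) (motive := fun f => f ∈ total V) hf
      (fun p f hf => component_le V (p + n) ((mem_component_shift n V).1 hf)) (zero_mem _)
      fun f g hf hg => add_mem hf hg
  · intro hf
    exact Submodule.iSup_induction (component V) (motive := fun f => f ∈ total (V.shift n)) hf
      (fun p f hf => component_le (V.shift n) (p - n)
        ((mem_component_shift n V).2 (by rwa [sub_add_cancel]))) (zero_mem _)
      fun f g hf hg => add_mem hf hg

/-- The identity on underlying spaces, from `Γ^eq(V[n])` to `Γ^eq(V)`. -/
def shiftLin : Space (V.shift n) →ₗ[ℂ] Space V where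
  toFun f := Space.mk (val (V.shift n) f) ((mem_total_shift n V).1 (val_mem f))
  map_add' f g := Space.ext (map_add (val (V.shift n)) f g)
  map_smul' c f := Space.ext (map_smul (val (V.shift n)) c f)

theorem val_shiftLin (f : Space (V.shift n)) :
    val V (shiftLin n V f) = val (V.shift n) f := val_mk _ _

theorem shiftLin_bijective : Function.Bijective (shiftLin n V) := by
  constructor
  · intro f g h
    have h' := congrArg (val V) h
    rw [val_shiftLin, val_shiftLin] at h'
    exact Space.ext h'
  · intro f
    refine ⟨Space.mk (V := V.shift n) (val V f) ((mem_total_shift n V).2 (val_mem f)),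
      Space.ext ?_⟩
    rw [val_shiftLin]
    exact val_mk _ _

/-- `Γ^eq(V[n])` and `Γ^eq(V)[n]` have the same underlying space. -/
def shiftEquiv : Space (V.shift n) ≃ₗ[ℂ] Space V :=
  LinearEquiv.ofBijective (shiftLin n V) (shiftLin_bijective n V)

theorem val_shiftEquiv (f : Space (V.shift n)) :
    val V (shiftEquiv n V f) = val (V.shift n) f := val_shiftLin n V f

theorem shiftEquiv_mem {p : ℤ} {f : Space (V.shift n)} :
    f ∈ totalGr (V.shift n) p ↔ shiftEquiv n V f ∈ totalGr V (p + n) := by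
  rw [mem_totalGr, mem_totalGr, val_shiftEquiv]
  exact mem_component_shift n V (f := val (V.shift n) f)

/-- For f of degree p over V[n] the differential is (-1)^n d ∘ f - (-1)^p f ∘ d. Pulling out (-1)^n
leaves d ∘ f - (-1)^(p + n) f ∘ d, the differential of f in degree p + n over V. -/
theorem shiftEquiv_d (f : Space (V.shift n)) :
    shiftEquiv n V (dΓ (V.shift n) f) = sgn n • dΓ V (shiftEquiv n V f) := by
  refine space_induction (p := fun f => shiftEquiv n V (dΓ (V.shift n) f) =
    sgn n • dΓ V (shiftEquiv n V f)) f (fun p f hf => Space.ext' fun m k => ?_)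
    (by simp only [map_zero, smul_zero]) fun f g hf hg => by simp only [map_add, smul_add, hf, hg]
  refine (dΓ_apply f m k hf).trans ?_
  rw [map_smul, LinearMap.smul_apply, Pi.smul_apply,
    dΓ_apply _ m k ((shiftEquiv_mem n V).1 hf), smul_sub, smul_smul, sgn_add, mul_left_comm,
    sgn_mul_self, mul_one]
  rfl

/-- The translate Γ^eq(V)[n] has the twist (-1)^(n i) in its action, and f has degree p + n there.
The exponent n i + i (p + n) has the parity of i p, which is the exponent over V[n]. -/
theorem shiftEquiv_ω (m : StdComplex (LieAlg K)) (f : Space (V.shift n)) :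
    shiftEquiv n V (ωΓ (V.shift n) m f) = ωΓ V ((hc K).twist n m) (shiftEquiv n V f) := by
  refine grading_induction (p := fun m => ∀ f, shiftEquiv n V (ωΓ (V.shift n) m f) =
    ωΓ V ((hc K).twist n m) (shiftEquiv n V f)) StdComplex.isInternal m (fun i m hm f => ?_)
    (fun f => by simp only [map_zero, LinearMap.zero_apply])
    (fun a b ha hb f => by simp only [map_add, LinearMap.add_apply, ha, hb]) f
  refine space_induction (p := fun f => shiftEquiv n V (ωΓ (V.shift n) m f) =
    ωΓ V ((hc K).twist n m) (shiftEquiv n V f)) f (fun p f hf => Space.ext' fun m' k => ?_)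
    (by simp only [map_zero]) fun f g hf hg => by simp only [map_add, hf, hg]
  refine (ωΓ_apply f m' k hf hm).trans ?_
  rw [(hc K).twist_of_mem n hm, map_smul, LinearMap.smul_apply, map_smul, LinearMap.smul_apply,
    Pi.smul_apply, ωΓ_apply _ m' k ((shiftEquiv_mem n V).1 hf) hm, smul_smul, ← sgn_add,
    show n * i + i * (p + n) = i * p + (i * n + i * n) by ring, sgn_add, sgn_add (i * n),
    sgn_mul_self, mul_one]
  rfl

theorem shiftEquiv_π (a : A) (f : Space (V.shift n)) :
    shiftEquiv n V (πΓ (V.shift n) a f) = πΓ V a (shiftEquiv n V f) :=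
  Space.ext' fun m k => by
    rw [val_shiftEquiv, πΓ_apply (V := V), val_shiftEquiv]
    exact πΓ_apply f m k a

theorem shiftEquiv_ν (l : K) (f : Space (V.shift n)) :
    shiftEquiv n V (νΓ (V.shift n) l f) = νΓ V l (shiftEquiv n V f) :=
  Space.ext' fun m k => by
    rw [val_shiftEquiv, νΓ_apply, val_shiftEquiv]
    exact νΓ_apply f m k l

/-- `Γ^eq(V[n]) ≅ Γ^eq(V)[n]`. -/
def shiftIso : obj (V.shift n) ≅ (obj V).shift n :=
  isoOfLinearEquiv (V := obj (V.shift n)) (W := (obj V).shift n) (shiftEquiv n V)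
    (fun _ _ => shiftEquiv_mem n V) (shiftEquiv_d n V) (shiftEquiv_π n V) (shiftEquiv_ν n V)
    (shiftEquiv_ω n V)

end Shift

end Zuckerman

/-! ### Naturality and coherence of the translation isomorphisms. -/

namespace Zuckerman

open StdComplex AKDModule

variable {A : Type w} {K T : Type u} [Ring A] [Algebra ℂ A] [Group K] [AffineAlgebraicGroup K]
  [Group T] [AffineAlgebraicGroup T] (P : HCPair A K) (γ : GroupMorphism T K)

variable {P γ} in
theorem shiftEquiv_mapSpace {V W : AKDModule.{u, u} (P.restrict γ) (hc T)} (n : ℤ) (f : V ⟶ W)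
    (v : Space (V.shift n)) :
    shiftEquiv n W (mapSpace (V := V.shift n) (W := W.shift n) ((shiftFun n).map f) v) =
      mapSpace f (shiftEquiv n V v) :=
  Space.ext' fun m k => by
    rw [val_shiftEquiv, val_mapSpace, mapOp_apply, val_shiftEquiv]
    rfl

/-- The compatibility of `Γ^eq` with the translation by `n`. -/
def shiftNatIso (n : ℤ) : shiftFunctor (AKDModule.{u, u} (P.restrict γ) (hc T)) n ⋙ zuckerman P γ ≅
    zuckerman P γ ⋙ shiftFunctor (AKDModule.{u, u} P (hc K)) n :=
  NatIso.ofComponents (fun V => shiftIso n V) fun f => hom_ext fun v => shiftEquiv_mapSpace n f v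

variable {P γ} in
-- All structural isomorphisms of the translations are the identity on underlying vectors, so both
-- sides have the same values at every n and k. Additivity holds for the same reason.
theorem shiftEquiv_zero (V : AKDModule.{u, u} (P.restrict γ) (hc T)) (f : Space (V.shift 0)) :
    shiftEquiv 0 V f = mapSpace (V := V.shift 0) (shiftZero.hom.app V) f :=
  Space.ext' fun m k => by
    rw [val_shiftEquiv]
    rfl

variable {P γ} in
theorem shiftEquiv_add (V : AKDModule.{u, u} (P.restrict γ) (hc T)) (a b : ℤ)
    (f : Space (V.shift (a + b))) :
    shiftEquiv (a + b) V f = shiftEquiv a V (shiftEquiv b (V.shift a)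
      (mapSpace (V := V.shift (a + b)) (W := (V.shift a).shift b) ((shiftAdd a b).hom.app V) f)) :=
  Space.ext' fun m k => by
    rw [val_shiftEquiv, val_shiftEquiv, val_shiftEquiv]
    rfl

instance commShift_zuckerman : (zuckerman P γ).CommShift ℤ where
  commShiftIso := shiftNatIso P γ
  commShiftIso_zero := Iso.ext <| NatTrans.ext <| funext fun V => hom_ext fun f => by
    rw [Functor.CommShift.isoZero_hom_app]
    exact shiftEquiv_zero V f
  commShiftIso_add a b := Iso.ext <| NatTrans.ext <| funext fun V => hom_ext fun f => by
    rw [Functor.CommShift.isoAdd_hom_app]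
    exact shiftEquiv_add V a b f

end Zuckerman

/-! ### Γ^eq commutes with cones. -/

namespace Zuckerman

open StdComplex AKDModule

variable {A : Type w} {K T : Type u} [Ring A] [Algebra ℂ A] [Group K] [AffineAlgebraicGroup K]
  [Group T] [AffineAlgebraicGroup T] {P : HCPair A K} {γ : GroupMorphism T K}

/-- The conditions defining a component never mention the differential. This matters for cones: the
projection onto W and the inclusion of V[1] respect degrees and actions but need not be chain maps.
-/
theorem mapOp_mem_of_graded {V W : AKDModule.{u, u} (P.restrict γ) (hc T)}
    {l : V.carrier →ₗ[ℂ] W.carrier}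
    (l_mem : ∀ {i : ℤ} {v : V.carrier}, v ∈ V.gr i → l v ∈ W.gr i)
    (l_π : ∀ a v, l (V.π a v) = W.π a (l v)) (l_ν : ∀ k v, l (V.ν k v) = W.ν k (l v))
    (l_ω : ∀ x v, l (V.ω x v) = W.ω x (l v)) {p : ℤ}
    {f : StdComplex (LieAlg K) →ₗ[ℂ] (K → V.carrier)} (hf : f ∈ component V p) :
    mapOp l f ∈ component W p where
  regular n := (hf.regular n).map l
  degree hn k := l_mem (hf.degree hn k)
  lie X n k := ((hf.lie X n k).map l).mono (fun _ => rfl) (by rw [map_sub, l_π]; rfl)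
  group t n k := by rw [mapOp_apply, mapOp_apply, hf.group, l_ν]
  std hm n k := by rw [mapOp_apply, mapOp_apply, hf.std hm, map_smul, l_ω]

section Cone

variable {V W : AKDModule.{u, u} (P.restrict γ) (hc T)} (φ : V ⟶ W)

/-- The projection `C_φ → W`. -/
def coneSnd : (cone φ).carrier →ₗ[ℂ] W.carrier := LinearMap.snd ℂ V.carrier W.carrier

/-- The inclusion `V[1] → C_φ`. -/
def coneInr : (V.shift 1).carrier →ₗ[ℂ] (cone φ).carrier := LinearMap.inl ℂ V.carrier W.carrier

theorem mapOp_coneSnd_mem {p : ℤ} {f : StdComplex (LieAlg K) →ₗ[ℂ] (K → (cone φ).carrier)}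
    (hf : f ∈ component (cone φ) p) : mapOp (coneSnd φ) f ∈ component W p :=
  mapOp_mem_of_graded (V := cone φ)
    (fun {i v} h => (show v ∈ (V.gr (i + 1)).prod (W.gr i) from h).2) (fun _ _ => rfl) (fun _ _ => rfl) (fun _ _ => rfl) hf

theorem mapOp_coneInr_mem {p : ℤ} {f : StdComplex (LieAlg K) →ₗ[ℂ] (K → V.carrier)}
    (hf : f ∈ component V (p + 1)) :
    mapOp (V := V.shift 1) (coneInr φ) f ∈ component (cone φ) p :=
  mapOp_mem_of_graded (V := V.shift 1) (l := coneInr φ) (fun h => ⟨h, zero_mem _⟩)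
    (fun a _ => Prod.ext rfl (map_zero (W.π a)).symm)
    (fun k _ => Prod.ext rfl (map_zero (W.ν k)).symm)
    (fun m _ => Prod.ext rfl (map_zero (W.ω m)).symm) ((mem_component_shift 1 V).2 hf)

theorem mapOp_coneInl_mem {p : ℤ} {f : StdComplex (LieAlg K) →ₗ[ℂ] (K → W.carrier)}
    (hf : f ∈ component W p) : mapOp (coneInl φ).toLin f ∈ component (cone φ) p :=
  mapOp_mem (coneInl φ) hf

/-- The `W`-component of an element of `Γ^eq(C_φ)`. -/
def coneSndSpace : Space (cone φ) →ₗ[ℂ] Space W where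
  toFun f := Space.mk (mapOp (coneSnd φ) (val (cone φ) f)) <| by
    have h : total (cone φ) ≤ (total W).comap (mapOp (coneSnd φ)) :=
      iSup_le fun p f hf => component_le W p (mapOp_coneSnd_mem φ hf)
    exact h (val_mem f)
  map_add' f g := Space.ext (by simp only [val_mk, map_add])
  map_smul' c f := Space.ext (by simp only [val_mk, map_smul, RingHom.id_apply])

theorem val_coneSndSpace (f : Space (cone φ)) (n : StdComplex (LieAlg K)) (k : K) :
    val W (coneSndSpace φ f) n k = coneSnd φ (val (cone φ) f n k) := rfl

theorem coneSndSpace_mem {p : ℤ} {f : Space (cone φ)} (hf : f ∈ totalGr (cone φ) p) :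
    coneSndSpace φ f ∈ totalGr W p := mapOp_coneSnd_mem φ hf

/-- The `V`-component of an element of `Γ^eq(C_φ)`. -/
def coneFstSpace : Space (cone φ) →ₗ[ℂ] Space V :=
  (shiftEquiv 1 V).toLinearMap ∘ₗ mapSpace (W := V.shift 1) (coneProj φ)

theorem coneFstSpace_apply (f : Space (cone φ)) :
    coneFstSpace φ f = shiftEquiv 1 V (mapSpace (W := V.shift 1) (coneProj φ) f) := rfl

theorem val_coneFstSpace (f : Space (cone φ)) (n : StdComplex (LieAlg K)) (k : K) :
    val V (coneFstSpace φ f) n k = (coneProj φ).toLin (val (cone φ) f n k) := by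
  rw [coneFstSpace_apply, val_shiftEquiv]; rfl

theorem coneFstSpace_mem {p : ℤ} {f : Space (cone φ)} (hf : f ∈ totalGr (cone φ) p) :
    coneFstSpace φ f ∈ totalGr V (p + 1) :=
  (shiftEquiv_mem 1 V).1 ((homMap (coneProj φ)).map_mem hf)

/-- An element of `Γ^eq(C_φ)` from its components. -/
def conePair (f : Space V) (g : Space W) : Space (cone φ) :=
  Space.mk (mapOp (V := V.shift 1) (coneInr φ) (val V f) + mapOp (coneInl φ).toLin (val W g)) <| by
    refine add_mem ?_ (mapOp_total (coneInl φ) _ (val_mem g))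
    exact Submodule.iSup_induction (component V)
      (motive := fun f => mapOp (V := V.shift 1) (coneInr φ) f ∈ total (cone φ)) (val_mem f)
      -- The summand V sits in the cone as V[1], so degree p over V becomes degree p - 1.
      (fun p f hf => component_le (cone φ) (p - 1)
        (mapOp_coneInr_mem φ (by rwa [sub_add_cancel])))
      (by
        have h := map_zero (mapOp (K := K) (V := V.shift 1) (coneInr φ))
        exact h ▸ zero_mem _)
      fun f g hf hg => by
        have h := map_add (mapOp (K := K) (V := V.shift 1) (coneInr φ)) f g
        exact h ▸ add_mem hf hg

theorem val_conePair (f : Space V) (g : Space W) (n : StdComplex (LieAlg K)) (k : K) :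
    val (cone φ) (conePair φ f g) n k = (coneInr φ (val V f n k) + (coneInl φ).toLin (val W g n k)) :=
  rfl

theorem coneInr_add_coneInl (v : (cone φ).carrier) :
    coneInr φ ((coneProj φ).toLin v) + (coneInl φ).toLin (coneSnd φ v) = v :=
  Prod.ext (add_zero v.1) (zero_add v.2)

theorem coneProj_add (v : V.carrier) (w : W.carrier) :
    (coneProj φ).toLin (coneInr φ v + (coneInl φ).toLin w) = v := add_zero v

theorem coneSnd_add (v : V.carrier) (w : W.carrier) :
    coneSnd φ (coneInr φ v + (coneInl φ).toLin w) = w := zero_add w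

theorem conePair_components (f : Space (cone φ)) :
    conePair φ (coneFstSpace φ f) (coneSndSpace φ f) = f :=
  Space.ext' fun n k => by
    rw [val_conePair, val_coneFstSpace, val_coneSndSpace]
    exact coneInr_add_coneInl φ _

theorem coneFstSpace_conePair (f : Space V) (g : Space W) :
    coneFstSpace φ (conePair φ f g) = f :=
  Space.ext' fun n k => by
    rw [val_coneFstSpace, val_conePair]
    exact coneProj_add φ _ _

theorem coneSndSpace_conePair (f : Space V) (g : Space W) :
    coneSndSpace φ (conePair φ f g) = g :=
  Space.ext' fun n k => by
    rw [val_coneSndSpace, val_conePair]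
    exact coneSnd_add φ _ _

theorem conePair_mem {p : ℤ} {f : Space V} {g : Space W} (hf : f ∈ totalGr V (p + 1))
    (hg : g ∈ totalGr W p) : conePair φ f g ∈ totalGr (cone φ) p :=
  mem_totalGr.2 (add_mem (mapOp_coneInr_mem φ hf) (mapOp_coneInl_mem φ hg))

/-- The decomposition of `Γ^eq(C_φ)` into components. -/
def coneEquiv : Space (cone φ) ≃ₗ[ℂ] Space V × Space W :=
  LinearEquiv.ofBijective ((coneFstSpace φ).prod (coneSndSpace φ))
    ⟨fun f g h => by
      rw [← conePair_components φ f, ← conePair_components φ g]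
      exact congrArg₂ (conePair φ) (congrArg Prod.fst h) (congrArg Prod.snd h),
    fun x => ⟨conePair φ x.1 x.2,
      Prod.ext (coneFstSpace_conePair φ _ _) (coneSndSpace_conePair φ _ _)⟩⟩

theorem coneEquiv_mem {p : ℤ} {f : Space (cone φ)} : f ∈ totalGr (cone φ) p ↔
    coneEquiv φ f ∈ (totalGr V (p + 1)).prod (totalGr W p) := by
  constructor
  · exact fun hf => ⟨coneFstSpace_mem φ hf, coneSndSpace_mem φ hf⟩
  · intro h
    rw [← conePair_components φ f]
    exact conePair_mem φ h.1 h.2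

/-- The projection of the cone to V[1] is a morphism of modules, so its image under Γ^eq respects
all the structure, and the translation isomorphism carries the result to Γ^eq(V)[1]. The three
lemmas for π, ν and ω have the same reason. -/
theorem coneFstSpace_d (f : Space (cone φ)) :
    coneFstSpace φ (dΓ (cone φ) f) = -dΓ V (coneFstSpace φ f) := by
  have h : mapSpace (W := V.shift 1) (coneProj φ) (dΓ (cone φ) f) =
    dΓ (V.shift 1) (mapSpace (W := V.shift 1) (coneProj φ) f) := (homMap (coneProj φ)).map_d f
  rw [coneFstSpace_apply, h, shiftEquiv_d, sgn_one, neg_one_smul, coneFstSpace_apply]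

theorem coneFstSpace_π (a : A) (f : Space (cone φ)) :
    coneFstSpace φ (πΓ (cone φ) a f) = πΓ V a (coneFstSpace φ f) := by
  have h : mapSpace (W := V.shift 1) (coneProj φ) (πΓ (cone φ) a f) =
    πΓ (V.shift 1) a (mapSpace (W := V.shift 1) (coneProj φ) f) := (homMap (coneProj φ)).map_π a f
  rw [coneFstSpace_apply, h, shiftEquiv_π, coneFstSpace_apply]

theorem coneFstSpace_ν (l : K) (f : Space (cone φ)) :
    coneFstSpace φ (νΓ (cone φ) l f) = νΓ V l (coneFstSpace φ f) := by
  have h : mapSpace (W := V.shift 1) (coneProj φ) (νΓ (cone φ) l f) =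
    νΓ (V.shift 1) l (mapSpace (W := V.shift 1) (coneProj φ) f) := (homMap (coneProj φ)).map_ν l f
  rw [coneFstSpace_apply, h, shiftEquiv_ν, coneFstSpace_apply]

theorem coneFstSpace_ω (m : StdComplex (LieAlg K)) (f : Space (cone φ)) :
    coneFstSpace φ (ωΓ (cone φ) m f) = ωΓ V ((hc K).twist 1 m) (coneFstSpace φ f) := by
  have h : mapSpace (W := V.shift 1) (coneProj φ) (ωΓ (cone φ) m f) =
    ωΓ (V.shift 1) m (mapSpace (W := V.shift 1) (coneProj φ) f) := (homMap (coneProj φ)).map_ω m f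
  rw [coneFstSpace_apply, h, shiftEquiv_ω, coneFstSpace_apply]

theorem coneSnd_d (v : (cone φ).carrier) :
    coneSnd φ ((cone φ).d v) = φ.toLin ((coneProj φ).toLin v) + W.d (coneSnd φ v) := rfl

/-- The W-coordinate of the cone differential is φ(v) + dw. The term with f(dn) in the Hom
differential only joins the dw part, so φ is applied to the V-component without any sign, as in the
cone of Γ^eq(φ). -/
theorem coneSndSpace_d (f : Space (cone φ)) :
    coneSndSpace φ (dΓ (cone φ) f) =
      mapSpace φ (coneFstSpace φ f) + dΓ W (coneSndSpace φ f) := by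
  refine space_induction (p := fun f => coneSndSpace φ (dΓ (cone φ) f) =
    mapSpace φ (coneFstSpace φ f) + dΓ W (coneSndSpace φ f)) f
    (fun p f hf => Space.ext' fun n k => ?_)
    (by simp only [map_zero, add_zero]) fun f g hf hg => by simp only [map_add, hf, hg]; abel
  rw [val_coneSndSpace, dΓ_apply f n k hf, map_sub, coneSnd_d, map_smul, map_add,
    LinearMap.add_apply, Pi.add_apply, dΓ_apply _ n k (coneSndSpace_mem φ hf), val_coneSndSpace,
    val_coneSndSpace, val_mapSpace, mapOp_apply, val_coneFstSpace, add_sub_assoc]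

theorem coneSndSpace_π (a : A) (f : Space (cone φ)) :
    coneSndSpace φ (πΓ (cone φ) a f) = πΓ W a (coneSndSpace φ f) :=
  Space.ext' fun n k => by
    rw [val_coneSndSpace, πΓ_apply, πΓ_apply, val_coneSndSpace]; rfl

theorem coneSndSpace_ν (l : K) (f : Space (cone φ)) :
    coneSndSpace φ (νΓ (cone φ) l f) = νΓ W l (coneSndSpace φ f) :=
  Space.ext' fun n k => by
    rw [val_coneSndSpace, νΓ_apply, νΓ_apply, val_coneSndSpace]

theorem coneSndSpace_ω (m : StdComplex (LieAlg K)) (f : Space (cone φ)) :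
    coneSndSpace φ (ωΓ (cone φ) m f) = ωΓ W m (coneSndSpace φ f) := by
  refine grading_induction (p := fun m => ∀ f, coneSndSpace φ (ωΓ (cone φ) m f) =
    ωΓ W m (coneSndSpace φ f)) StdComplex.isInternal m (fun i m hm f => ?_)
    (fun f => by simp only [map_zero, LinearMap.zero_apply])
    (fun a b ha hb f => by simp only [map_add, LinearMap.add_apply, ha, hb]) f
  refine space_induction (p := fun f => coneSndSpace φ (ωΓ (cone φ) m f) =
    ωΓ W m (coneSndSpace φ f)) f (fun p f hf => Space.ext' fun n k => ?_)
    (by simp only [map_zero]) fun f g hf hg => by simp only [map_add, hf, hg]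
  rw [val_coneSndSpace, ωΓ_apply f n k hf hm, ωΓ_apply _ n k (coneSndSpace_mem φ hf) hm,
    val_coneSndSpace, map_smul]

/-- `Γ^eq(C_φ) ≅ C_(Γ^eq(φ))`. -/
def coneIso : obj (cone φ) ≅ cone (homMap (K := K) φ) :=
  isoOfLinearEquiv (V := obj (cone φ)) (W := cone (homMap φ)) (coneEquiv φ)
    (fun _ _ => coneEquiv_mem φ)
    (fun f => Prod.ext (coneFstSpace_d φ f) (coneSndSpace_d φ f))
    (fun a f => Prod.ext (coneFstSpace_π φ a f) (coneSndSpace_π φ a f))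
    (fun l f => Prod.ext (coneFstSpace_ν φ l f) (coneSndSpace_ν φ l f))
    (fun m f => Prod.ext (coneFstSpace_ω φ m f) (coneSndSpace_ω φ m f))

end Cone

end Zuckerman

/-! ## Exactness -/

namespace Zuckerman

open StdComplex AKDModule

variable {A : Type w} {K T : Type u} [Ring A] [Algebra ℂ A] [Group K] [AffineAlgebraicGroup K]
  [Group T] [AffineAlgebraicGroup T] (P : HCPair A K) (γ : GroupMorphism T K)

variable {P γ} in
/-- `Γ^eq` maps standard triangles to standard triangles. -/
def standardTriangleIso {V W : AKDModule.{u, u} (P.restrict γ) (hc T)} (φ : V ⟶ W) :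
    (zuckerman P γ).mapTriangle.obj (standardTriangle φ) ≅
      standardTriangle ((zuckerman P γ).map φ) :=
  Pretriangulated.Triangle.isoMk _ _ (Iso.refl _) (Iso.refl _) (coneIso φ)
    ((Category.comp_id _).trans (Category.id_comp _).symm)
    -- An element of Γ^eq(W) is included in the cone with zero V-component.
    (hom_ext fun f => by
      have h : coneEquiv φ (mapSpace (coneInl φ) f) = (0, f) :=
        Prod.ext (Space.ext' fun n k => by
          change val V (coneFstSpace φ _) n k = 0
          rw [val_coneFstSpace]
          rfl) rfl
      exact h)
    -- The third morphism of the image triangle is Γ^eq of the projection followed by the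
    -- translation isomorphism. The V-component of `coneIso` was defined as that same composite, so
    -- the square holds by definition.
    (by
      refine (congrArg (_ ≫ ·) (CategoryTheory.Functor.map_id _ _)).trans ?_
      exact (Category.comp_id _).trans rfl)

/-- The translation structure is the one descended from modules. The comparison of the two
composites with `toHo` therefore respects translation, as is needed to compare them on triangles. -/
instance commShift_zuckermanHo : (zuckermanHo P γ).CommShift ℤ :=
  CategoryTheory.Quotient.liftCommShift (zuckerman P γ ⋙ toHo P (hc K)) Homotopic ℤ
    fun _ _ _ _ H => CategoryTheory.Quotient.sound Homotopic (homMap_homotopic H)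

/-- The functors `Γ^eq` on modules and between homotopy categories have the same effect on
triangles. -/
def mapTriangleIso (Δ : Pretriangulated.Triangle (AKDModule.{u, u} (P.restrict γ) (hc T))) :
    (zuckermanHo P γ).mapTriangle.obj ((toHo (P.restrict γ) (hc T)).mapTriangle.obj Δ) ≅
      (toHo P (hc K)).mapTriangle.obj ((zuckerman P γ).mapTriangle.obj Δ) :=
  (Functor.mapTriangleCompIso _ _).symm.app Δ ≪≫
    (Functor.mapTriangleIso (CategoryTheory.Quotient.lift.isLift Homotopic
      (zuckerman P γ ⋙ toHo P (hc K)) fun _ _ _ _ H =>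
        CategoryTheory.Quotient.sound Homotopic (homMap_homotopic H))).app Δ ≪≫
    (Functor.mapTriangleCompIso _ _).app Δ

/-- A triangle isomorphic to the image of the standard triangle of φ is sent to one isomorphic to
the image of the standard triangle of Γ^eq(φ), by `standardTriangleIso`. -/
theorem zuckermanHo_isExactFunctor : IsExactFunctor (zuckermanHo P γ) := by
  refine ⟨inferInstance, fun Δ ⟨V, W, φ, ⟨e⟩⟩ => ?_⟩
  exact ⟨_, _, (zuckerman P γ).map φ, ⟨(zuckermanHo P γ).mapTriangle.mapIso e ≪≫
    mapTriangleIso P γ _ ≪≫ (toHo P (hc K)).mapTriangle.mapIso (standardTriangleIso φ)⟩⟩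

end Zuckerman

end

end HC

/-! ### The proposition. -/

theorem mainTheorem9 {A : Type w} {K T : Type u} [Ring A] [Algebra ℂ A]
    [Group K] [HC.AffineAlgebraicGroup K] [Group T] [HC.AffineAlgebraicGroup T]
    (P : HC.HCPair A K) (γ : HC.GroupMorphism T K) (hγ : Function.Injective γ.differential) :
    ∃ G : HC.AKDModule.HoCat.{u, u} (P.restrict γ) (HC.StdComplex.hc T) ⥤
        HC.AKDModule.HoCat.{u, u} P (HC.StdComplex.hc K),
      HC.AKDModule.toHo (P.restrict γ) (HC.StdComplex.hc T) ⋙ G =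
        HC.zuckerman P γ ⋙ HC.AKDModule.toHo P (HC.StdComplex.hc K) ∧
      HC.IsExactFunctor G ∧
      Nonempty (HC.forgetHo P γ ⊣ G) :=
  ⟨HC.zuckermanHo P γ, CategoryTheory.Quotient.lift_spec _ _ _,
    HC.Zuckerman.zuckermanHo_isExactFunctor P γ, ⟨HC.zuckermanHoAdjunction P γ⟩⟩
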